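/- Let $\Lambda$ be an artin algebra, i.e. a ring that is finitely generated as a module over a commutative artinian ring $R$ mapping to its centre, and let $\mathrm{mod}\,\Lambda$ be the category of finitely generated left $\Lambda$-modules. Let $P$ be a finitely generated projective $\Lambda$-module (so that its trace in $\Lambda$ is an idempotent ideal; e.g. $P=\Lambda e$ with $e$ idempotent), let $\Gamma=\mathrm{End}_\Lambda(P)^{op}$, and let $I$ be an injective envelope of $P/rP$, where $r$ is the radical of $\Lambda$. For $0\le k\le\infty$ let $\mathbb P_k$ be the full subcategory of those $X$ in $\mathrm{mod}\,\Lambda$ that have a projective resolution $\cdots\to P_1\to P_0\to X\to 0$ in $\mathrm{mod}\,\Lambda$ with $P_i\in\mathrm{add}\,P$ for all $0\le i\le k$ (for all $i\ge 0$ if $k=\infty$), and let $\mathbb I_k$ be the full subcategory of those $X$ that have an injective resolution $0\to X\to I_0\to I_1\to\cdots$ in $\mathrm{mod}\,\Lambda$ with $I_i\in\mathrm{add}\,I$ for all $0\le i\le k$ (for all $i \ge 0$ if $k=\infty$). For any artin algebra $\Delta$, let $K_0$ be the abelian group generated by the symbols $[M]$, $M$ in $\mathrm{mod}\,\Delta$,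 modulo $[C]=[A]+[B]$ if $C\simeq A\oplus B$, and $[Q]=0$ if $Q$ is projective. Let $\Omega:K_0\to K_0$ be the homomorphism with $\Omega[M]=[\Omega M]$, where $\Omega M$ is the kernel of a projective cover of $M$, and let $\langle\mathrm{add}\,M\rangle\subseteq K_0$ be the subgroup generated by the classes of the indecomposable direct summands of $M$. Then $\phi_l(M)$ is the smallest $n\ge0$ such that $\Omega:\Omega^s\langle\mathrm{add}\,M\rangle\to\Omega^{s+1}\langle\mathrm{add}\,M\rangle$ is an isomorphism for all $s\ge n$, and $$\psi_l(M)=\phi_l(M)+\sup\{\mathrm{pd}\,X : X \text{ a direct summand of } \Omega^{\phi_l(M)}(M),\ \mathrm{pd}\,X<\infty\},$$ where the zero summand contributes $0$. The functions $\phi_r,\psi_r$ are defined dually, with injective modules, cosyzygies (cokernels of injective envelopes) and injective dimension in place of projective modules, syzygies and projective dimension. Let $\phi_l\dim\Delta=\sup\{\phi_l(M): M\in\mathrm{mod}\,\Delta\}\in\mathbb N\cup\{\infty\}$, and define $\psi_l\dim\Delta$, $\phi_r\dim\Delta$, $\psi_r\dim\Delta$ in the same way. (a) If $\mathbb P_1=\mathbb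 P_\infty$, then $\phi_l\dim\Gamma\le\phi_l\dim\Lambda$ and $\psi_l\dim\Gamma\le\psi_l\dim\Lambda$. (b) If $\mathbb I_1=\mathbb I_\infty$, then $\phi_r\dim\Gamma\le\phi_r\dim\Lambda$ and $\psi_r\dim\Gamma\le\psi_r\dim\Lambda$. -/

import Mathlib

universe u v

noncomputable section

namespace IgusaTodorov

/-! Throughout, `FGModuleCat.{u} Λ` is the category `mod Λ` of finitely generated left modules
over a ring `Λ : Type u`. -/

/-! ### Projective covers, injective envelopes, syzygies and cosyzygies -/

/-- `f : Q → M` is a projective cover: `Q` is projective and `f` is an epimorphism with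
superfluous kernel. -/
def IsProjectiveCover {Λ : Type u} [Ring Λ] {Q M : Type u} [AddCommGroup Q] [Module Λ Q]
    [AddCommGroup M] [Module Λ M] (f : Q →ₗ[Λ] M) : Prop :=
  Module.Projective Λ Q ∧ Function.Surjective f ∧
    ∀ N : Submodule Λ Q, N ⊔ LinearMap.ker f = ⊤ → N = ⊤

/-- `f : M → J` is an injective envelope: `J` is injective and `f` is a monomorphism with
essential image. -/
def IsInjectiveEnvelope {Λ : Type u} [Ring Λ] {M J : Type u} [AddCommGroup M] [Module Λ M]
    [AddCommGroup J] [Module Λ J] (f : M →ₗ[Λ] J) : Prop :=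
  Module.Injective Λ J ∧ Function.Injective f ∧
    ∀ N : Submodule Λ J, N ⊓ LinearMap.range f = ⊥ → N = ⊥

/-- `K` is (isomorphic to) the syzygy `Ω M`, the kernel of a projective cover of `M`. -/
def IsSyzygy {Λ : Type u} [Ring Λ] (M K : FGModuleCat.{u} Λ) : Prop :=
  ∃ (Q : FGModuleCat.{u} Λ) (f : Q →ₗ[Λ] M),
    IsProjectiveCover f ∧ Nonempty (K ≃ₗ[Λ] LinearMap.ker f)

/-- `C` is (isomorphic to) the cosyzygy `Ω⁻¹ M`, the cokernel of an injective envelope of `M`. -/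
def IsCosyzygy {Λ : Type u} [Ring Λ] (M C : FGModuleCat.{u} Λ) : Prop :=
  ∃ (J : FGModuleCat.{u} Λ) (f : M →ₗ[Λ] J),
    IsInjectiveEnvelope f ∧ Nonempty (C ≃ₗ[Λ] (J ⧸ LinearMap.range f))

/-- Iteration of a relation `S` on `mod Λ` up to isomorphism. For `S = IsSyzygy` this says that
`N` is isomorphic to `Ωⁿ M`, and for `S = IsCosyzygy` that `N` is isomorphic to `Ω⁻ⁿ M`. -/
def IsIterate {Λ : Type u} [Ring Λ] (S : FGModuleCat.{u} Λ → FGModuleCat.{u} Λ → Prop) :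
    ℕ → FGModuleCat.{u} Λ → FGModuleCat.{u} Λ → Prop
  | 0, M, N => Nonempty (M ≃ₗ[Λ] N)
  | n + 1, M, N => ∃ L : FGModuleCat.{u} Λ, IsIterate S n M L ∧ S L N

/-- `X` is (isomorphic to) a direct summand of `M`. -/
def IsSummand {Λ : Type u} [Ring Λ] (X M : Type u) [AddCommGroup X] [Module Λ X]
    [AddCommGroup M] [Module Λ M] : Prop :=
  ∃ (i : X →ₗ[Λ] M) (p : M →ₗ[Λ] X), p ∘ₗ i = LinearMap.id

/-- `M` is an indecomposable module: nonzero, and without nontrivial decomposition. -/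
def IsIndecomposable {Λ : Type u} [Ring Λ] (M : Type u) [AddCommGroup M] [Module Λ M] : Prop :=
  Nontrivial M ∧ ∀ A B : Submodule Λ M, IsCompl A B → A = ⊥ ∨ B = ⊥

/-! ### The group `K₀` and the Igusa-Todorov functions

The two versions are treated at once. `Z` is the class of modules that are killed in `K₀` (the
projective modules, resp. the injective modules), and `S M N` says that `N` is the syzygy
(resp. cosyzygy) of `M`. -/

/-- The relations `[C] = [A] + [B]` if `C ≃ A ⊕ B`, and `[Q] = 0` if `Q` is in `Z`. -/
def relations {Λ : Type u} [Ring Λ] (Z : FGModuleCat.{u} Λ → Prop) :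
    AddSubgroup (FreeAbelianGroup (FGModuleCat.{u} Λ)) :=
  AddSubgroup.closure
    ({x | ∃ A B C : FGModuleCat.{u} Λ, Nonempty (C ≃ₗ[Λ] (A × B)) ∧
        x = FreeAbelianGroup.of C - (FreeAbelianGroup.of A + FreeAbelianGroup.of B)} ∪
      {x | ∃ Q : FGModuleCat.{u} Λ, Z Q ∧ x = FreeAbelianGroup.of Q})

/-- The abelian group generated by the symbols `[M]`, with `M` in `mod Λ`, modulo `relations Z`. -/
abbrev K0 {Λ : Type u} [Ring Λ] (Z : FGModuleCat.{u} Λ → Prop) : Type (u + 1) :=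
  FreeAbelianGroup (FGModuleCat.{u} Λ) ⧸ relations Z

/-- The class `[M]`. -/
def K0.cls {Λ : Type u} [Ring Λ] (Z : FGModuleCat.{u} Λ → Prop) (M : FGModuleCat.{u} Λ) : K0 Z :=
  QuotientAddGroup.mk (FreeAbelianGroup.of M)

open Classical in
/-- The endomorphism `Ω` of `K₀` induced by the (co)syzygy, i.e. the group homomorphism with
`Ω [M] = [N]` whenever `N` is the (co)syzygy of `M`. Over an artin algebra every finitely
generated module has a projective cover and an injective envelope in `mod Λ`, these are unique up
to isomorphism and compatible with direct sums, so there is exactly one such homomorphism. (Over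
a ring without such a homomorphism the value is `0`.) -/
def K0.shift {Λ : Type u} [Ring Λ] (Z : FGModuleCat.{u} Λ → Prop)
    (S : FGModuleCat.{u} Λ → FGModuleCat.{u} Λ → Prop) : K0 Z →+ K0 Z :=
  if h : ∃ ω : K0 Z →+ K0 Z, ∀ M N : FGModuleCat.{u} Λ, S M N → ω (K0.cls Z M) = K0.cls Z N
  then h.choose else 0

/-- The subgroup `⟨add M⟩` of `K₀` generated by the classes of the indecomposable summands
of `M`. -/
def K0.addClosure {Λ : Type u} [Ring Λ] (Z : FGModuleCat.{u} Λ → Prop) (M : FGModuleCat.{u} Λ) :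
    AddSubgroup (K0 Z) :=
  AddSubgroup.closure {x | ∃ X : FGModuleCat.{u} Λ,
    IsIndecomposable (Λ := Λ) X ∧ IsSummand (Λ := Λ) X M ∧ x = K0.cls Z X}

/-- The subgroup `Ωˢ ⟨add M⟩` of `K₀`. -/
def K0.shiftAddClosure {Λ : Type u} [Ring Λ] (Z : FGModuleCat.{u} Λ → Prop)
    (S : FGModuleCat.{u} Λ → FGModuleCat.{u} Λ → Prop) (M : FGModuleCat.{u} Λ) :
    ℕ → AddSubgroup (K0 Z)
  | 0 => K0.addClosure Z M
  | s + 1 => (K0.shiftAddClosure Z S M s).map (K0.shift Z S)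

/-- The smallest `n` such that `Ω : Ωˢ ⟨add M⟩ → Ωˢ⁺¹ ⟨add M⟩` is an isomorphism for all
`s ≥ n`. -/
def phi {Λ : Type u} [Ring Λ] (Z : FGModuleCat.{u} Λ → Prop)
    (S : FGModuleCat.{u} Λ → FGModuleCat.{u} Λ → Prop) (M : FGModuleCat.{u} Λ) : ℕ :=
  sInf {n : ℕ | ∀ s, n ≤ s → Set.BijOn (K0.shift Z S)
    (K0.shiftAddClosure Z S M s : Set (K0 Z)) (K0.shiftAddClosure Z S M (s + 1) : Set (K0 Z))}

/-- `phi M` plus the supremum of the finite values of `dim X`, where `X` runs through the direct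
summands of the `phi M`-th (co)syzygy of `M`. The supremum is taken in `ℕ∞`, and the zero summand
contributes nothing. -/
def psi {Λ : Type u} [Ring Λ] (Z : FGModuleCat.{u} Λ → Prop)
    (S : FGModuleCat.{u} Λ → FGModuleCat.{u} Λ → Prop)
    (dim : FGModuleCat.{u} Λ → WithBot ℕ∞) (M : FGModuleCat.{u} Λ) : ℕ∞ :=
  (phi Z S M : ℕ∞) + sSup {l : ℕ∞ | l ≠ ⊤ ∧ ∃ N X : FGModuleCat.{u} Λ,
    IsIterate S (phi Z S M) M N ∧ IsSummand (Λ := Λ) X N ∧ dim X = (l : WithBot ℕ∞)}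

/-- `φ_l`, defined through syzygies and `K₀` modulo projectives. -/
def phiL {Λ : Type u} [Ring Λ] (M : FGModuleCat.{u} Λ) : ℕ :=
  phi (fun Q : FGModuleCat.{u} Λ => Module.Projective Λ Q) IsSyzygy M

/-- `φ_r`, defined through cosyzygies and `K₀` modulo injectives. -/
def phiR {Λ : Type u} [Ring Λ] (M : FGModuleCat.{u} Λ) : ℕ :=
  phi (fun J : FGModuleCat.{u} Λ => Module.Injective Λ J) IsCosyzygy M

/-- `ψ_l`, defined through syzygies and projective dimension. -/
def psiL {Λ : Type u} [Ring Λ] (M : FGModuleCat.{u} Λ) : ℕ∞ :=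
  psi (fun Q : FGModuleCat.{u} Λ => Module.Projective Λ Q) IsSyzygy
    (fun X => CategoryTheory.projectiveDimension X.obj) M

/-- `ψ_r`, defined through cosyzygies and injective dimension. -/
def psiR {Λ : Type u} [Ring Λ] (M : FGModuleCat.{u} Λ) : ℕ∞ :=
  psi (fun J : FGModuleCat.{u} Λ => Module.Injective Λ J) IsCosyzygy
    (fun X => CategoryTheory.injectiveDimension X.obj) M

/-- `φ_l dim Λ`. -/
def phiLDim (Λ : Type u) [Ring Λ] : ℕ∞ := ⨆ M : FGModuleCat.{u} Λ, (phiL M : ℕ∞)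

/-- `φ_r dim Λ`. -/
def phiRDim (Λ : Type u) [Ring Λ] : ℕ∞ := ⨆ M : FGModuleCat.{u} Λ, (phiR M : ℕ∞)

/-- `ψ_l dim Λ`. -/
def psiLDim (Λ : Type u) [Ring Λ] : ℕ∞ := ⨆ M : FGModuleCat.{u} Λ, psiL M

/-- `ψ_r dim Λ`. -/
def psiRDim (Λ : Type u) [Ring Λ] : ℕ∞ := ⨆ M : FGModuleCat.{u} Λ, psiR M

/-! ### The subcategories `ℙ_k` and `𝕀_k` -/

/-- `X` is in `add M`: it is a direct summand of a finite direct sum of copies of `M`. -/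
def InAdd {Λ : Type u} [Ring Λ] (M X : Type u) [AddCommGroup M] [Module Λ M]
    [AddCommGroup X] [Module Λ X] : Prop :=
  ∃ n : ℕ, IsSummand (Λ := Λ) X (Fin n → M)

/-- `ℙ_k` (`0 ≤ k ≤ ∞`): the modules `X` in `mod Λ` having a projective resolution
`⋯ → Q 1 → Q 0 → X → 0` with `Q i` in `add P` for all `i ≤ k`. -/
def PPres {Λ : Type u} [Ring Λ] (P : Type u) [AddCommGroup P] [Module Λ P] (k : ℕ∞) :
    Set (FGModuleCat.{u} Λ) :=
  {X | ∃ (Q : ℕ → FGModuleCat.{u} Λ) (ε : Q 0 →ₗ[Λ] X) (d : ∀ n, Q (n + 1) →ₗ[Λ] Q n),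
    (∀ n, Module.Projective Λ (Q n)) ∧ Function.Surjective ε ∧ Function.Exact (d 0) ε ∧
    (∀ n, Function.Exact (d (n + 1)) (d n)) ∧
    ∀ i : ℕ, (i : ℕ∞) ≤ k → InAdd (Λ := Λ) P (Q i)}

/-- `𝕀_k` (`0 ≤ k ≤ ∞`): the modules `X` in `mod Λ` having an injective resolution
`0 → X → J 0 → J 1 → ⋯` with `J i` in `add I` for all `i ≤ k`. -/
def IIres {Λ : Type u} [Ring Λ] (I : Type u) [AddCommGroup I] [Module Λ I] (k : ℕ∞) :
    Set (FGModuleCat.{u} Λ) :=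
  {X | ∃ (J : ℕ → FGModuleCat.{u} Λ) (η : X →ₗ[Λ] J 0) (d : ∀ n, J n →ₗ[Λ] J (n + 1)),
    (∀ n, Module.Injective Λ (J n)) ∧ Function.Injective η ∧ Function.Exact η (d 0) ∧
    (∀ n, Function.Exact (d n) (d (n + 1))) ∧
    ∀ i : ℕ, (i : ℕ∞) ≤ k → InAdd (Λ := Λ) I (J i)}

end IgusaTodorov

end

/-! Write Γ for `End(P)ᵒᵖ`. The functor Hom(P, -) identifies ℙ₁ with mod Γ. By a Yoneda argument it
is fully faithful on maps out of P, hence on maps out of add P; since P is projective the functor is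
exact, so this passes to cokernels of maps in add P. Conversely, a presentation of a Γ-module by
modules Hom(P, Pᵐ) → Hom(P, Pⁿ) comes from a map Pᵐ → Pⁿ, and Hom(P, -) sends its cokernel to the
given module.

If ℙ₁ = ℙ_∞, the first term of a resolution by add P has a kernel that is again in ℙ₁. The
projective cover is a retract of that term, so it lies in add P and the syzygy lies in ℙ₁. Over
artinian rings a projective cover is the same as a right minimal epimorphism from a projective
module, a condition that full faithfulness transports. So the equivalence commutes with Ω, and it
preserves and reflects projectivity and hence projective dimension.

It remains to compare the groups K₀. The inverse equivalence induces a homomorphism from K₀ of Γ to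
K₀ of Λ. It commutes with Ω and carries ⟨add Hom(P, M)⟩ onto ⟨add M⟩ for M in ℙ₁. A Krull-Schmidt
argument (`IsShift.common_summand`) shows that it is injective, so Ω is injective on corresponding
subgroups at the same stages. Hence φ takes the same value on M and Hom(P, M), and ψ cannot be
larger on Hom(P, M) than on M. As every Γ-module is of this form, the inequalities between suprema
follow. This comparison is done once, for `IsShiftEquivOn`.

Part (b) uses the same functor Hom(P, -), now on 𝕀₁, and no duality. Two facts about the envelope I
of the top of P replace Yoneda: every nonzero submodule of I receives a nonzero map from P, and
every nonzero map P → X stays nonzero after some X → I. They make Hom(P, -) fully faithful on maps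
into I, make Hom(P, I) injective, and embed every finitely generated Γ-module in some Hom(P, Iⁿ).
From there the argument of part (a) runs with kernels and cokernels exchanged. -/

set_option autoImplicit false

noncomputable section

namespace IgusaTodorov

/-! ### Direct summands and indecomposability -/

section Summands

variable {Λ : Type u} [Ring Λ] {X Y M N : Type u} [AddCommGroup X] [Module Λ X]
  [AddCommGroup Y] [Module Λ Y] [AddCommGroup M] [Module Λ M] [AddCommGroup N] [Module Λ N]

theorem IsSummand.trans (h : IsSummand (Λ := Λ) X M) (h' : IsSummand (Λ := Λ) M N) :
    IsSummand (Λ := Λ) X N := by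
  obtain ⟨i, p, h⟩ := h
  obtain ⟨j, q, h'⟩ := h'
  refine ⟨j ∘ₗ i, p ∘ₗ q, ?_⟩
  ext x
  have h1 := LinearMap.congr_fun h' (i x)
  have h2 := LinearMap.congr_fun h x
  simp only [LinearMap.comp_apply, LinearMap.id_apply] at *
  rw [h1, h2]

theorem IsSummand.of_equiv (e : X ≃ₗ[Λ] M) : IsSummand (Λ := Λ) X M :=
  ⟨e, e.symm, by ext x; simp⟩

theorem IsSummand.fst : IsSummand (Λ := Λ) X (X × Y) :=
  ⟨LinearMap.inl Λ X Y, LinearMap.fst Λ X Y, by ext x; simp⟩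

theorem IsSummand.projective [Module.Projective Λ M] (h : IsSummand (Λ := Λ) X M) :
    Module.Projective Λ X := by
  obtain ⟨i, p, h⟩ := h
  exact Module.Projective.of_split i p h

theorem IsSummand.injective [hM : Module.Injective Λ M] (h : IsSummand (Λ := Λ) X M) :
    Module.Injective Λ X := by
  obtain ⟨i, p, h⟩ := h
  refine ⟨fun A B _ _ _ _ f hf g => ?_⟩
  obtain ⟨k, hk⟩ := hM.out f hf (i ∘ₗ g)
  refine ⟨p ∘ₗ k, fun x => ?_⟩
  have := LinearMap.congr_fun h (g x)
  simpa [hk] using this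

/-- A summand has a complement. -/
theorem IsSummand.exists_prod (h : IsSummand (Λ := Λ) X M) :
    ∃ K : Submodule Λ M, Nonempty (M ≃ₗ[Λ] (X × K)) := by
  obtain ⟨i, p, h⟩ := h
  have h' : ∀ x, p (i x) = x := fun x => LinearMap.congr_fun h x
  refine ⟨LinearMap.ker p, ⟨LinearEquiv.ofLinearMap
    (p.prod ((LinearMap.id - i ∘ₗ p).codRestrict (LinearMap.ker p) fun x => by simp [h']))
    (i.coprod (LinearMap.ker p).subtype) ?_ ?_⟩⟩
  · ext x <;> simp [h']
  · ext x; simp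

/-- Complementary pairs of submodules correspond to idempotent endomorphisms. The formulation by
idempotents is the one that a fully faithful functor transports. -/
theorem isIndecomposable_iff : IsIndecomposable (Λ := Λ) M ↔
    Nontrivial M ∧ ∀ e : M →ₗ[Λ] M, e ∘ₗ e = e → e = 0 ∨ e = LinearMap.id := by
  refine and_congr_right fun _ => ⟨fun H e he => ?_, fun H A B hAB => ?_⟩
  · have he' : ∀ x, e (e x) = e x := fun x => LinearMap.congr_fun he x
    have hc : IsCompl (LinearMap.range e) (LinearMap.ker e) := by
      refine IsCompl.of_eq ?_ ?_
      · rw [eq_bot_iff]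
        rintro _ ⟨⟨x, rfl⟩, hx⟩
        have : e (e x) = 0 := hx
        rw [he'] at this
        simp [this]
      · rw [eq_top_iff]
        intro x _
        exact Submodule.mem_sup.2 ⟨e x, ⟨x, rfl⟩, x - e x, by simp [he'], by simp⟩
    rcases H _ _ hc with h | h
    · exact .inl (LinearMap.range_eq_bot.1 h)
    · refine .inr (LinearMap.ext fun x => ?_)
      have : e x - x ∈ LinearMap.ker e := by simp [he']
      rw [h] at this
      simpa [sub_eq_zero] using this
  · have hp := Submodule.projection_apply_mem hAB
    have hp' : ∀ x ∈ A, A.projection B hAB x = x := fun x hx =>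
      Submodule.projection_apply_of_mem_left hAB hx
    rcases H (A.projection B hAB) (LinearMap.ext fun x => hp' _ (hp x)) with h | h
    · left
      rw [eq_bot_iff]
      intro x hx
      rw [Submodule.mem_bot, ← hp' x hx, h]; rfl
    · right
      rw [eq_bot_iff]
      intro x hx
      have h1 := (Submodule.projection_apply_eq_zero_iff hAB).2 hx
      rw [h] at h1
      simpa using h1

end Summands

/-! ### The group K₀ and its shift endomorphism -/

section Grothendieck

variable {Λ : Type u} [Ring Λ] {Z : FGModuleCat.{u} Λ → Prop}

/-- The direct sum in `mod Λ`. -/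
abbrev sum (A B : FGModuleCat.{u} Λ) : FGModuleCat.{u} Λ := FGModuleCat.of Λ (A × B)

theorem K0.cls_add {A B C : FGModuleCat.{u} Λ} (e : C ≃ₗ[Λ] (A × B)) :
    K0.cls Z C = K0.cls Z A + K0.cls Z B := by
  refine (QuotientAddGroup.eq_iff_sub_mem (N := relations Z)).2 (AddSubgroup.subset_closure ?_)
  exact .inl ⟨A, B, C, ⟨e⟩, rfl⟩

theorem K0.cls_eq_zero {Q : FGModuleCat.{u} Λ} (h : Z Q) : K0.cls Z Q = 0 :=
  (QuotientAddGroup.eq_zero_iff _).2 (AddSubgroup.subset_closure (.inr ⟨Q, h, rfl⟩))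

theorem K0.cls_of_subsingleton (A : FGModuleCat.{u} Λ) [Subsingleton A] : K0.cls Z A = 0 := by
  -- A zero module is isomorphic to its own square by the diagonal, so its class is twice itself.
  have : K0.cls Z A = K0.cls Z A + K0.cls Z A := K0.cls_add
    { toFun := fun x => (x, x), invFun := fun x => x.1, map_add' := fun _ _ => rfl,
      map_smul' := fun _ _ => rfl, left_inv := fun _ => rfl,
      right_inv := fun _ => Subsingleton.elim _ _ }
  simpa using this

theorem K0.cls_congr {A B : FGModuleCat.{u} Λ} (e : A ≃ₗ[Λ] B) : K0.cls Z A = K0.cls Z B := by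
  have h : Nonempty (A ≃ₗ[Λ] (B × FGModuleCat.of Λ PUnit.{u+1})) :=
    ⟨e.trans (LinearEquiv.prodUnique (R := Λ) (M := B) (M₂ := PUnit.{u+1})).symm⟩
  have : Subsingleton (FGModuleCat.of Λ PUnit.{u+1}) :=
    inferInstanceAs (Subsingleton PUnit.{u+1})
  rw [K0.cls_add h.some, K0.cls_of_subsingleton (FGModuleCat.of Λ PUnit.{u+1}), add_zero]

/-- Additive functions on `mod Λ` that vanish on `Z` factor over `K₀`. -/
theorem K0.exists_lift {G : Type*} [AddCommGroup G] (f : FGModuleCat.{u} Λ → G)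
    (hf : ∀ A B C : FGModuleCat.{u} Λ, (C ≃ₗ[Λ] (A × B)) → f C = f A + f B)
    (hZ : ∀ Q, Z Q → f Q = 0) : ∃ φ : K0 Z →+ G, ∀ M, φ (K0.cls Z M) = f M := by
  refine ⟨QuotientAddGroup.lift _ (FreeAbelianGroup.lift f) ?_, fun M => ?_⟩
  · rw [relations, AddSubgroup.closure_le]
    rintro x (⟨A, B, C, ⟨e⟩, rfl⟩ | ⟨Q, hQ, rfl⟩)
    · simp [hf A B C e]
    · simp [hZ Q hQ]
  · exact (QuotientAddGroup.lift_mk' _ _ _).trans (FreeAbelianGroup.lift_apply_of _ _)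

theorem K0.exists_eq_sub (x : K0 Z) : ∃ A B : FGModuleCat.{u} Λ,
    x = K0.cls Z A - K0.cls Z B := by
  obtain ⟨x, rfl⟩ := QuotientAddGroup.mk_surjective x
  induction x using FreeAbelianGroup.induction_on with
  | zero => exact ⟨FGModuleCat.of Λ PUnit.{u+1}, FGModuleCat.of Λ PUnit.{u+1}, by simp⟩
  | of M =>
    have : Subsingleton (FGModuleCat.of Λ PUnit.{u+1}) :=
      inferInstanceAs (Subsingleton PUnit.{u+1})
    exact ⟨M, FGModuleCat.of Λ PUnit.{u+1}, by
      rw [K0.cls_of_subsingleton (FGModuleCat.of Λ PUnit.{u+1}), sub_zero]; rfl⟩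
  | neg M h =>
    obtain ⟨A, B, h⟩ := h
    exact ⟨B, A, by rw [QuotientAddGroup.mk_neg, h, neg_sub]⟩
  | add x y hx hy =>
    obtain ⟨A, B, hx⟩ := hx
    obtain ⟨C, D, hy⟩ := hy
    refine ⟨sum A C, sum B D, ?_⟩
    rw [QuotientAddGroup.mk_add, hx, hy, K0.cls_add (C := sum A C) (LinearEquiv.refl Λ _),
      K0.cls_add (C := sum B D) (LinearEquiv.refl Λ _)]
    abel

/-- The properties of the pairs (projective modules, syzygies) and (injective modules, cosyzygies)
which make `K₀` and `Ω` well behaved. -/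
structure IsShift (Z : FGModuleCat.{u} Λ → Prop)
    (S : FGModuleCat.{u} Λ → FGModuleCat.{u} Λ → Prop) : Prop where
  exists_shift : ∀ M, ∃ N, S M N
  unique : ∀ {M M' N N' : FGModuleCat.{u} Λ}, (M ≃ₗ[Λ] M') → S M N → S M' N' → Nonempty (N ≃ₗ[Λ] N')
  prod : ∀ {A A' B B' : FGModuleCat.{u} Λ}, S A A' → S B B' → S (sum A B) (sum A' B')
  shift_mem : ∀ {Q N}, Z Q → S Q N → Z N
  mem_of_summand : ∀ {X Q : FGModuleCat.{u} Λ}, IsSummand (Λ := Λ) X Q → Z Q → Z X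
  mem_prod : ∀ {A B}, Z A → Z B → Z (sum A B)
  mem_of_subsingleton : ∀ A : FGModuleCat.{u} Λ, Subsingleton A → Z A

variable {S : FGModuleCat.{u} Λ → FGModuleCat.{u} Λ → Prop}

/-- The definition of `K0.shift` falls back to zero when no suitable homomorphism exists. Existence,
uniqueness and additivity of (co)syzygies produce one, so the fallback never occurs here. -/
theorem IsShift.shift_cls (h : IsShift Z S) {M N : FGModuleCat.{u} Λ} (hMN : S M N) :
    K0.shift Z S (K0.cls Z M) = K0.cls Z N := by
  have H : ∃ ω : K0 Z →+ K0 Z, ∀ M N : FGModuleCat.{u} Λ, S M N →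
      ω (K0.cls Z M) = K0.cls Z N := by
    choose σ hσ using h.exists_shift
    obtain ⟨ω, hω⟩ := K0.exists_lift (Z := Z) (fun M => K0.cls Z (σ M))
      (fun A B C e => by
        obtain ⟨e'⟩ := h.unique (M := C) (M' := sum A B) e (hσ C) (h.prod (hσ A) (hσ B))
        exact K0.cls_add e')
      (fun Q hQ => K0.cls_eq_zero (h.shift_mem hQ (hσ Q)))
    refine ⟨ω, fun M N hMN => ?_⟩
    obtain ⟨e⟩ := h.unique (LinearEquiv.refl Λ M) (hσ M) hMN
    rw [hω, K0.cls_congr e]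
  rw [K0.shift, dif_pos H]
  exact H.choose_spec M N hMN

theorem IsShift.exists_iterate (h : IsShift Z S) (n : ℕ) (M : FGModuleCat.{u} Λ) :
    ∃ N, IsIterate S n M N := by
  induction n with
  | zero => exact ⟨M, ⟨LinearEquiv.refl Λ M⟩⟩
  | succ n ih =>
    obtain ⟨L, hL⟩ := ih
    obtain ⟨N, hN⟩ := h.exists_shift L
    exact ⟨N, L, hL, hN⟩

theorem IsShift.iterate_unique (h : IsShift Z S) {n : ℕ} {M M' N N' : FGModuleCat.{u} Λ}
    (e : M ≃ₗ[Λ] M') (hN : IsIterate S n M N) (hN' : IsIterate S n M' N') :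
    Nonempty (N ≃ₗ[Λ] N') := by
  induction n generalizing N N' with
  | zero =>
    obtain ⟨a⟩ := hN
    obtain ⟨b⟩ := hN'
    exact ⟨a.symm.trans (e.trans b)⟩
  | succ n ih =>
    obtain ⟨L, hL, hLN⟩ := hN
    obtain ⟨L', hL', hLN'⟩ := hN'
    obtain ⟨e'⟩ := ih hL hL'
    exact h.unique e' hLN hLN'

end Grothendieck

/-- An additive functor between categories of finitely generated modules. -/
structure AddFunctor (Λ Γ : Type u) [Ring Λ] [Ring Γ] where
  obj : FGModuleCat.{u} Λ → FGModuleCat.{u} Γ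
  map : ∀ {X Y : FGModuleCat.{u} Λ}, (X →ₗ[Λ] Y) →+ (obj X →ₗ[Γ] obj Y)
  map_id : ∀ X : FGModuleCat.{u} Λ, map (LinearMap.id : X →ₗ[Λ] X) = LinearMap.id
  map_comp : ∀ {X Y W : FGModuleCat.{u} Λ} (g : Y →ₗ[Λ] W) (f : X →ₗ[Λ] Y),
    map (g ∘ₗ f) = map g ∘ₗ map f

/-! ### Comparing φ and ψ along an equivalence with a subcategory -/

section Functor

variable {Λ Γ : Type u} [Ring Λ] [Ring Γ] (F : AddFunctor Λ Γ)

namespace AddFunctor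

variable {F} in
theorem map_comp_eq_id {X Y : FGModuleCat.{u} Λ} {i : X →ₗ[Λ] Y} {p : Y →ₗ[Λ] X}
    (h : p ∘ₗ i = LinearMap.id) : F.map p ∘ₗ F.map i = LinearMap.id := by
  rw [← F.map_comp, h, F.map_id]

/-- The image of an isomorphism. -/
def mapEquiv {X Y : FGModuleCat.{u} Λ} (e : X ≃ₗ[Λ] Y) : F.obj X ≃ₗ[Γ] F.obj Y :=
  LinearEquiv.ofLinearMap (F.map (e : X →ₗ[Λ] Y)) (F.map (e.symm : Y →ₗ[Λ] X))
    (map_comp_eq_id (by ext; simp)) (map_comp_eq_id (by ext; simp))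

theorem map_isSummand {X Y : FGModuleCat.{u} Λ} (h : IsSummand (Λ := Λ) X Y) :
    IsSummand (Λ := Γ) (F.obj X) (F.obj Y) := by
  obtain ⟨i, p, h⟩ := h
  exact ⟨F.map i, F.map p, map_comp_eq_id h⟩

/-- Additive functors preserve direct sums. -/
def prodEquiv (A B : FGModuleCat.{u} Λ) :
    F.obj (sum A B) ≃ₗ[Γ] (F.obj A × F.obj B) := by
  have h1 : F.map (X := sum A B) (Y := A) (LinearMap.fst Λ A B) ∘ₗ
      F.map (X := A) (Y := sum A B) (LinearMap.inl Λ A B) = LinearMap.id :=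
    map_comp_eq_id (by ext; simp)
  have h2 : F.map (X := sum A B) (Y := B) (LinearMap.snd Λ A B) ∘ₗ
      F.map (X := B) (Y := sum A B) (LinearMap.inr Λ A B) = LinearMap.id :=
    map_comp_eq_id (by ext; simp)
  have h3 : F.map (X := sum A B) (Y := A) (LinearMap.fst Λ A B) ∘ₗ
      F.map (X := B) (Y := sum A B) (LinearMap.inr Λ A B) = 0 := by
    rw [← F.map_comp, ← F.map.map_zero]; congr 1
  have h4 : F.map (X := sum A B) (Y := B) (LinearMap.snd Λ A B) ∘ₗ
      F.map (X := A) (Y := sum A B) (LinearMap.inl Λ A B) = 0 := by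
    rw [← F.map_comp, ← F.map.map_zero]; congr 1
  have h5 : F.map (X := A) (Y := sum A B) (LinearMap.inl Λ A B) ∘ₗ
        F.map (X := sum A B) (Y := A) (LinearMap.fst Λ A B) +
      F.map (X := B) (Y := sum A B) (LinearMap.inr Λ A B) ∘ₗ
        F.map (X := sum A B) (Y := B) (LinearMap.snd Λ A B) = LinearMap.id := by
    rw [← F.map_comp, ← F.map_comp, ← F.map_id, ← map_add]
    congr 1
    ext x <;> simp
  refine LinearEquiv.ofLinearMap
    ((F.map (X := sum A B) (Y := A) (LinearMap.fst Λ A B)).prod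
      (F.map (X := sum A B) (Y := B) (LinearMap.snd Λ A B)))
    ((F.map (X := A) (Y := sum A B) (LinearMap.inl Λ A B)).coprod
      (F.map (X := B) (Y := sum A B) (LinearMap.inr Λ A B))) ?_ ?_
  · apply LinearMap.prod_ext
    · ext x
      · simpa using LinearMap.congr_fun h1 x
      · simpa using LinearMap.congr_fun h4 x
    · ext x
      · simpa using LinearMap.congr_fun h3 x
      · simpa using LinearMap.congr_fun h2 x
  · ext x
    simpa using LinearMap.congr_fun h5 x

end AddFunctor

theorem phi_congr {Z : FGModuleCat.{u} Λ → Prop}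
    {S : FGModuleCat.{u} Λ → FGModuleCat.{u} Λ → Prop} {M N : FGModuleCat.{u} Λ}
    (e : M ≃ₗ[Λ] N) : phi Z S M = phi Z S N := by
  have h0 : K0.addClosure Z M = K0.addClosure Z N := by
    unfold K0.addClosure
    congr 1
    ext x
    exact ⟨fun ⟨X, hX, h, hx⟩ => ⟨X, hX, h.trans (.of_equiv e), hx⟩,
      fun ⟨X, hX, h, hx⟩ => ⟨X, hX, h.trans (.of_equiv e.symm), hx⟩⟩
  have h1 : ∀ s, K0.shiftAddClosure Z S M s = K0.shiftAddClosure Z S N s := fun s => by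
    induction s with
    | zero => exact h0
    | succ s ih => rw [K0.shiftAddClosure, K0.shiftAddClosure, ih]
  simp only [phi, h1]

/-- `F` restricts to an equivalence between the full subcategory `C`, which is closed under sums
and summands, and the whole category of finitely generated modules. -/
structure IsEquivOn (F : AddFunctor Λ Γ) (C : Set (FGModuleCat.{u} Λ)) : Prop where
  mem_of_summand : ∀ {X Y : FGModuleCat.{u} Λ}, IsSummand (Λ := Λ) X Y → Y ∈ C → X ∈ C
  mem_prod : ∀ {A B}, A ∈ C → B ∈ C → sum A B ∈ C
  full : ∀ {X Y}, X ∈ C → Y ∈ C → Function.Bijective (F.map : (X →ₗ[Λ] Y) →+ _)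
  dense : ∀ Y : FGModuleCat.{u} Γ, ∃ X ∈ C, Nonempty (F.obj X ≃ₗ[Γ] Y)

namespace IsEquivOn

variable {F} {C : Set (FGModuleCat.{u} Λ)} (h : IsEquivOn F C)
include h

theorem isSummand {X Y : FGModuleCat.{u} Λ} (hX : X ∈ C) (hY : Y ∈ C)
    (hXY : IsSummand (Λ := Γ) (F.obj X) (F.obj Y)) : IsSummand (Λ := Λ) X Y := by
  obtain ⟨i, p, hip⟩ := hXY
  obtain ⟨i, rfl⟩ := (h.full hX hY).2 i
  obtain ⟨p, rfl⟩ := (h.full hY hX).2 p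
  refine ⟨i, p, (h.full hX hX).1 ?_⟩
  rw [F.map_comp, hip, F.map_id]

theorem nonempty_equiv {X Y : FGModuleCat.{u} Λ} (hX : X ∈ C) (hY : Y ∈ C)
    (e : F.obj X ≃ₗ[Γ] F.obj Y) : Nonempty (X ≃ₗ[Λ] Y) := by
  obtain ⟨i, hi⟩ := (h.full hX hY).2 (e : F.obj X →ₗ[Γ] F.obj Y)
  obtain ⟨p, hp⟩ := (h.full hY hX).2 (e.symm : F.obj Y →ₗ[Γ] F.obj X)
  refine ⟨LinearEquiv.ofLinearMap i p ((h.full hY hY).1 ?_) ((h.full hX hX).1 ?_)⟩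
  · rw [F.map_comp, hi, hp, F.map_id]; ext; simp
  · rw [F.map_comp, hi, hp, F.map_id]; ext; simp

theorem isIndecomposable_iff {X : FGModuleCat.{u} Λ} (hX : X ∈ C) :
    IsIndecomposable (Λ := Γ) (F.obj X) ↔ IsIndecomposable (Λ := Λ) X := by
  have hid : ∀ e : X →ₗ[Λ] X, F.map e = LinearMap.id ↔ e = LinearMap.id := fun e => by
    rw [← F.map_id]; exact (h.full hX hX).1.eq_iff
  have hz : ∀ e : X →ₗ[Λ] X, F.map e = 0 ↔ e = 0 := fun e => by
    rw [← F.map.map_zero (M := X →ₗ[Λ] X)]; exact (h.full hX hX).1.eq_iff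
  have hn : ∀ (Δ : Type u) [Ring Δ] (M : FGModuleCat.{u} Δ),
      Nontrivial M ↔ (LinearMap.id : M →ₗ[Δ] M) ≠ 0 := fun Δ _ M => by
    rw [← not_subsingleton_iff_nontrivial, not_iff_comm, not_ne_iff]
    exact ⟨fun H => ⟨fun x y => by
      rw [← LinearMap.id_apply (R := Δ) x, ← LinearMap.id_apply (R := Δ) y, H]; rfl⟩,
      fun H => by ext x; exact Subsingleton.elim _ _⟩
  rw [IgusaTodorov.isIndecomposable_iff, IgusaTodorov.isIndecomposable_iff, hn, hn,
    ← F.map_id, Ne, hz]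
  refine and_congr_right fun _ => ⟨fun H e he => ?_, fun H e he => ?_⟩
  · have := H (F.map e) (by rw [← F.map_comp, he])
    rwa [hz, F.map_id, hid] at this
  · obtain ⟨e, rfl⟩ := (h.full hX hX).2 e
    rw [F.map_id, hz, hid]
    exact H e ((h.full hX hX).1 (by rw [F.map_comp, he]))

end IsEquivOn

/-- `F` restricts to an equivalence on `C` that is compatible with the data defining the
Igusa-Todorov functions. -/
structure IsShiftEquivOn (F : AddFunctor Λ Γ) (C : Set (FGModuleCat.{u} Λ))
    (Z : FGModuleCat.{u} Λ → Prop) (S : FGModuleCat.{u} Λ → FGModuleCat.{u} Λ → Prop)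
    (Z' : FGModuleCat.{u} Γ → Prop) (S' : FGModuleCat.{u} Γ → FGModuleCat.{u} Γ → Prop) : Prop
    extends IsEquivOn F C where
  isShift : IsShift Z S
  isShift' : IsShift Z' S'
  shift_mem : ∀ {X K}, X ∈ C → S X K → K ∈ C
  map_shift : ∀ {X K}, X ∈ C → S X K → S' (F.obj X) (F.obj K)
  map_mem : ∀ {X}, X ∈ C → (Z' (F.obj X) ↔ Z X)
  common_summand : ∀ {A B : FGModuleCat.{u} Λ}, K0.cls Z A = K0.cls Z B →
    ∃ A' B' D : FGModuleCat.{u} Λ, Z A' ∧ Z B' ∧ Nonempty (A ≃ₗ[Λ] (A' × D)) ∧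
      Nonempty (B ≃ₗ[Λ] (B' × D))

namespace IsShiftEquivOn

variable {F} {C : Set (FGModuleCat.{u} Λ)}
    {Z : FGModuleCat.{u} Λ → Prop} {S : FGModuleCat.{u} Λ → FGModuleCat.{u} Λ → Prop}
    {Z' : FGModuleCat.{u} Γ → Prop} {S' : FGModuleCat.{u} Γ → FGModuleCat.{u} Γ → Prop}

/-- The map is induced by a quasi-inverse `G` of `F`. If `G A` and `G B` have the same class, they
share a summand `D` with complements in `Z`. Those complements are in `C` as summands, so `F` sends
them into `Z'`, and the classes of `A` and `B` both equal that of `F D`. -/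
theorem exists_embedding (h : IsShiftEquivOn F C Z S Z' S') :
    ∃ g : K0 Z' →+ K0 Z, Function.Injective g ∧
      ∀ X ∈ C, g (K0.cls Z' (F.obj X)) = K0.cls Z X := by
  choose G hG e using h.dense
  obtain ⟨g, hg⟩ := K0.exists_lift (Z := Z') (fun Y => K0.cls Z (G Y))
    (fun A B Y a => by
      obtain ⟨b⟩ := h.nonempty_equiv (hG Y) (h.mem_prod (hG A) (hG B))
        ((e Y).some.trans (a.trans (((e A).some.symm.prodCongr (e B).some.symm).trans
          (F.prodEquiv _ _).symm)))
      exact K0.cls_add b)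
    (fun Q hQ => K0.cls_eq_zero ((h.map_mem (hG Q)).1
      (h.isShift'.mem_of_summand (.of_equiv (e Q).some) hQ)))
  refine ⟨g, (injective_iff_map_eq_zero g).2 fun x hx => ?_, fun X hX => ?_⟩
  · obtain ⟨A, B, rfl⟩ := K0.exists_eq_sub x
    rw [map_sub, hg, hg, sub_eq_zero] at hx
    obtain ⟨A', B', D, hA', hB', ⟨a⟩, ⟨b⟩⟩ := h.common_summand hx
    have hA'C : A' ∈ C := h.mem_of_summand (IsSummand.fst.trans (.of_equiv a.symm)) (hG A)
    have hB'C : B' ∈ C := h.mem_of_summand (IsSummand.fst.trans (.of_equiv b.symm)) (hG B)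
    have ha := K0.cls_add (Z := Z') ((F.mapEquiv (Y := sum A' D) a).trans (F.prodEquiv A' D))
    have hb := K0.cls_add (Z := Z') ((F.mapEquiv (Y := sum B' D) b).trans (F.prodEquiv B' D))
    rw [K0.cls_eq_zero ((h.map_mem hA'C).2 hA'), zero_add] at ha
    rw [K0.cls_eq_zero ((h.map_mem hB'C).2 hB'), zero_add] at hb
    rw [← K0.cls_congr (e A).some, ← K0.cls_congr (e B).some, ha, hb, sub_self]
  · obtain ⟨a⟩ := h.nonempty_equiv (hG _) hX (e (F.obj X)).some
    rw [hg, K0.cls_congr a]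

theorem map_addClosure (h : IsShiftEquivOn F C Z S Z' S') {g : K0 Z' →+ K0 Z}
    (hg : ∀ X ∈ C, g (K0.cls Z' (F.obj X)) = K0.cls Z X) {M : FGModuleCat.{u} Λ} (hM : M ∈ C) :
    (K0.addClosure Z' (F.obj M)).map g = K0.addClosure Z M := by
  rw [K0.addClosure, AddMonoidHom.map_closure, K0.addClosure]
  congr 1
  ext x
  constructor
  · rintro ⟨_, ⟨Y, hY, hYM, rfl⟩, rfl⟩
    obtain ⟨X, hX, ⟨e⟩⟩ := h.dense Y
    have hXM := h.isSummand hX hM ((IsSummand.of_equiv e).trans hYM)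
    refine ⟨X, (h.isIndecomposable_iff hX).1 ?_, hXM, ?_⟩
    · rw [IgusaTodorov.isIndecomposable_iff] at hY ⊢
      refine ⟨(e.toEquiv.nontrivial_congr).2 hY.1, fun f hf => ?_⟩
      have h0 := hY.2 ((e : F.obj X →ₗ[Γ] Y) ∘ₗ f ∘ₗ (e.symm : Y →ₗ[Γ] F.obj X)) (by
        ext y
        have := LinearMap.congr_fun hf (e.symm y)
        simp only [LinearMap.comp_apply] at this
        simp [this])
      refine h0.imp (fun h1 => ?_) fun h1 => ?_
      · ext x
        have := LinearMap.congr_fun h1 (e x)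
        simpa using this
      · ext x
        have := LinearMap.congr_fun h1 (e x)
        simpa using this
    · rw [← hg X hX, K0.cls_congr e]
  · rintro ⟨X, hX, hXM, rfl⟩
    have hXC := h.mem_of_summand hXM hM
    exact ⟨_, ⟨F.obj X, (h.isIndecomposable_iff hXC).2 hX, F.map_isSummand hXM, rfl⟩, hg X hXC⟩

theorem shift_comm (h : IsShiftEquivOn F C Z S Z' S') {g : K0 Z' →+ K0 Z}
    (hg : ∀ X ∈ C, g (K0.cls Z' (F.obj X)) = K0.cls Z X) (x : K0 Z') :
    g (K0.shift Z' S' x) = K0.shift Z S (g x) := by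
  have key : ∀ Y : FGModuleCat.{u} Γ,
      g (K0.shift Z' S' (K0.cls Z' Y)) = K0.shift Z S (g (K0.cls Z' Y)) := fun Y => by
    obtain ⟨X, hX, ⟨e⟩⟩ := h.dense Y
    obtain ⟨K, hK⟩ := h.isShift.exists_shift X
    rw [← K0.cls_congr e, h.isShift'.shift_cls (h.map_shift hX hK), hg X hX,
      hg K (h.shift_mem hX hK), h.isShift.shift_cls hK]
  obtain ⟨A, B, rfl⟩ := K0.exists_eq_sub x
  simp only [map_sub, key]

theorem map_shiftAddClosure (h : IsShiftEquivOn F C Z S Z' S') {g : K0 Z' →+ K0 Z}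
    (hg : ∀ X ∈ C, g (K0.cls Z' (F.obj X)) = K0.cls Z X) {M : FGModuleCat.{u} Λ} (hM : M ∈ C)
    (s : ℕ) : (K0.shiftAddClosure Z' S' (F.obj M) s).map g = K0.shiftAddClosure Z S M s := by
  induction s with
  | zero => exact h.map_addClosure hg hM
  | succ s ih =>
    rw [K0.shiftAddClosure, K0.shiftAddClosure, ← ih, AddSubgroup.map_map, AddSubgroup.map_map]
    congr 1
    exact AddMonoidHom.ext fun x => h.shift_comm hg x

theorem phi_eq (h : IsShiftEquivOn F C Z S Z' S') {M : FGModuleCat.{u} Λ} (hM : M ∈ C) :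
    phi Z' S' (F.obj M) = phi Z S M := by
  obtain ⟨g, hinj, hg⟩ := h.exists_embedding
  unfold phi
  congr 1
  ext n
  refine forall₂_congr fun s _ => ?_
  -- The next subgroup is by definition the image of the previous one, so bijectivity amounts to
  -- injectivity, which passes through the injective `g`.
  have himg : ∀ {Δ : Type u} [Ring Δ] (W : FGModuleCat.{u} Δ → Prop) (T) (N : FGModuleCat.{u} Δ),
      Set.BijOn (K0.shift W T) (K0.shiftAddClosure W T N s : Set (K0 W))
        (K0.shiftAddClosure W T N (s + 1) : Set (K0 W)) ↔
      Set.InjOn (K0.shift W T) (K0.shiftAddClosure W T N s : Set (K0 W)) := fun W T N =>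
    ⟨fun H => H.injOn, fun H => H.bijOn_image⟩
  rw [himg, himg, ← h.map_shiftAddClosure hg hM]
  constructor
  · rintro H _ ⟨x, hx, rfl⟩ _ ⟨y, hy, rfl⟩ hxy
    rw [← h.shift_comm hg, ← h.shift_comm hg] at hxy
    rw [H hx hy (hinj hxy)]
  · intro H x hx y hy hxy
    refine hinj (H ⟨x, hx, rfl⟩ ⟨y, hy, rfl⟩ ?_)
    rw [← h.shift_comm hg, ← h.shift_comm hg, hxy]

theorem iterate_mem (h : IsShiftEquivOn F C Z S Z' S') {n : ℕ} {M N : FGModuleCat.{u} Λ}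
    (hM : M ∈ C) (hN : IsIterate S n M N) : N ∈ C ∧ IsIterate S' n (F.obj M) (F.obj N) := by
  induction n generalizing N with
  | zero =>
    obtain ⟨e⟩ := hN
    exact ⟨h.mem_of_summand (.of_equiv e.symm) hM, ⟨F.mapEquiv e⟩⟩
  | succ n ih =>
    obtain ⟨L, hL, hLN⟩ := hN
    obtain ⟨hLC, hFL⟩ := ih hL
    exact ⟨h.shift_mem hLC hLN, F.obj L, hFL, h.map_shift hLC hLN⟩

/-- As the φ-values agree, both suprema refer to the same iterate. A summand of the iterate over `Γ`
comes from an object of `C` that is a summand of the iterate over `Λ` and has the same dimension. An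
inclusion of the sets of values is all that is needed. -/
theorem psi_le (h : IsShiftEquivOn F C Z S Z' S') {dim : FGModuleCat.{u} Λ → WithBot ℕ∞}
    {dim' : FGModuleCat.{u} Γ → WithBot ℕ∞} (hdim : ∀ X ∈ C, dim' (F.obj X) = dim X)
    (hiso : ∀ Y Y' : FGModuleCat.{u} Γ, (Y ≃ₗ[Γ] Y') → dim' Y = dim' Y')
    {M : FGModuleCat.{u} Λ} (hM : M ∈ C) {Y : FGModuleCat.{u} Γ} (e : F.obj M ≃ₗ[Γ] Y) :
    psi Z' S' dim' Y ≤ psi Z S dim M := by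
  unfold psi
  rw [← phi_congr e, h.phi_eq hM]
  refine add_le_add le_rfl (sSup_le_sSup ?_)
  rintro l ⟨hl, N, X, hN, hX, hd⟩
  obtain ⟨L, hL⟩ := h.isShift.exists_iterate (phi Z S M) M
  obtain ⟨hLC, hFL⟩ := h.iterate_mem hM hL
  obtain ⟨a⟩ := h.isShift'.iterate_unique e hFL hN
  obtain ⟨W, hW, ⟨b⟩⟩ := h.dense X
  refine ⟨hl, L, W, hL, h.isSummand hW hLC ((IsSummand.of_equiv b).trans
    (hX.trans (.of_equiv a.symm))), ?_⟩
  rw [← hdim W hW, hiso _ _ b, hd]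

/-- An equivalence `C ≃ mod Γ` that is compatible with syzygies bounds the Igusa-Todorov
dimensions. -/
theorem iSup_le (h : IsShiftEquivOn F C Z S Z' S') {dim : FGModuleCat.{u} Λ → WithBot ℕ∞}
    {dim' : FGModuleCat.{u} Γ → WithBot ℕ∞} (hdim : ∀ X ∈ C, dim' (F.obj X) = dim X)
    (hiso : ∀ Y Y' : FGModuleCat.{u} Γ, (Y ≃ₗ[Γ] Y') → dim' Y = dim' Y') :
    (⨆ Y, (phi Z' S' Y : ℕ∞)) ≤ ⨆ M, (phi Z S M : ℕ∞) ∧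
      (⨆ Y, psi Z' S' dim' Y) ≤ ⨆ M, psi Z S dim M := by
  constructor
  · refine _root_.iSup_le fun Y => ?_
    obtain ⟨M, hM, ⟨e⟩⟩ := h.dense Y
    rw [← phi_congr e, h.phi_eq hM]
    exact le_iSup (fun M => (phi Z S M : ℕ∞)) M
  · refine _root_.iSup_le fun Y => ?_
    obtain ⟨M, hM, ⟨e⟩⟩ := h.dense Y
    exact (h.psi_le hdim hiso hM e).trans (le_iSup (fun M => psi Z S dim M) M)

end IsShiftEquivOn

end Functor

/-! ### The functor Hom(P, -) to modules over End(P)ᵒᵖ -/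

section Hom

variable {Λ : Type u} [Ring Λ] {P X Y W : Type u} [AddCommGroup P] [Module Λ P]
  [AddCommGroup X] [Module Λ X] [AddCommGroup Y] [Module Λ Y] [AddCommGroup W] [Module Λ W]

/-- The action of `End(P)ᵒᵖ` on `Hom(P, X)` by precomposition. -/
instance homModule : Module (Module.End Λ P)ᵐᵒᵖ (P →ₗ[Λ] X) where
  smul γ f := f ∘ₗ γ.unop
  one_smul _ := rfl
  mul_smul _ _ _ := rfl
  smul_zero _ := rfl
  smul_add _ _ _ := rfl
  add_smul γ δ f := LinearMap.comp_add γ.unop δ.unop f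
  zero_smul f := LinearMap.comp_zero f

variable (P) in
/-- The map `Hom(P, X) → Hom(P, Y)` induced by `f : X → Y`. -/
def postcomp (f : X →ₗ[Λ] Y) : (P →ₗ[Λ] X) →ₗ[(Module.End Λ P)ᵐᵒᵖ] (P →ₗ[Λ] Y) where
  toFun h := f ∘ₗ h
  map_add' g h := LinearMap.comp_add g h f
  map_smul' _ _ := rfl

@[simp] theorem postcomp_apply (f : X →ₗ[Λ] Y) (h : P →ₗ[Λ] X) : postcomp P f h = f ∘ₗ h := rfl

theorem postcomp_comp (g : Y →ₗ[Λ] W) (f : X →ₗ[Λ] Y) :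
    postcomp P (g ∘ₗ f) = postcomp P g ∘ₗ postcomp P f := rfl

theorem postcomp_zero : postcomp P (0 : X →ₗ[Λ] Y) = 0 := by
  ext; simp

theorem postcomp_add (f g : X →ₗ[Λ] Y) : postcomp P (f + g) = postcomp P f + postcomp P g := by
  ext; simp

/-- The functor `Hom(P, -)`. -/
def homFunctor (P : Type u) [AddCommGroup P] [Module Λ P]
    (hP : ∀ X : FGModuleCat.{u} Λ, Module.Finite (Module.End Λ P)ᵐᵒᵖ (P →ₗ[Λ] X)) :
    AddFunctor Λ (Module.End Λ P)ᵐᵒᵖ where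
  obj X := haveI := hP X; FGModuleCat.of _ (P →ₗ[Λ] X)
  map := { toFun := fun f => postcomp P f, map_zero' := postcomp_zero, map_add' := postcomp_add }
  map_id _ := rfl
  map_comp _ _ := rfl

end Hom

/-! ### Finiteness over the base ring -/

section ArtinAlgebra

variable (R : Type v) [CommRing R] [IsArtinianRing R] {Λ : Type u} [Ring Λ] [Algebra R Λ]
  [Module.Finite R Λ]

/-- A homomorphism is determined by its values on n generators of `P`, which embeds Hom(P, X) in Xⁿ,
a noetherian `R`-module. -/
theorem finite_hom_over_base (P X : Type u) [AddCommGroup P] [Module Λ P] [Module.Finite Λ P]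
    [AddCommGroup X] [Module Λ X] [Module.Finite Λ X] [Module R X] [IsScalarTower R Λ X] :
    Module.Finite R (P →ₗ[Λ] X) := by
  have : Module.Finite R X := Module.Finite.trans Λ X
  obtain ⟨n, s, hs⟩ := Module.Finite.exists_fin (R := Λ) (M := P)
  let φ : (P →ₗ[Λ] X) →ₗ[R] (Fin n → X) :=
    { toFun := fun f i => f (s i), map_add' := fun _ _ => rfl, map_smul' := fun _ _ => rfl }
  refine Module.Finite.of_injective φ fun f g hfg => ?_
  exact LinearMap.ext_on_range hs fun i => congrFun hfg i

/-- The endomorphism ring of a finitely generated module over an artin algebra is an artin algebra,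
and `Hom(P, -)` takes finitely generated modules to finitely generated modules. -/
theorem exists_algebra_end (P : Type u) [AddCommGroup P] [Module Λ P] [Module.Finite Λ P] :
    (∃ _ : Algebra R (Module.End Λ P)ᵐᵒᵖ, Module.Finite R (Module.End Λ P)ᵐᵒᵖ) ∧
      ∀ (X : Type u) [AddCommGroup X] [Module Λ X] [Module.Finite Λ X],
        Module.Finite (Module.End Λ P)ᵐᵒᵖ (P →ₗ[Λ] X) := by
  let _ : Module R P := Module.compHom P (algebraMap R Λ)
  have : IsScalarTower R Λ P := ⟨fun r l p => by
    rw [Algebra.smul_def, mul_smul]; rfl⟩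
  have h1 : Module.Finite R (Module.End Λ P) := finite_hom_over_base R P P
  refine ⟨⟨inferInstance, Module.Finite.equiv (MulOpposite.opLinearEquiv R)⟩, ?_⟩
  intro X _ _ _
  let _ : Module R X := Module.compHom X (algebraMap R Λ)
  have : IsScalarTower R Λ X := ⟨fun r l p => by
    rw [Algebra.smul_def, mul_smul]; rfl⟩
  have : Module.Finite R (P →ₗ[Λ] X) := finite_hom_over_base (Λ := Λ) R P X
  have : IsScalarTower R (Module.End Λ P)ᵐᵒᵖ (P →ₗ[Λ] X) := ⟨fun r γ f => by
    ext p
    change f (r • γ.unop p) = r • f (γ.unop p)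
    exact LinearMap.map_smul_of_tower f r _⟩
  exact Module.Finite.of_restrictScalars_finite R _ _

include R in
theorem isArtinianRing_of_artinAlgebra : IsArtinianRing Λ := IsArtinianRing.of_finite R Λ

end ArtinAlgebra

/-! ### Local endomorphism rings and multiplicities of indecomposables -/

section Multiplicity

variable {Λ : Type u} [Ring Λ] (X M : Type u) [AddCommGroup X] [Module Λ X]
  [AddCommGroup M] [Module Λ M]

variable {X} in
-- Fitting's lemma: `X` splits as kernel plus image of a high power of `u`. By indecomposability one
-- of them vanishes, so `u` is either invertible or nilpotent, and in the latter case `1 - u` is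
-- invertible.
theorem IsIndecomposable.isLocalRing [IsArtinian Λ X] [IsNoetherian Λ X]
    (hX : IsIndecomposable (Λ := Λ) X) : IsLocalRing (Module.End Λ X) := by
  have := hX.1
  refine IsLocalRing.of_isUnit_or_isUnit_one_sub_self fun u => ?_
  obtain ⟨n, hn, h0⟩ := ((u.eventually_isCompl_ker_pow_range_pow).and
    (Filter.eventually_ge_atTop 1)).exists
  rcases hX.2 _ _ hn with h | h
  · left
    rw [← isUnit_pow_iff (n := n) (by omega), Module.End.isUnit_iff]
    have h' := hn.sup_eq_top
    rw [h, bot_sup_eq] at h'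
    exact ⟨LinearMap.ker_eq_bot.1 h, LinearMap.range_eq_top.1 h'⟩
  · right
    exact IsNilpotent.isUnit_one_sub ⟨n, LinearMap.range_eq_bot.1 h⟩

theorem not_isUnit_add {A : Type u} [Ring A] [IsLocalRing A] {a b : A} (ha : ¬ IsUnit a)
    (hb : ¬ IsUnit b) : ¬ IsUnit (a + b) := by
  rintro ⟨w, hw⟩
  have h : ↑w⁻¹ * a + ↑w⁻¹ * b = 1 := by rw [← mul_add, ← hw, Units.inv_mul]
  rcases IsLocalRing.isUnit_or_isUnit_of_add_one h with h | h
  · exact ha ((Units.isUnit_units_mul _ _).1 h)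
  · exact hb ((Units.isUnit_units_mul _ _).1 h)

/-- The radical of `Hom(X, M)`, for `X` indecomposable. -/
def radHom [IsNoetherian Λ X] [IsLocalRing (Module.End Λ X)] :
    Submodule (Module.End Λ X)ᵐᵒᵖ (X →ₗ[Λ] M) where
  carrier := {f | ∀ g : M →ₗ[Λ] X, ¬ IsUnit (g ∘ₗ f : Module.End Λ X)}
  zero_mem' g := by
    rw [LinearMap.comp_zero]
    exact not_isUnit_zero
  add_mem' {a b} ha hb g := by
    rw [LinearMap.comp_add]
    exact not_isUnit_add (ha g) (hb g)
  smul_mem' γ f hf g hg := by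
    refine hf g ((Module.End.isUnit_iff _).2 ?_)
    -- If `g ∘ f ∘ γ` is invertible then `g ∘ f` is surjective, and a surjective endomorphism of a
    -- noetherian module is bijective.
    have hs : Function.Surjective (g ∘ₗ f) := by
      intro x
      obtain ⟨y, hy⟩ := ((Module.End.isUnit_iff _).1 hg).2 x
      exact ⟨γ.unop y, hy⟩
    exact ⟨IsNoetherian.injective_of_surjective_endomorphism _ hs, hs⟩

variable {X M} in
theorem isSummand_of_isUnit {f : X →ₗ[Λ] M} {g : M →ₗ[Λ] X}
    (h : IsUnit (g ∘ₗ f : Module.End Λ X)) : IsSummand (Λ := Λ) X M := by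
  obtain ⟨w, hw⟩ := h
  refine ⟨f, (↑w⁻¹ : Module.End Λ X) ∘ₗ g, ?_⟩
  rw [LinearMap.comp_assoc, ← hw]
  exact w.inv_mul

/-- The multiplicity of the indecomposable module `X` in `M`. -/
def mult [IsNoetherian Λ X] [IsLocalRing (Module.End Λ X)] : ℕ :=
  (Module.length (Module.End Λ X)ᵐᵒᵖ ((X →ₗ[Λ] M) ⧸ radHom X M)).toNat

/-- Multiplicities are additive. -/
theorem mult_add [IsNoetherian Λ X] [IsLocalRing (Module.End Λ X)]
    [IsArtinianRing (Module.End Λ X)ᵐᵒᵖ]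
    (hfin : ∀ (M : Type u) [AddCommGroup M] [Module Λ M] [Module.Finite Λ M],
      Module.Finite (Module.End Λ X)ᵐᵒᵖ (X →ₗ[Λ] M))
    (A B C : Type u) [AddCommGroup A] [Module Λ A] [Module.Finite Λ A] [AddCommGroup B]
    [Module Λ B] [Module.Finite Λ B] [AddCommGroup C] [Module Λ C] (e : C ≃ₗ[Λ] (A × B)) :
    mult (Λ := Λ) X C = mult (Λ := Λ) X A + mult (Λ := Λ) X B := by
  let φ : (X →ₗ[Λ] C) →ₗ[(Module.End Λ X)ᵐᵒᵖ]
      (((X →ₗ[Λ] A) ⧸ radHom X A) × ((X →ₗ[Λ] B) ⧸ radHom X B)) :=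
    ((radHom X A).mkQ ∘ₗ postcomp X (LinearMap.fst Λ A B ∘ₗ (e : C →ₗ[Λ] (A × B)))).prod
      ((radHom X B).mkQ ∘ₗ postcomp X (LinearMap.snd Λ A B ∘ₗ (e : C →ₗ[Λ] (A × B))))
  have hφ : Function.Surjective φ := by
    rintro ⟨a, b⟩
    obtain ⟨a, rfl⟩ := Submodule.mkQ_surjective _ a
    obtain ⟨b, rfl⟩ := Submodule.mkQ_surjective _ b
    refine ⟨(e.symm : (A × B) →ₗ[Λ] C) ∘ₗ a.prod b, Prod.ext ?_ ?_⟩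
    · refine congrArg (radHom X A).mkQ (LinearMap.ext fun x => ?_)
      simp
    · refine congrArg (radHom X B).mkQ (LinearMap.ext fun x => ?_)
      simp
  -- The radical is compatible with direct sums because non-units in a local ring are closed under
  -- addition.
  have hker : LinearMap.ker φ = radHom X C := by
    ext f
    have h1 : f ∈ LinearMap.ker φ ↔
        LinearMap.fst Λ A B ∘ₗ (e : C →ₗ[Λ] (A × B)) ∘ₗ f ∈ radHom X A ∧
        LinearMap.snd Λ A B ∘ₗ (e : C →ₗ[Λ] (A × B)) ∘ₗ f ∈ radHom X B := by
      rw [LinearMap.mem_ker, Prod.ext_iff]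
      exact and_congr (Submodule.Quotient.mk_eq_zero (radHom X A))
        (Submodule.Quotient.mk_eq_zero (radHom X B))
    rw [h1]
    constructor
    · rintro ⟨ha, hb⟩ g
      have : g ∘ₗ f = (g ∘ₗ (e.symm : (A × B) →ₗ[Λ] C) ∘ₗ LinearMap.inl Λ A B) ∘ₗ
            (LinearMap.fst Λ A B ∘ₗ (e : C →ₗ[Λ] (A × B)) ∘ₗ f) +
          (g ∘ₗ (e.symm : (A × B) →ₗ[Λ] C) ∘ₗ LinearMap.inr Λ A B) ∘ₗ
            (LinearMap.snd Λ A B ∘ₗ (e : C →ₗ[Λ] (A × B)) ∘ₗ f) := by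
        ext x
        simp [← map_add]
      rw [this]
      exact not_isUnit_add (ha _) (hb _)
    · intro hf
      exact ⟨fun g => hf (g ∘ₗ LinearMap.fst Λ A B ∘ₗ (e : C →ₗ[Λ] (A × B))),
        fun g => hf (g ∘ₗ LinearMap.snd Λ A B ∘ₗ (e : C →ₗ[Λ] (A × B)))⟩
  have := hfin A
  have := hfin B
  rw [mult, ← hker, (φ.quotKerEquivOfSurjective hφ).length_eq, Module.length_prod,
    ENat.toNat_add Module.length_ne_top Module.length_ne_top]
  rfl

variable {X M} in
theorem isSummand_of_mult_ne_zero [IsNoetherian Λ X] [IsLocalRing (Module.End Λ X)]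
    (h : mult (Λ := Λ) X M ≠ 0) : IsSummand (Λ := Λ) X M := by
  by_contra hs
  have htop : radHom (Λ := Λ) X M = ⊤ := by
    rw [eq_top_iff]
    intro f _ g hg
    exact hs (isSummand_of_isUnit hg)
  apply h
  have : Subsingleton ((X →ₗ[Λ] M) ⧸ radHom X M) :=
    Submodule.Quotient.subsingleton_iff.2 htop
  rw [mult, Module.length_eq_zero, ENat.toNat_zero]

/-- The identity is not in the radical. Nonvanishing, rather than the exact value, is all that the
Krull-Schmidt argument uses; finite length matters because `ENat.toNat` sends `⊤` to zero. -/
theorem mult_self_ne_zero [IsNoetherian Λ X] [IsLocalRing (Module.End Λ X)]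
    [IsArtinianRing (Module.End Λ X)ᵐᵒᵖ] :
    mult (Λ := Λ) X X ≠ 0 := by
  have hfin : Module.Finite (Module.End Λ X)ᵐᵒᵖ (X →ₗ[Λ] X) :=
    ⟨⟨{(1 : Module.End Λ X)}, by
      rw [eq_top_iff]
      intro f _
      rw [Finset.coe_singleton, Submodule.mem_span_singleton]
      exact ⟨MulOpposite.op f, LinearMap.id_comp f⟩⟩⟩
  have : Nontrivial ((X →ₗ[Λ] X) ⧸ radHom X X) := by
    rw [Submodule.Quotient.nontrivial_iff]
    intro h
    have : (LinearMap.id : X →ₗ[Λ] X) ∈ radHom X X := by rw [h]; trivial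
    exact this LinearMap.id isUnit_one
  rw [mult, Ne, ENat.toNat_eq_zero, Module.length_eq_zero_iff, not_or]
  exact ⟨not_subsingleton _, Module.length_ne_top⟩

end Multiplicity

/-! ### Krull-Schmidt cancellation modulo Z -/

section KrullSchmidt

variable {Λ : Type u} [Ring Λ]

/-- The length of a module, as a natural number. -/
def len (Λ : Type u) [Ring Λ] (M : Type u) [AddCommGroup M] [Module Λ M] : ℕ :=
  (Module.length Λ M).toNat

section

variable [IsArtinianRing Λ] {A B C : Type u} [AddCommGroup A] [Module Λ A] [Module.Finite Λ A]
  [AddCommGroup B] [Module Λ B] [Module.Finite Λ B] [AddCommGroup C] [Module Λ C]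

theorem len_add (e : C ≃ₗ[Λ] (A × B)) : len Λ C = len Λ A + len Λ B := by
  rw [len, e.length_eq, Module.length_prod,
    ENat.toNat_add Module.length_ne_top Module.length_ne_top]
  rfl

theorem len_pos [Nontrivial A] : 0 < len Λ A := by
  rw [Nat.pos_iff_ne_zero, len, Ne, ENat.toNat_eq_zero, Module.length_eq_zero_iff, not_or]
  exact ⟨not_subsingleton _, Module.length_ne_top⟩

end

variable {Z : FGModuleCat.{u} Λ → Prop} {S : FGModuleCat.{u} Λ → FGModuleCat.{u} Λ → Prop}

/-- Induction on length along a nontrivial decomposition: if both parts lie in `Z` so does the sum,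
and otherwise the indecomposable split off from one part is split off from the whole. -/
theorem IsShift.mem_or_exists_indecomposable [IsArtinianRing Λ] (h : IsShift Z S)
    (M : FGModuleCat.{u} Λ) :
    Z M ∨ ∃ X M' : FGModuleCat.{u} Λ, IsIndecomposable (Λ := Λ) X ∧ ¬ Z X ∧
      Nonempty (M ≃ₗ[Λ] (X × M')) := by
  induction hn : len Λ M using Nat.strong_induction_on generalizing M with
  | _ n ih =>
  subst hn
  rcases subsingleton_or_nontrivial M with hM | hM
  · exact .inl (h.mem_of_subsingleton M hM)
  by_cases hI : IsIndecomposable (Λ := Λ) M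
  · by_cases hZ : Z M
    · exact .inl hZ
    · exact .inr ⟨M, FGModuleCat.of Λ PUnit.{u+1}, hI, hZ,
        ⟨(LinearEquiv.prodUnique (R := Λ) (M := M) (M₂ := PUnit.{u+1})).symm⟩⟩
  obtain ⟨A, B, hAB, hA, hB⟩ : ∃ A B : Submodule Λ M, IsCompl A B ∧ A ≠ ⊥ ∧ B ≠ ⊥ := by
    by_contra! H
    exact hI ⟨hM, fun A B hAB => or_iff_not_imp_left.2 (H A B hAB)⟩
  have e : M ≃ₗ[Λ] (A × B) := (Submodule.prodEquivOfIsCompl A B hAB).symm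
  have := Submodule.nontrivial_iff_ne_bot.2 hA
  have := Submodule.nontrivial_iff_ne_bot.2 hB
  have hl := len_add e
  have hA0 := len_pos (Λ := Λ) (A := A)
  have hB0 := len_pos (Λ := Λ) (A := B)
  rcases ih (len Λ A) (by omega) (FGModuleCat.of Λ A) rfl with hZA | ⟨X, M', hX, hXZ, ⟨a⟩⟩
  · rcases ih (len Λ B) (by omega) (FGModuleCat.of Λ B) rfl with hZB | ⟨X, M', hX, hXZ, ⟨b⟩⟩
    · left
      exact h.mem_of_summand (.of_equiv e) (h.mem_prod hZA hZB)
    · refine .inr ⟨X, sum (FGModuleCat.of Λ A) M', hX, hXZ, ⟨?_⟩⟩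
      exact e.trans (((LinearEquiv.refl Λ A).prodCongr b).trans
        ((LinearEquiv.prodAssoc Λ A X M').symm.trans
        (((LinearEquiv.prodComm Λ A X).prodCongr (LinearEquiv.refl Λ M')).trans
          (LinearEquiv.prodAssoc Λ X A M'))))
  · refine .inr ⟨X, sum M' (FGModuleCat.of Λ B), hX, hXZ, ⟨?_⟩⟩
    exact e.trans ((LinearEquiv.prodCongr a (LinearEquiv.refl Λ B)).trans
      (LinearEquiv.prodAssoc Λ X M' B))

variable (R : Type v) [CommRing R] [IsArtinianRing R] [Algebra R Λ] [Module.Finite R Λ]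

include R in
/-- A form of the Krull-Schmidt theorem: modules with the same class in `K₀` agree up to summands
in `Z`. -/
theorem IsShift.common_summand (h : IsShift Z S) {A B : FGModuleCat.{u} Λ}
    (hAB : K0.cls Z A = K0.cls Z B) : ∃ A' B' D : FGModuleCat.{u} Λ, Z A' ∧ Z B' ∧
      Nonempty (A ≃ₗ[Λ] (A' × D)) ∧ Nonempty (B ≃ₗ[Λ] (B' × D)) := by
  have hart : IsArtinianRing Λ := isArtinianRing_of_artinAlgebra R
  have hadd : ∀ X : FGModuleCat.{u} Λ, ∀ _ : IsIndecomposable (Λ := Λ) X,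
      ∀ _ : IsLocalRing (Module.End Λ X),
      (∀ (A B C : FGModuleCat.{u} Λ), (C ≃ₗ[Λ] (A × B)) →
        mult (Λ := Λ) X C = mult (Λ := Λ) X A + mult (Λ := Λ) X B) ∧
      mult (Λ := Λ) X X ≠ 0 := fun X hX _ => by
    obtain ⟨⟨_, hE⟩, hfin⟩ := exists_algebra_end (Λ := Λ) R X
    have : IsArtinianRing (Module.End Λ X)ᵐᵒᵖ := isArtinianRing_of_artinAlgebra R
    exact ⟨fun A B C e => mult_add X (fun M => hfin M) A B C e, mult_self_ne_zero X⟩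
  have hmult : ∀ X : FGModuleCat.{u} Λ, ∀ _ : IsIndecomposable (Λ := Λ) X, ¬ Z X →
      ∀ _ : IsLocalRing (Module.End Λ X), mult (Λ := Λ) X A = mult (Λ := Λ) X B := by
    intro X hX hZ _
    obtain ⟨φ, hφ⟩ := K0.exists_lift (Z := Z) (fun M => (mult (Λ := Λ) X M : ℤ))
      (fun A B C e => by rw [(hadd X hX _).1 A B C e]; push_cast; rfl)
      -- An indecomposable outside `Z` cannot be a summand of a module in `Z`, so its multiplicity
      -- vanishes on `Z` and defines a function on K₀.
      (fun Q hQ => by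
        by_contra hne
        exact hZ (h.mem_of_summand (isSummand_of_mult_ne_zero (by exact_mod_cast hne)) hQ))
    have := congrArg φ hAB
    rw [hφ, hφ] at this
    exact_mod_cast this
  -- From here only the equality of multiplicities is used. It survives the cancellation of a common
  -- indecomposable summand, and so serves as the induction hypothesis.
  clear hAB
  induction hn : len Λ A using Nat.strong_induction_on generalizing A B with
  | _ n ih =>
  subst hn
  have triv : ∀ M : FGModuleCat.{u} Λ, Nonempty (M ≃ₗ[Λ] (M × FGModuleCat.of Λ PUnit.{u+1})) :=
    fun M => ⟨(LinearEquiv.prodUnique (R := Λ) (M := M) (M₂ := PUnit.{u+1})).symm⟩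
  rcases h.mem_or_exists_indecomposable A with hZA | ⟨X, A₁, hX, hXZ, ⟨a⟩⟩
  · rcases h.mem_or_exists_indecomposable B with hZB | ⟨X, B₁, hX, hXZ, ⟨b⟩⟩
    · exact ⟨A, B, FGModuleCat.of Λ PUnit.{u+1}, hZA, hZB, triv A, triv B⟩
    · have hl := hX.isLocalRing
      have h1 := hmult X hX hXZ hl
      rw [(hadd X hX hl).1 _ _ _ b] at h1
      have h2 := (hadd X hX hl).2
      exact absurd (h.mem_of_summand (isSummand_of_mult_ne_zero (by omega)) hZA) hXZ
  · have hl := hX.isLocalRing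
    have h1 := hmult X hX hXZ hl
    rw [(hadd X hX hl).1 _ _ _ a] at h1
    have h2 := (hadd X hX hl).2
    obtain ⟨B₁, ⟨b⟩⟩ :=
      (isSummand_of_mult_ne_zero (X := X) (M := B) (by omega)).exists_prod
    have := hX.1
    have hlen := len_add a
    have h3 := len_pos (Λ := Λ) (A := X)
    obtain ⟨A', B', D, hA', hB', ⟨a'⟩, ⟨b'⟩⟩ := ih (len Λ A₁) (by omega)
      (A := A₁) (B := FGModuleCat.of Λ B₁) (fun Y hY hYZ hYl => by
        have := hmult Y hY hYZ hYl
        rw [(hadd Y hY hYl).1 _ _ _ a, (hadd Y hY hYl).1 X (FGModuleCat.of Λ B₁) _ b] at this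
        exact Nat.add_left_cancel this) rfl
    have swap : ∀ (E E' : FGModuleCat.{u} Λ), (E ≃ₗ[Λ] (E' × D)) →
        Nonempty ((X × E) ≃ₗ[Λ] (E' × (X × D))) := fun E E' e =>
      ⟨((LinearEquiv.refl Λ X).prodCongr e).trans ((LinearEquiv.prodAssoc Λ X E' D).symm.trans
        (((LinearEquiv.prodComm Λ X E').prodCongr (LinearEquiv.refl Λ D)).trans
          (LinearEquiv.prodAssoc Λ E' X D)))⟩
    exact ⟨A', B', sum X D, hA', hB', ⟨a.trans (swap _ _ a').some⟩,
      ⟨b.trans (swap (FGModuleCat.of Λ B₁) _ b').some⟩⟩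

end KrullSchmidt

/-! ### Projective covers and syzygies -/

section ProjectiveCovers

variable {Λ : Type u} [Ring Λ] {M M' Q Q' : Type u} [AddCommGroup M] [Module Λ M]
  [AddCommGroup M'] [Module Λ M'] [AddCommGroup Q] [Module Λ Q] [AddCommGroup Q'] [Module Λ Q']

theorem IsProjectiveCover.surjective_of_comp {f : Q →ₗ[Λ] M} (hf : IsProjectiveCover f)
    {b : Q' →ₗ[Λ] Q} (hb : Function.Surjective (f ∘ₗ b)) : Function.Surjective b := by
  rw [← LinearMap.range_eq_top]
  refine hf.2.2 _ (eq_top_iff.2 fun x _ => ?_)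
  obtain ⟨y, hy⟩ := hb (f x)
  refine Submodule.mem_sup.2 ⟨b y, ⟨y, rfl⟩, x - b y, ?_, by simp⟩
  rw [LinearMap.mem_ker, map_sub, sub_eq_zero]
  exact hy.symm

/-- A projective cover is a retract of every epimorphism from a projective module. -/
theorem IsProjectiveCover.exists_retract {f : Q →ₗ[Λ] M} (hf : IsProjectiveCover f)
    [Module.Projective Λ Q'] {g : Q' →ₗ[Λ] M} (hg : Function.Surjective g) :
    ∃ (a : Q →ₗ[Λ] Q') (b : Q' →ₗ[Λ] Q), b ∘ₗ a = LinearMap.id ∧ g ∘ₗ a = f ∧ f ∘ₗ b = g := by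
  have := hf.1
  obtain ⟨b, hb⟩ := Module.projective_lifting_property f g hf.2.1
  obtain ⟨a, ha⟩ := Module.projective_lifting_property b LinearMap.id
    (hf.surjective_of_comp (b := b) (by rw [hb]; exact hg))
  exact ⟨a, b, ha, by rw [← hb, LinearMap.comp_assoc, ha, LinearMap.comp_id], hb⟩

theorem IsProjectiveCover.exists_equiv {f : Q →ₗ[Λ] M} (hf : IsProjectiveCover f)
    {f' : Q' →ₗ[Λ] M'} (hf' : IsProjectiveCover f') (e : M ≃ₗ[Λ] M') :
    Nonempty (LinearMap.ker f ≃ₗ[Λ] LinearMap.ker f') := by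
  have := hf'.1
  obtain ⟨a, b, hba, ha, hb⟩ := hf.exists_retract
    (g := (e.symm : M' →ₗ[Λ] M) ∘ₗ f') (e.symm.surjective.comp hf'.2.1)
  have ha' : ∀ x, f' (a x) = e (f x) := fun x => by
    rw [← ha]; simp
  have hs : Function.Surjective a := hf'.surjective_of_comp (b := a) (by
    intro y
    obtain ⟨x, hx⟩ := hf.2.1 (e.symm y)
    exact ⟨x, by simp [ha', hx]⟩)
  have hi : Function.Injective a := fun x y hxy => by
    rw [← LinearMap.id_apply (R := Λ) x, ← hba, LinearMap.comp_apply, hxy]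
    exact LinearMap.congr_fun hba y
  refine ⟨LinearEquiv.ofSubmodules (LinearEquiv.ofBijective a ⟨hi, hs⟩) _ _ ?_⟩
  ext y
  constructor
  · rintro ⟨x, hx, rfl⟩
    have hx : f x = 0 := hx
    change f' (a x) = 0
    rw [ha', hx, map_zero]
  · intro hy
    obtain ⟨x, rfl⟩ := hs y
    refine ⟨x, ?_, rfl⟩
    have hy : f' (a x) = 0 := hy
    simpa [ha'] using hy

theorem IsProjectiveCover.prodMap {f : Q →ₗ[Λ] M} (hf : IsProjectiveCover f)
    {f' : Q' →ₗ[Λ] M'} (hf' : IsProjectiveCover f') : IsProjectiveCover (f.prodMap f') := by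
  have := hf.1
  have := hf'.1
  refine ⟨inferInstance, hf.2.1.prodMap hf'.2.1, fun N hN => ?_⟩
  have key : ∀ z : Q × Q', ∃ n ∈ N, f n.1 = f z.1 ∧ f' n.2 = f' z.2 := fun z => by
    obtain ⟨n, hn, k, hk, rfl⟩ := Submodule.mem_sup.1 (hN ▸ Submodule.mem_top : z ∈ _)
    have hk : (f k.1, f' k.2) = 0 := hk
    rw [Prod.mk_eq_zero] at hk
    exact ⟨n, hn, by simp [hk.1], by simp [hk.2]⟩
  -- `N + (0 × ker f') = ⊤`, as `ker f × 0` is superfluous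
  have h2 : N ⊔ (LinearMap.ker f').map (LinearMap.inr Λ Q Q') = ⊤ := by
    have : (N ⊔ (LinearMap.ker f').map (LinearMap.inr Λ Q Q')).comap (LinearMap.inl Λ Q Q') = ⊤ := by
      refine hf.2.2 _ (eq_top_iff.2 fun x _ => ?_)
      obtain ⟨n, hn, h1, h2⟩ := key (x, 0)
      refine Submodule.mem_sup.2 ⟨n.1, ?_, x - n.1, by simp [h1], by simp⟩
      refine Submodule.mem_sup.2 ⟨n, hn, (0, - n.2), ⟨- n.2, ?_, rfl⟩, by ext <;> simp⟩
      simpa using h2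
    rw [eq_top_iff]
    rintro ⟨x, y⟩ -
    have hx : ∀ x, (x, (0 : Q')) ∈ N ⊔ (LinearMap.ker f').map (LinearMap.inr Λ Q Q') := fun x =>
      Submodule.mem_comap.1 (this.symm ▸ Submodule.mem_top)
    obtain ⟨n, hn, h1, h2⟩ := key (0, y)
    have e : (x, y) = n + (x - n.1, 0) + (0, y - n.2) := by ext <;> simp
    rw [e]
    refine add_mem (add_mem (Submodule.mem_sup_left hn) (hx _)) (Submodule.mem_sup_right ?_)
    exact ⟨y - n.2, by simp [h2], rfl⟩
  have h3 : N.comap (LinearMap.inr Λ Q Q') = ⊤ := by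
    refine hf'.2.2 _ (eq_top_iff.2 fun y _ => ?_)
    obtain ⟨n, hn, _, ⟨k, hk, rfl⟩, hnk⟩ :=
      Submodule.mem_sup.1 (h2 ▸ Submodule.mem_top : ((0 : Q), y) ∈ _)
    have e1 : n.1 = 0 := by simpa using congrArg Prod.fst hnk
    have e2 : n.2 + k = y := by simpa using congrArg Prod.snd hnk
    refine Submodule.mem_sup.2 ⟨n.2, ?_, k, hk, e2⟩
    have : n = LinearMap.inr Λ Q Q' n.2 := by ext <;> simp [e1]
    rw [Submodule.mem_comap, ← this]
    exact hn
  rw [eq_top_iff, ← h2]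
  refine sup_le le_rfl ?_
  rintro _ ⟨y, -, rfl⟩
  exact (h3 ▸ Submodule.mem_top : y ∈ N.comap (LinearMap.inr Λ Q Q'))

/-- Every finitely generated module over an artinian ring has a projective cover. -/
theorem exists_projectiveCover [IsArtinianRing Λ] (M : FGModuleCat.{u} Λ) :
    ∃ (Q : FGModuleCat.{u} Λ) (f : Q →ₗ[Λ] M), IsProjectiveCover f := by
  classical
  -- The cover is a projective epimorphism onto `M` with source of least length.
  have H : ∃ n, ∃ (Q : FGModuleCat.{u} Λ) (f : Q →ₗ[Λ] M), Module.Projective Λ Q ∧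
      Function.Surjective f ∧ len Λ Q = n := by
    obtain ⟨n, f, hf⟩ := Module.Finite.exists_fin' Λ M
    exact ⟨_, FGModuleCat.of Λ (Fin n → Λ), f,
      inferInstanceAs (Module.Projective Λ (Fin n → Λ)), hf, rfl⟩
  obtain ⟨Q, f, hQ, hf, hl⟩ := Nat.find_spec H
  refine ⟨Q, f, hQ, hf, fun N hN => ?_⟩
  have hfN : Function.Surjective (f ∘ₗ N.subtype) := fun y => by
    obtain ⟨x, rfl⟩ := hf y
    obtain ⟨n, hn, k, hk, rfl⟩ := Submodule.mem_sup.1 (hN ▸ Submodule.mem_top : x ∈ _)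
    have hk : f k = 0 := hk
    exact ⟨⟨n, hn⟩, by simp [hk]⟩
  -- Lifting `f` through `N` gives `u : Q → N ⊆ Q` with `f u = f`. By Fitting, the image of a high
  -- power of `u` is a summand of `Q` that still maps onto `M`. Minimal length forces it to be `Q`,
  -- and it lies in `N`.
  obtain ⟨g, hg⟩ := Module.projective_lifting_property _ f hfN
  let u : Module.End Λ Q := N.subtype ∘ₗ g
  have hu : f ∘ₗ u = f := hg
  have hun : ∀ n : ℕ, f ∘ₗ (u ^ n) = f := fun n => by
    induction n with
    | zero => rfl
    | succ n ih => rw [pow_succ, Module.End.mul_eq_comp, ← LinearMap.comp_assoc, ih, hu]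
  obtain ⟨n, hn, h0⟩ := ((u.eventually_isCompl_ker_pow_range_pow).and
    (Filter.eventually_ge_atTop 1)).exists
  have hW : IsSummand (Λ := Λ) (LinearMap.range (u ^ n)) Q :=
    ⟨Submodule.subtype _, Submodule.projectionOnto _ _ hn.symm, LinearMap.ext fun x =>
      Submodule.projectionOnto_apply_left hn.symm x⟩
  have htop : LinearMap.range (u ^ n) = ⊤ := by
    by_contra hne
    refine Nat.find_min H (m := len Λ (LinearMap.range (u ^ n))) ?_
      ⟨FGModuleCat.of Λ (LinearMap.range (u ^ n)), f ∘ₗ Submodule.subtype _, hW.projective,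
        fun y => ?_, rfl⟩
    · rw [← hl, ← Nat.cast_lt (α := ℕ∞), len, len, ENat.natCast_toNat Module.length_ne_top,
        ENat.natCast_toNat Module.length_ne_top]
      exact Submodule.length_lt hne
    · obtain ⟨x, rfl⟩ := hf y
      exact ⟨⟨(u ^ n) x, x, rfl⟩, LinearMap.congr_fun (hun n) x⟩
  rw [eq_top_iff, ← htop]
  rintro _ ⟨x, rfl⟩
  obtain ⟨m, rfl⟩ := Nat.exists_eq_succ_of_ne_zero (by omega : n ≠ 0)
  rw [pow_succ']
  exact (g ((u ^ m) x)).2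

/-- Over an artinian ring, projective covers are the right minimal epimorphisms. -/
theorem isProjectiveCover_iff_minimal [IsArtinianRing Λ] {Q M : FGModuleCat.{u} Λ}
    (hQ : Module.Projective Λ Q) {f : Q →ₗ[Λ] M} (hf : Function.Surjective f) :
    IsProjectiveCover f ↔ ∀ u : Q →ₗ[Λ] Q, f ∘ₗ u = f → Function.Bijective u := by
  constructor
  · intro h u hu
    have hs := h.surjective_of_comp (b := u) (by rw [hu]; exact hf)
    exact ⟨IsNoetherian.injective_of_surjective_endomorphism u hs, hs⟩
  · intro h
    refine ⟨hQ, hf, fun N hN => ?_⟩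
    obtain ⟨Q', f', hf'⟩ := exists_projectiveCover M
    obtain ⟨a, b, hba, ha, hb⟩ := hf'.exists_retract hf
    -- Minimality makes the idempotent `a ∘ b` bijective, so `f` is isomorphic to a genuine
    -- projective cover and inherits the superfluous kernel.
    have hab := h (a ∘ₗ b) (by rw [← LinearMap.comp_assoc, ha, hb])
    have hbi : Function.Injective b := .of_comp hab.1
    have hN' : N.map b = ⊤ := by
      refine hf'.2.2 _ (eq_top_iff.2 fun x _ => ?_)
      obtain ⟨n, hn, k, hk, hnk⟩ := Submodule.mem_sup.1 (hN ▸ Submodule.mem_top : a x ∈ _)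
      refine Submodule.mem_sup.2 ⟨b n, ⟨n, hn, rfl⟩, b k, ?_, ?_⟩
      · have hk : f k = 0 := hk
        rw [← hb] at hk
        exact hk
      · rw [← map_add, hnk]
        exact LinearMap.congr_fun hba x
    rw [eq_top_iff]
    intro x _
    obtain ⟨n, hn, hnx⟩ := (hN' ▸ Submodule.mem_top : b x ∈ N.map b)
    rwa [← hbi hnx]

/-- The kernel of a direct sum of maps. -/
def kerProdEquiv (f : Q →ₗ[Λ] M) (f' : Q' →ₗ[Λ] M') :
    (LinearMap.ker f × LinearMap.ker f') ≃ₗ[Λ] LinearMap.ker (f.prodMap f') where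
  toFun x := ⟨(x.1, x.2), Prod.ext x.1.2 x.2.2⟩
  invFun x := (⟨x.1.1, congrArg Prod.fst x.2⟩, ⟨x.1.2, congrArg Prod.snd x.2⟩)
  map_add' _ _ := rfl
  map_smul' _ _ := rfl

theorem isShift_projective [IsArtinianRing Λ] :
    IsShift (fun Q : FGModuleCat.{u} Λ => Module.Projective Λ Q) IsSyzygy where
  exists_shift M := by
    obtain ⟨Q, f, hf⟩ := exists_projectiveCover M
    exact ⟨FGModuleCat.of Λ (LinearMap.ker f), Q, f, hf, ⟨LinearEquiv.refl Λ _⟩⟩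
  unique := by
    rintro M M' N N' e ⟨Q, f, hf, ⟨a⟩⟩ ⟨Q', f', hf', ⟨a'⟩⟩
    obtain ⟨b⟩ := hf.exists_equiv hf' e
    exact ⟨a.trans (b.trans a'.symm)⟩
  prod := by
    rintro A A' B B' ⟨Q, f, hf, ⟨a⟩⟩ ⟨Q', f', hf', ⟨a'⟩⟩
    exact ⟨sum Q Q', f.prodMap f', hf.prodMap hf', ⟨(a.prodCongr a').trans (kerProdEquiv f f')⟩⟩
  shift_mem := by
    rintro Q N hQ ⟨Q', f, hf, ⟨e⟩⟩
    -- A projective module is its own cover, so by uniqueness its syzygy is zero.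
    have hid : IsProjectiveCover (LinearMap.id : Q →ₗ[Λ] Q) :=
      ⟨hQ, Function.surjective_id, fun N hN => by simpa [LinearMap.ker_id] using hN⟩
    obtain ⟨b⟩ := hf.exists_equiv hid (LinearEquiv.refl Λ Q)
    have : Subsingleton (LinearMap.ker (LinearMap.id : Q →ₗ[Λ] Q)) := by
      rw [LinearMap.ker_id]; infer_instance
    have : Subsingleton N := (e.trans b).toEquiv.subsingleton
    exact Module.Projective.of_free
  mem_of_summand h hQ := h.projective
  mem_prod {A B} hA hB := inferInstanceAs (Module.Projective Λ (A × B))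
  mem_of_subsingleton A hA := Module.Projective.of_free

end ProjectiveCovers

/-! ### Injective envelopes and cosyzygies -/

section InjectiveEnvelopes

variable {Λ : Type u} [Ring Λ] {M M' J J' : Type u} [AddCommGroup M] [Module Λ M]
  [AddCommGroup M'] [Module Λ M'] [AddCommGroup J] [Module Λ J] [AddCommGroup J'] [Module Λ J']

theorem IsInjectiveEnvelope.injective_of_comp {f : M →ₗ[Λ] J} (hf : IsInjectiveEnvelope f)
    {b : J →ₗ[Λ] J'} (hb : Function.Injective (b ∘ₗ f)) : Function.Injective b := by
  rw [← LinearMap.ker_eq_bot]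
  refine hf.2.2 _ (eq_bot_iff.2 ?_)
  rintro _ ⟨hx, m, rfl⟩
  have : m = 0 := hb (by simpa using hx)
  simp [this]

/-- An injective envelope is a retract of every monomorphism to an injective module. -/
theorem IsInjectiveEnvelope.exists_retract {f : M →ₗ[Λ] J} (hf : IsInjectiveEnvelope f)
    (hJ' : Module.Injective Λ J') {g : M →ₗ[Λ] J'} (hg : Function.Injective g) :
    ∃ (a : J →ₗ[Λ] J') (b : J' →ₗ[Λ] J), b ∘ₗ a = LinearMap.id ∧ a ∘ₗ f = g ∧ b ∘ₗ g = f := by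
  have := hf.1
  obtain ⟨a, ha⟩ := hJ'.out f hf.2.1 g
  have ha : a ∘ₗ f = g := LinearMap.ext ha
  obtain ⟨b, hb⟩ := hf.1.out a (hf.injective_of_comp (by rw [ha]; exact hg)) LinearMap.id
  have hb : b ∘ₗ a = LinearMap.id := LinearMap.ext hb
  exact ⟨a, b, hb, ha, by rw [← ha, ← LinearMap.comp_assoc, hb, LinearMap.id_comp]⟩

theorem IsInjectiveEnvelope.exists_equiv {f : M →ₗ[Λ] J} (hf : IsInjectiveEnvelope f)
    {f' : M' →ₗ[Λ] J'} (hf' : IsInjectiveEnvelope f') (e : M ≃ₗ[Λ] M') :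
    Nonempty ((J ⧸ LinearMap.range f) ≃ₗ[Λ] (J' ⧸ LinearMap.range f')) := by
  obtain ⟨a, b, hba, ha, hb⟩ := hf.exists_retract hf'.1
    (g := f' ∘ₗ (e : M →ₗ[Λ] M')) (hf'.2.1.comp e.injective)
  have hbi : Function.Injective b := hf'.injective_of_comp (b := b) (by
    have : b ∘ₗ f' = f ∘ₗ (e.symm : M' →ₗ[Λ] M) := by
      ext y
      have := LinearMap.congr_fun hb (e.symm y)
      simpa using this
    rw [this]
    exact hf.2.1.comp e.symm.injective)
  have hba' : ∀ x, b (a x) = x := fun x => LinearMap.congr_fun hba x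
  have hab : ∀ y, a (b y) = y := fun y => hbi (hba' _)
  let ε : J ≃ₗ[Λ] J' := { a with invFun := b, left_inv := hba', right_inv := hab }
  refine ⟨Submodule.Quotient.equiv _ _ ε ?_⟩
  ext y
  constructor
  · rintro ⟨_, ⟨m, rfl⟩, rfl⟩
    exact ⟨e m, (LinearMap.congr_fun ha m).symm⟩
  · rintro ⟨m, rfl⟩
    refine ⟨f (e.symm m), ⟨_, rfl⟩, ?_⟩
    exact (LinearMap.congr_fun ha (e.symm m)).trans (by simp)

theorem IsInjectiveEnvelope.prodMap {f : M →ₗ[Λ] J} (hf : IsInjectiveEnvelope f)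
    {f' : M' →ₗ[Λ] J'} (hf' : IsInjectiveEnvelope f') : IsInjectiveEnvelope (f.prodMap f') := by
  refine ⟨⟨fun A B _ _ _ _ i hi g => ?_⟩, hf.2.1.prodMap hf'.2.1, fun N hN => ?_⟩
  · obtain ⟨p, hp⟩ := hf.1.out i hi (LinearMap.fst Λ J J' ∘ₗ g)
    obtain ⟨q, hq⟩ := hf'.1.out i hi (LinearMap.snd Λ J J' ∘ₗ g)
    exact ⟨p.prod q, fun x => Prod.ext (hp x) (hq x)⟩
  have h1 : N ⊓ (LinearMap.range f).comap (LinearMap.fst Λ J J') = ⊥ := by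
    have h2 : (N ⊓ (LinearMap.range f).comap (LinearMap.fst Λ J J')).map
        (LinearMap.snd Λ J J') = ⊥ := by
      refine hf'.2.2 _ (eq_bot_iff.2 ?_)
      rintro _ ⟨⟨x, ⟨hxN, m, hm⟩, rfl⟩, m', hm'⟩
      have : x ∈ N ⊓ LinearMap.range (f.prodMap f') := ⟨hxN, (m, m'), Prod.ext hm hm'⟩
      rw [hN] at this
      have : x = 0 := this
      simp [this]
    rw [eq_bot_iff]
    intro x hx
    have hx2 : x.2 ∈ (⊥ : Submodule Λ J') := h2 ▸ ⟨x, hx, rfl⟩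
    have hx2 : x.2 = 0 := hx2
    obtain ⟨hxN, m, hm⟩ := hx
    have : x ∈ N ⊓ LinearMap.range (f.prodMap f') :=
      ⟨hxN, (m, 0), Prod.ext hm (by simp [hx2])⟩
    rwa [hN] at this
  have h3 : N.map (LinearMap.fst Λ J J') = ⊥ := by
    refine hf.2.2 _ (eq_bot_iff.2 ?_)
    rintro _ ⟨⟨x, hxN, rfl⟩, hx⟩
    have : x ∈ N ⊓ (LinearMap.range f).comap (LinearMap.fst Λ J J') := ⟨hxN, hx⟩
    rw [h1] at this
    have : x = 0 := this
    simp [this]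
  rw [eq_bot_iff, ← h1]
  intro x hx
  have hx1 : x.1 ∈ (⊥ : Submodule Λ J) := h3 ▸ ⟨x, hx, rfl⟩
  have hx1 : x.1 = 0 := hx1
  exact ⟨hx, 0, by simp [hx1]⟩

theorem exists_maximal_disjoint (A B : Submodule Λ J) (h : A ⊓ B = ⊥) :
    ∃ C, B ≤ C ∧ A ⊓ C = ⊥ ∧ ∀ D, C ≤ D → A ⊓ D = ⊥ → D = C := by
  obtain ⟨C, hBC, hC⟩ := zorn_le_nonempty₀ {C : Submodule Λ J | A ⊓ C = ⊥}
    (fun c hc hchain y hy => ⟨sSup c, by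
      change A ⊓ sSup c = ⊥
      rw [eq_bot_iff]
      rintro x ⟨hxA, hx⟩
      obtain ⟨D, hD, hxD⟩ := (Submodule.mem_sSup_of_directed ⟨y, hy⟩ hchain.directedOn).1 hx
      have : x ∈ A ⊓ D := ⟨hxA, hxD⟩
      rwa [(hc hD : A ⊓ D = ⊥)] at this, fun z hz => le_sSup hz⟩) B h
  exact ⟨C, hBC, hC.1, fun D hCD hD => le_antisymm (hC.2 hD hCD) hCD⟩

/-- Every module has an injective envelope. -/
theorem exists_injectiveEnvelope (Λ : Type u) [Ring Λ] (M : Type u) [AddCommGroup M]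
    [Module Λ M] : ∃ (J : Type u) (_ : AddCommGroup J) (_ : Module Λ J) (f : M →ₗ[Λ] J),
      IsInjectiveEnvelope f := by
  obtain ⟨⟨E, hE, i, hi⟩⟩ := CategoryTheory.EnoughInjectives.presentation (ModuleCat.of Λ M)
  have hE := (Module.injective_iff_injective_object Λ E).2 hE
  have hi : Function.Injective i.hom := (ModuleCat.mono_iff_injective i).1 hi
  -- Inside an injective `E` containing `M`, take `A` maximal with zero intersection with `M`, then
  -- `N ⊇ M` maximal with zero intersection with `A`. This `N` will be the envelope.
  obtain ⟨A, -, hA, hAmax⟩ := exists_maximal_disjoint (LinearMap.range i.hom) ⊥ (by simp)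
  obtain ⟨N, hMN, hN, hNmax⟩ := exists_maximal_disjoint A (LinearMap.range i.hom)
    (by rwa [inf_comm])
  have hAmax' : ∀ D, A ≤ D → N ⊓ D = ⊥ → D = A := fun D hD h => hAmax D hD
    (le_bot_iff.1 (h ▸ inf_le_inf_right _ hMN))
  -- the inclusion of `N` extends along the essential monomorphism `N → E ⧸ A`
  obtain ⟨g, hg⟩ := hE.out (A.mkQ ∘ₗ N.subtype) (by
    rw [← LinearMap.ker_eq_bot, eq_bot_iff]
    intro x hx
    have hx : (x : E) ∈ A := by simpa using hx
    have : (x : E) ∈ A ⊓ N := ⟨hx, x.2⟩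
    rw [hN] at this
    exact Subtype.ext this) N.subtype
  have hess : ∀ L : Submodule Λ (E ⧸ A), (∀ x ∈ L, ∀ n ∈ N, A.mkQ n = x → x = 0) → L = ⊥ := by
    intro L hL
    have h1 := hAmax' (L.comap A.mkQ) (fun x hx => by
      have : A.mkQ x = 0 := (Submodule.Quotient.mk_eq_zero A).2 hx
      rw [Submodule.mem_comap, this]; exact L.zero_mem) (by
      rw [eq_bot_iff]
      rintro x ⟨hxN, hx⟩
      have h2 : A.mkQ x = 0 := hL _ hx x hxN rfl
      have : x ∈ A ⊓ N := ⟨(Submodule.Quotient.mk_eq_zero A).1 h2, hxN⟩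
      rwa [hN] at this)
    rw [eq_bot_iff]
    intro x hx
    obtain ⟨x, rfl⟩ := A.mkQ_surjective x
    have : x ∈ L.comap A.mkQ := hx
    rw [h1] at this
    exact (Submodule.Quotient.mk_eq_zero A).2 this
  have hgN : ∀ n ∈ N, g (A.mkQ n) = n := fun n hn => hg ⟨n, hn⟩
  -- Since `N` is essential in `E ⧸ A` and `g` is the identity on it, `g` is injective. Its image
  -- meets `A` trivially, so maximality of `N` makes the image equal to `N`, and `E → E ⧸ A → N` is
  -- a retraction.
  have hginj : LinearMap.ker g = ⊥ := hess _ fun x hx n hn hnx => by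
    have hx : g x = 0 := hx
    rw [← hnx, hgN n hn] at hx
    rw [← hnx, hx, map_zero]
  have hrange : LinearMap.range g = N := by
    refine hNmax _ (fun n hn => ⟨A.mkQ n, hgN n hn⟩) ?_
    have : (A.comap g) = ⊥ := hess _ fun x hx n hn hnx => by
      have hx : g x ∈ A := hx
      rw [← hnx, hgN n hn] at hx
      rw [← hnx]
      exact (Submodule.Quotient.mk_eq_zero A).2 hx
    rw [eq_bot_iff]
    rintro _ ⟨hx, y, rfl⟩
    have : y ∈ A.comap g := hx
    rw [‹A.comap g = ⊥›] at this
    have : y = 0 := this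
    simp [this]
  have hsum : IsSummand (Λ := Λ) N E :=
    ⟨N.subtype, (g ∘ₗ A.mkQ).codRestrict N fun x => by
      rw [← hrange]; exact ⟨_, rfl⟩, LinearMap.ext fun n => Subtype.ext (hgN n n.2)⟩
  refine ⟨N, inferInstance, inferInstance, i.hom.codRestrict N fun m => hMN ⟨m, rfl⟩,
    hsum.injective, fun x y hxy => hi (congrArg Subtype.val hxy), fun L hL => ?_⟩
  -- If `L ⊆ N` meets `M` trivially, then so does `L + A`. Maximality of `A` gives `L ⊆ A`, whence
  -- `L ⊆ A ∩ N = 0`.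
  have h1 := hAmax (L.map N.subtype ⊔ A) le_sup_right (by
    rw [eq_bot_iff]
    rintro _ ⟨⟨m, rfl⟩, hx⟩
    obtain ⟨_, ⟨l, hl, rfl⟩, a, ha, hla⟩ := Submodule.mem_sup.1 hx
    have haN : a ∈ N := by
      have : a = i.hom m - l := by rw [← hla]; simp
      rw [this]
      exact N.sub_mem (hMN ⟨m, rfl⟩) l.2
    have ha0 : a ∈ A ⊓ N := ⟨ha, haN⟩
    rw [hN] at ha0
    have ha0 : a = 0 := ha0
    have hlm : l ∈ L ⊓ LinearMap.range (i.hom.codRestrict N fun m => hMN ⟨m, rfl⟩) :=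
      ⟨hl, m, Subtype.ext (by rw [ha0, add_zero] at hla; exact hla.symm)⟩
    rw [hL] at hlm
    have hlm : l = 0 := hlm
    rw [← hla, ha0, hlm]
    simp)
  rw [eq_bot_iff]
  intro l hl
  have h2 : (l : E) ∈ A ⊓ N := ⟨by
    rw [← h1]; exact Submodule.mem_sup_left ⟨l, hl, rfl⟩, l.2⟩
  rw [hN] at h2
  exact Subtype.ext h2

/-- Over an artinian ring, modules that are annihilated by the radical are semisimple. -/
theorem isSemisimpleModule_of_jacobson [IsArtinianRing Λ]
    (h : ∀ a ∈ Ring.jacobson Λ, ∀ x : M, a • x = 0) : IsSemisimpleModule Λ M := by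
  have h : Module.IsTorsionBySet Λ M (Ring.jacobson Λ) := fun x a => h a a.2 x
  let _ := h.module
  exact h.isSemisimpleModule_iff.1 inferInstance

variable (R : Type v) [CommRing R] [IsArtinianRing R] [Algebra R Λ] [Module.Finite R Λ]

include R in
/-- Over an artin algebra, essential extensions of finitely generated modules are finitely
generated. -/
theorem finite_of_essential (N : Submodule Λ J) [Module.Finite Λ N]
    (hN : ∀ L : Submodule Λ J, L ⊓ N = ⊥ → L = ⊥) : Module.Finite Λ J := by
  have : IsArtinianRing Λ := isArtinianRing_of_artinAlgebra R
  let _ : Module R J := Module.compHom J (algebraMap R Λ)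
  have : IsScalarTower R Λ J := ⟨fun r l p => by
    rw [Algebra.smul_def, mul_smul]; rfl⟩
  -- The elements killed by the radical form a semisimple module. A complement in it of its
  -- intersection with the essential submodule `N` must vanish, so it lies in `N`.
  let K : Submodule Λ J :=
    { carrier := {x | ∀ a ∈ Ring.jacobson Λ, a • x = 0}
      zero_mem' := fun a _ => smul_zero a
      add_mem' := fun hx hy a ha => by rw [smul_add, hx a ha, hy a ha, add_zero]
      smul_mem' := fun l x hx a ha => by
        rw [← mul_smul]; exact hx _ (Ideal.mul_mem_right l _ ha) }
  have hK : IsSemisimpleModule Λ K :=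
    isSemisimpleModule_of_jacobson fun a ha x => Subtype.ext (x.2 a ha)
  have hKN : K ≤ N := by
    obtain ⟨L, hL⟩ := exists_isCompl (N.comap K.subtype)
    have h1 := hN (L.map K.subtype) (by
      rw [eq_bot_iff]
      rintro _ ⟨⟨l, hl, rfl⟩, hlN⟩
      have : l ∈ N.comap K.subtype ⊓ L := ⟨hlN, hl⟩
      rw [hL.inf_eq_bot] at this
      have : l = 0 := this
      simp [this])
    have h2 : L = ⊥ := Submodule.map_injective_of_injective K.subtype_injective
      (h1.trans (Submodule.map_bot _).symm)
    have h3 := hL.sup_eq_top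
    rw [h2, sup_bot_eq] at h3
    intro x hx
    exact (h3 ▸ Submodule.mem_top : (⟨x, hx⟩ : K) ∈ N.comap K.subtype)
  -- `F i` is the annihilator in `J` of the i-th power of the radical. Multiplication by
  -- `R`-generators of the radical maps `F (i + 1)` to a finite power of `F i` with kernel inside
  -- `N`, so each `F i` is noetherian over `R`. Nilpotence of the radical gives `F m = J` for some
  -- `m`.
  let F (i : ℕ) : Submodule R J :=
    { carrier := {x | ∀ a ∈ Ring.jacobson Λ ^ i, a • x = 0}
      zero_mem' := fun a _ => smul_zero a
      add_mem' := fun hx hy a ha => by rw [smul_add, hx a ha, hy a ha, add_zero]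
      smul_mem' := fun r x hx a ha => by rw [smul_comm, hx a ha, smul_zero] }
  have hfin : ∀ i, IsNoetherian R (F i) := by
    intro i
    induction i with
    | zero =>
      have : Subsingleton (F 0) := ⟨fun x y => Subtype.ext <| by
        have h : ∀ z : F 0, (z : J) = 0 := fun z => by
          rw [← one_smul Λ (z : J)]
          exact z.2 1 (by rw [Submodule.pow_zero, Ideal.one_eq_top]; trivial)
        rw [h, h]⟩
      infer_instance
    | succ i ih =>
      obtain ⟨n, s, hs⟩ := Submodule.fg_iff_exists_fin_generating_family.1
        (IsNoetherian.noetherian ((Ring.jacobson Λ).restrictScalars R))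
      have hsr : ∀ k, s k ∈ Ring.jacobson Λ := fun k => by
        have : s k ∈ (Ring.jacobson Λ).restrictScalars R := hs ▸ Submodule.subset_span ⟨k, rfl⟩
        exact this
      let φ : F (i + 1) →ₗ[R] (Fin n → F i) :=
        { toFun := fun x k => ⟨s k • (x : J), fun b hb => by
            rw [← mul_smul]
            exact x.2 _ (by rw [Submodule.pow_succ]; exact Ideal.mul_mem_mul hb (hsr k))⟩
          map_add' := fun x y => funext fun k => Subtype.ext (smul_add _ _ _)
          map_smul' := fun r x => funext fun k => Subtype.ext (smul_comm _ _ _) }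
      have hker : ∀ x : LinearMap.ker φ, (x : J) ∈ N := fun x => hKN fun a ha => by
        have hx : ∀ k, s k • (x : J) = 0 := fun k =>
          congrArg Subtype.val (congrFun (LinearMap.mem_ker.1 x.2) k)
        replace ha : a ∈ Submodule.span R (Set.range s) := hs ▸ ha
        induction ha using Submodule.span_induction with
        | mem a ha => obtain ⟨k, rfl⟩ := ha; exact hx k
        | zero => exact zero_smul _ _
        | add a b _ _ ha hb => rw [add_smul, ha, hb, add_zero]
        | smul r a _ ha => rw [smul_assoc, ha, smul_zero]
      have : Module.Finite R N := Module.Finite.trans Λ N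
      have hk : IsNoetherian R (LinearMap.ker φ) :=
        isNoetherian_of_injective
          ({ toFun := fun x => ⟨x, hker x⟩, map_add' := fun _ _ => rfl,
             map_smul' := fun _ _ => rfl } : LinearMap.ker φ →ₗ[R] N)
          fun x y hxy => Subtype.ext (Subtype.ext (congrArg (fun z : N => (z : J)) hxy))
      exact isNoetherian_of_range_eq_ker (LinearMap.ker φ).subtype φ (by simp)
  obtain ⟨m, hm⟩ := IsSemiprimaryRing.isNilpotent (R := Λ)
  have htop : F m = ⊤ := by
    rw [eq_top_iff]
    intro x _ a ha
    rw [hm] at ha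
    have ha : a = 0 := ha
    rw [ha, zero_smul]
  have h2 := hfin m
  rw [htop] at h2
  have : Module.Finite R J := Module.Finite.equiv (Submodule.topEquiv : (⊤ : Submodule R J) ≃ₗ[R] J)
  exact Module.Finite.of_restrictScalars_finite R Λ J

include R in
theorem IsInjectiveEnvelope.finite [Module.Finite Λ M] {f : M →ₗ[Λ] J}
    (hf : IsInjectiveEnvelope f) : Module.Finite Λ J :=
  finite_of_essential R (LinearMap.range f) hf.2.2

include R in
theorem exists_injectiveEnvelope_fg (M : FGModuleCat.{u} Λ) :
    ∃ (J : FGModuleCat.{u} Λ) (f : M →ₗ[Λ] J), IsInjectiveEnvelope f := by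
  obtain ⟨J, _, _, f, hf⟩ := exists_injectiveEnvelope Λ M
  have := hf.finite R
  exact ⟨FGModuleCat.of Λ J, f, hf⟩

/-- Over an artinian ring, injective envelopes are the left minimal monomorphisms. -/
theorem isInjectiveEnvelope_iff_minimal [IsArtinianRing Λ] {M J : FGModuleCat.{u} Λ}
    (hJ : Module.Injective Λ J) {f : M →ₗ[Λ] J} (hf : Function.Injective f) :
    IsInjectiveEnvelope f ↔ ∀ u : J →ₗ[Λ] J, u ∘ₗ f = f → Function.Bijective u := by
  constructor
  · intro h u hu
    have hs := h.injective_of_comp (b := u) (by rw [hu]; exact hf)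
    exact ⟨hs, IsArtinian.surjective_of_injective_endomorphism u hs⟩
  · intro h
    refine ⟨hJ, hf, fun N hN => ?_⟩
    obtain ⟨J', _, _, f', hf'⟩ := exists_injectiveEnvelope Λ M
    obtain ⟨a, b, hba, ha, hb⟩ := hf'.exists_retract hJ hf
    have hab := h (a ∘ₗ b) (by rw [LinearMap.comp_assoc, hb, ha])
    have hbi : Function.Injective b := .of_comp hab.1
    have hN' : N.map b = ⊥ := by
      refine hf'.2.2 _ (eq_bot_iff.2 ?_)
      rintro _ ⟨⟨n, hn, rfl⟩, m, hm⟩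
      rw [← hb] at hm
      have hnm : f m = n := hbi hm
      have : n ∈ N ⊓ LinearMap.range f := ⟨hn, m, hnm⟩
      rw [hN] at this
      have : n = 0 := this
      simp [this]
    exact Submodule.map_injective_of_injective hbi (hN'.trans (Submodule.map_bot _).symm)

/-- The cokernel of a direct sum of maps. -/
theorem nonempty_cokerProdEquiv (f : M →ₗ[Λ] J) (f' : M' →ₗ[Λ] J') :
    Nonempty (((J ⧸ LinearMap.range f) × (J' ⧸ LinearMap.range f')) ≃ₗ[Λ]
      ((J × J') ⧸ LinearMap.range (f.prodMap f'))) := by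
  let φ : (J × J') →ₗ[Λ] ((J ⧸ LinearMap.range f) × (J' ⧸ LinearMap.range f')) :=
    (LinearMap.range f).mkQ.prodMap (LinearMap.range f').mkQ
  have h1 : LinearMap.ker φ = LinearMap.range (f.prodMap f') := by
    rw [LinearMap.ker_prodMap, Submodule.ker_mkQ, Submodule.ker_mkQ, LinearMap.range_prodMap]
  have h2 : Function.Surjective φ :=
    (Submodule.mkQ_surjective _).prodMap (Submodule.mkQ_surjective _)
  rw [← h1]
  exact ⟨(φ.quotKerEquivOfSurjective h2).symm⟩

include R in
theorem isShift_injective :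
    IsShift (fun J : FGModuleCat.{u} Λ => Module.Injective Λ J) IsCosyzygy where
  exists_shift M := by
    obtain ⟨J, f, hf⟩ := exists_injectiveEnvelope_fg R M
    exact ⟨FGModuleCat.of Λ (J ⧸ LinearMap.range f), J, f, hf, ⟨LinearEquiv.refl Λ _⟩⟩
  unique := by
    rintro M M' N N' e ⟨J, f, hf, ⟨a⟩⟩ ⟨J', f', hf', ⟨a'⟩⟩
    obtain ⟨b⟩ := hf.exists_equiv hf' e
    exact ⟨a.trans (b.trans a'.symm)⟩
  prod := by
    rintro A A' B B' ⟨J, f, hf, ⟨a⟩⟩ ⟨J', f', hf', ⟨a'⟩⟩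
    obtain ⟨b⟩ := nonempty_cokerProdEquiv f f'
    exact ⟨sum J J', f.prodMap f', hf.prodMap hf', ⟨(a.prodCongr a').trans b⟩⟩
  shift_mem := by
    rintro J N hJ ⟨J', f, hf, ⟨e⟩⟩
    have hid : IsInjectiveEnvelope (LinearMap.id : J →ₗ[Λ] J) :=
      ⟨hJ, Function.injective_id, fun N hN => by simpa [LinearMap.range_id] using hN⟩
    obtain ⟨b⟩ := hf.exists_equiv hid (LinearEquiv.refl Λ J)
    have : Subsingleton (J ⧸ LinearMap.range (LinearMap.id : J →ₗ[Λ] J)) := by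
      rw [LinearMap.range_id]; infer_instance
    have : Subsingleton N := (e.trans b).toEquiv.subsingleton
    exact ⟨fun _ _ _ _ _ _ _ _ _ => ⟨0, fun _ => Subsingleton.elim _ _⟩⟩
  mem_of_summand h hQ := h.injective
  mem_prod {A B} hA hB := ⟨fun X Y _ _ _ _ i hi g => by
    obtain ⟨p, hp⟩ := hA.out i hi (LinearMap.fst Λ A B ∘ₗ g)
    obtain ⟨q, hq⟩ := hB.out i hi (LinearMap.snd Λ A B ∘ₗ g)
    exact ⟨p.prod q, fun x => Prod.ext (hp x) (hq x)⟩⟩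
  mem_of_subsingleton A hA := ⟨fun _ _ _ _ _ _ _ _ _ => ⟨0, fun _ => Subsingleton.elim _ _⟩⟩

end InjectiveEnvelopes

/-! ### Projective and injective dimension under the equivalence -/

section Dimension

open CategoryTheory

/-- Dimension shifting along 0 → K → Q → X → 0. It starts at bound two for `X`, so dimension
comparisons treat zero modules and projective modules separately. -/
theorem hasProjectiveDimensionLT_of_isSyzygy {Λ : Type u} [Ring Λ] {X K : FGModuleCat.{u} Λ}
    (h : IsSyzygy X K) (n : ℕ) :
    HasProjectiveDimensionLT X.obj (n + 2) ↔ HasProjectiveDimensionLT K.obj (n + 1) := by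
  obtain ⟨Q, f, hf, ⟨e⟩⟩ := h
  let S : ShortComplex (ModuleCat.{u} Λ) := ShortComplex.mk (X₁ := K.obj) (X₂ := Q.obj)
    (X₃ := X.obj) (ModuleCat.ofHom ((LinearMap.ker f).subtype ∘ₗ (e : K →ₗ[Λ] _)))
    (ModuleCat.ofHom f) (by
      ext x
      exact (e x).2)
  have hS : S.ShortExact := ModuleCat.shortComplex_shortExact S
    (fun x => ⟨fun hx => ⟨e.symm ⟨x, hx⟩, by simp [S]⟩, by
      rintro ⟨y, rfl⟩
      exact (e y).2⟩)
    ((LinearMap.ker f).subtype_injective.comp e.injective) hf.2.1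
  exact hS.hasProjectiveDimensionLT_X₃_iff n ((IsProjective.iff_projective Q).1 hf.1)

theorem hasInjectiveDimensionLT_of_isCosyzygy {Λ : Type u} [Ring Λ] {X K : FGModuleCat.{u} Λ}
    (h : IsCosyzygy X K) (n : ℕ) :
    HasInjectiveDimensionLT X.obj (n + 2) ↔ HasInjectiveDimensionLT K.obj (n + 1) := by
  obtain ⟨J, f, hf, ⟨e⟩⟩ := h
  let S : ShortComplex (ModuleCat.{u} Λ) := ShortComplex.mk (X₁ := X.obj) (X₂ := J.obj)
    (X₃ := K.obj) (ModuleCat.ofHom f)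
    (ModuleCat.ofHom ((e.symm : _ →ₗ[Λ] K) ∘ₗ (LinearMap.range f).mkQ)) (by
      ext x
      change e.symm ((LinearMap.range f).mkQ (f x)) = 0
      rw [LinearEquiv.map_eq_zero_iff]
      exact (Submodule.Quotient.mk_eq_zero _).2 ⟨x, rfl⟩)
  have hS : S.ShortExact := ModuleCat.shortComplex_shortExact S
    (fun x => by
      change e.symm ((LinearMap.range f).mkQ x) = 0 ↔ x ∈ LinearMap.range f
      rw [LinearEquiv.map_eq_zero_iff]
      exact Submodule.Quotient.mk_eq_zero _)
    hf.2.1 (e.symm.surjective.comp (Submodule.mkQ_surjective _))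
  exact (hS.hasInjectiveDimensionLT_X₃_iff n
    ((Module.injective_iff_injective_object Λ J).1 hf.1)).symm

variable {Λ Γ : Type u} [Ring Λ] [Ring Γ] {F : AddFunctor Λ Γ} {C : Set (FGModuleCat.{u} Λ)}

theorem IsEquivOn.subsingleton_iff (h : IsEquivOn F C) {X : FGModuleCat.{u} Λ} (hX : X ∈ C) :
    Subsingleton (F.obj X) ↔ Subsingleton X := by
  have key : ∀ (Δ : Type u) [Ring Δ] (M : FGModuleCat.{u} Δ),
      Subsingleton M ↔ (LinearMap.id : M →ₗ[Δ] M) = 0 := fun Δ _ M =>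
    ⟨fun H => by ext x; exact Subsingleton.elim _ _, fun H => ⟨fun x y => by
      rw [← LinearMap.id_apply (R := Δ) x, ← LinearMap.id_apply (R := Δ) y, H]; rfl⟩⟩
  rw [key, key, ← F.map_id, ← F.map.map_zero]
  exact (h.full hX hX).1.eq_iff

theorem IsShiftEquivOn.projectiveDimension_obj
    (h : IsShiftEquivOn F C (fun Q : FGModuleCat.{u} Λ => Module.Projective Λ Q) IsSyzygy
      (fun Q : FGModuleCat.{u} Γ => Module.Projective Γ Q) IsSyzygy)
    {X : FGModuleCat.{u} Λ} (hX : X ∈ C) :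
    projectiveDimension (F.obj X).obj = projectiveDimension X.obj := by
  have key : ∀ n : ℕ, ∀ X ∈ C, HasProjectiveDimensionLT (F.obj X).obj n ↔
      HasProjectiveDimensionLT X.obj n := by
    intro n
    induction n with
    | zero =>
      intro X hX
      rw [hasProjectiveDimensionLT_zero_iff_isZero, hasProjectiveDimensionLT_zero_iff_isZero,
        ModuleCat.isZero_iff_subsingleton, ModuleCat.isZero_iff_subsingleton]
      exact h.subsingleton_iff hX
    | succ n ih =>
      intro X hX
      cases n with
      | zero =>
        rw [← projective_iff_hasProjectiveDimensionLT_one,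
          ← projective_iff_hasProjectiveDimensionLT_one]
        exact (IsProjective.iff_projective (F.obj X)).symm.trans
          ((h.map_mem hX).trans (IsProjective.iff_projective X))
      | succ n =>
        obtain ⟨K, hK⟩ := h.isShift.exists_shift X
        rw [hasProjectiveDimensionLT_of_isSyzygy hK,
          hasProjectiveDimensionLT_of_isSyzygy (h.map_shift hX hK)]
        exact ih K (h.shift_mem hX hK)
  simp only [projectiveDimension, fun n => key n X hX]

theorem IsShiftEquivOn.injectiveDimension_obj
    (h : IsShiftEquivOn F C (fun J : FGModuleCat.{u} Λ => Module.Injective Λ J) IsCosyzygy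
      (fun J : FGModuleCat.{u} Γ => Module.Injective Γ J) IsCosyzygy)
    {X : FGModuleCat.{u} Λ} (hX : X ∈ C) :
    injectiveDimension (F.obj X).obj = injectiveDimension X.obj := by
  have key : ∀ n : ℕ, ∀ X ∈ C, HasInjectiveDimensionLT (F.obj X).obj n ↔
      HasInjectiveDimensionLT X.obj n := by
    intro n
    induction n with
    | zero =>
      intro X hX
      rw [hasInjectiveDimensionLT_zero_iff_isZero, hasInjectiveDimensionLT_zero_iff_isZero,
        ModuleCat.isZero_iff_subsingleton, ModuleCat.isZero_iff_subsingleton]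
      exact h.subsingleton_iff hX
    | succ n ih =>
      intro X hX
      cases n with
      | zero =>
        rw [← injective_iff_hasInjectiveDimensionLT_one,
          ← injective_iff_hasInjectiveDimensionLT_one]
        exact (Module.injective_iff_injective_object Γ (F.obj X)).symm.trans
          ((h.map_mem hX).trans (Module.injective_iff_injective_object Λ X))
      | succ n =>
        obtain ⟨K, hK⟩ := h.isShift.exists_shift X
        rw [hasInjectiveDimensionLT_of_isCosyzygy hK,
          hasInjectiveDimensionLT_of_isCosyzygy (h.map_shift hX hK)]
        exact ih K (h.shift_mem hX hK)
  simp only [injectiveDimension, fun n => key n X hX]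

theorem IsShiftEquivOn.phiLDim_le
    (h : IsShiftEquivOn F C (fun Q : FGModuleCat.{u} Λ => Module.Projective Λ Q) IsSyzygy
      (fun Q : FGModuleCat.{u} Γ => Module.Projective Γ Q) IsSyzygy) :
    phiLDim Γ ≤ phiLDim Λ ∧ psiLDim Γ ≤ psiLDim Λ :=
  h.iSup_le (fun _ hX => h.projectiveDimension_obj hX)
    fun _ _ e => projectiveDimension_eq_of_iso e.toModuleIso

theorem IsShiftEquivOn.phiRDim_le
    (h : IsShiftEquivOn F C (fun J : FGModuleCat.{u} Λ => Module.Injective Λ J) IsCosyzygy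
      (fun J : FGModuleCat.{u} Γ => Module.Injective Γ J) IsCosyzygy) :
    phiRDim Γ ≤ phiRDim Λ ∧ psiRDim Γ ≤ psiRDim Λ :=
  h.iSup_le (fun _ hX => h.injectiveDimension_obj hX)
    fun _ _ e => injectiveDimension_eq_of_iso e.toModuleIso

end Dimension

/-! ### Splicing and truncating resolutions -/

section Resolutions

variable {Λ : Type u} [Ring Λ]

/-- `X` has a resolution by finitely generated projective modules whose `i`-th term satisfies
`c i`. -/
def HasProjRes (c : ℕ → FGModuleCat.{u} Λ → Prop) (X : FGModuleCat.{u} Λ) : Prop :=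
  ∃ (Q : ℕ → FGModuleCat.{u} Λ) (ε : Q 0 →ₗ[Λ] X) (d : ∀ n, Q (n + 1) →ₗ[Λ] Q n),
    (∀ n, Module.Projective Λ (Q n)) ∧ Function.Surjective ε ∧ Function.Exact (d 0) ε ∧
    (∀ n, Function.Exact (d (n + 1)) (d n)) ∧ ∀ i, c i (Q i)

/-- `X` has a coresolution by finitely generated injective modules whose `i`-th term satisfies
`c i`. -/
def HasInjRes (c : ℕ → FGModuleCat.{u} Λ → Prop) (X : FGModuleCat.{u} Λ) : Prop :=
  ∃ (J : ℕ → FGModuleCat.{u} Λ) (η : X →ₗ[Λ] J 0) (d : ∀ n, J n →ₗ[Λ] J (n + 1)),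
    (∀ n, Module.Injective Λ (J n)) ∧ Function.Injective η ∧ Function.Exact η (d 0) ∧
    (∀ n, Function.Exact (d n) (d (n + 1))) ∧ ∀ i, c i (J i)

theorem mem_PPres_iff {P : Type u} [AddCommGroup P] [Module Λ P] {k : ℕ∞}
    {X : FGModuleCat.{u} Λ} :
    X ∈ PPres (Λ := Λ) P k ↔ HasProjRes (fun i Q => (i : ℕ∞) ≤ k → InAdd (Λ := Λ) P Q) X :=
  Iff.rfl

theorem mem_IIres_iff {I : Type u} [AddCommGroup I] [Module Λ I] {k : ℕ∞}
    {X : FGModuleCat.{u} Λ} :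
    X ∈ IIres (Λ := Λ) I k ↔ HasInjRes (fun i J => (i : ℕ∞) ≤ k → InAdd (Λ := Λ) I J) X :=
  Iff.rfl

variable {c : ℕ → FGModuleCat.{u} Λ → Prop} {X Y : FGModuleCat.{u} Λ}

theorem HasProjRes.of_equiv (h : HasProjRes c X) (e : X ≃ₗ[Λ] Y) : HasProjRes c Y := by
  obtain ⟨Q, ε, d, h1, h2, h3, h4, h5⟩ := h
  refine ⟨Q, (e : X →ₗ[Λ] Y) ∘ₗ ε, d, h1, e.surjective.comp h2, fun x => ?_, h4, h5⟩
  rw [← h3 x]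
  exact e.map_eq_zero_iff

theorem HasInjRes.of_equiv (h : HasInjRes c X) (e : Y ≃ₗ[Λ] X) : HasInjRes c Y := by
  obtain ⟨J, η, d, h1, h2, h3, h4, h5⟩ := h
  refine ⟨J, η ∘ₗ (e : Y →ₗ[Λ] X), d, h1, h2.comp e.injective, fun x => ?_, h4, h5⟩
  rw [h3 x]
  exact ⟨fun ⟨y, hy⟩ => ⟨e.symm y, by simpa using hy⟩, fun ⟨y, hy⟩ => ⟨e y, hy⟩⟩

/-- The sequence `A, B 0, B 1, …`. -/
def consSeq (A : FGModuleCat.{u} Λ) (B : ℕ → FGModuleCat.{u} Λ) : ℕ → FGModuleCat.{u} Λ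
  | 0 => A
  | n + 1 => B n

/-- The sequence of maps `⋯ → B 1 → B 0 → A`. -/
def consMap {A : FGModuleCat.{u} Λ} {B : ℕ → FGModuleCat.{u} Λ} (f : B 0 →ₗ[Λ] A)
    (d : ∀ n, B (n + 1) →ₗ[Λ] B n) : ∀ n, consSeq A B (n + 1) →ₗ[Λ] consSeq A B n
  | 0 => f
  | n + 1 => d n

/-- The sequence of maps `A → B 0 → B 1 → ⋯`. -/
def consMap' {A : FGModuleCat.{u} Λ} {B : ℕ → FGModuleCat.{u} Λ} (f : A →ₗ[Λ] B 0)
    (d : ∀ n, B n →ₗ[Λ] B (n + 1)) : ∀ n, consSeq A B n →ₗ[Λ] consSeq A B (n + 1)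
  | 0 => f
  | n + 1 => d n

theorem hasProjRes_of_ker [IsArtinianRing Λ] {Q : FGModuleCat.{u} Λ}
    (hQ : Module.Projective Λ Q) (hc : c 0 Q) {ε : Q →ₗ[Λ] X} (hε : Function.Surjective ε)
    (h : HasProjRes (fun i => c (i + 1)) (FGModuleCat.of Λ (LinearMap.ker ε))) :
    HasProjRes c X := by
  obtain ⟨Q', ε', d', h1, h2, h3, h4, h5⟩ := h
  refine ⟨consSeq Q Q', ε, consMap ((LinearMap.ker ε).subtype ∘ₗ ε') d',
    fun n => ?_, hε, fun x => ?_, fun n => ?_, fun n => ?_⟩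
  · cases n
    exacts [hQ, h1 _]
  · constructor
    · intro hx
      obtain ⟨y, hy⟩ := h2 ⟨x, hx⟩
      exact ⟨y, congrArg Subtype.val hy⟩
    · rintro ⟨y, rfl⟩
      exact (ε' y).2
  · cases n with
    | zero =>
      exact fun x => Subtype.ext_iff.symm.trans (h3 x)
    | succ n => exact h4 n
  · cases n
    exacts [hc, h5 _]

theorem hasInjRes_of_coker {J : FGModuleCat.{u} Λ}
    (hJ : Module.Injective Λ J) (hc : c 0 J) {η : X →ₗ[Λ] J} (hη : Function.Injective η)
    (h : HasInjRes (fun i => c (i + 1)) (FGModuleCat.of Λ (J ⧸ LinearMap.range η))) :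
    HasInjRes c X := by
  obtain ⟨J', η', d', h1, h2, h3, h4, h5⟩ := h
  refine ⟨consSeq J J', η, consMap' (η' ∘ₗ (LinearMap.range η).mkQ) d',
    fun n => ?_, hη, fun x => ?_, fun n => ?_, fun n => ?_⟩
  · cases n
    exacts [hJ, h1 _]
  · exact (map_eq_zero_iff η' h2).trans (Submodule.Quotient.mk_eq_zero (LinearMap.range η))
  · cases n with
    | zero =>
      intro x
      refine (h3 x).trans ⟨?_, ?_⟩
      · rintro ⟨y, rfl⟩
        obtain ⟨y, rfl⟩ := Submodule.mkQ_surjective _ y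
        exact ⟨y, rfl⟩
      · rintro ⟨y, rfl⟩
        exact ⟨_, rfl⟩
    | succ n => exact h4 n
  · cases n
    exacts [hc, h5 _]

theorem HasProjRes.exists_ker [IsArtinianRing Λ] (h : HasProjRes c X) :
    ∃ (Q : FGModuleCat.{u} Λ) (ε : Q →ₗ[Λ] X), Module.Projective Λ Q ∧ c 0 Q ∧
      Function.Surjective ε ∧
      HasProjRes (fun i => c (i + 1)) (FGModuleCat.of Λ (LinearMap.ker ε)) := by
  obtain ⟨Q, ε, d, h1, h2, h3, h4, h5⟩ := h
  refine ⟨Q 0, ε, h1 0, h5 0, h2, fun n => Q (n + 1),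
    (d 0).codRestrict (LinearMap.ker ε) fun x => (h3 _).2 ⟨x, rfl⟩, fun n => d (n + 1),
    fun n => h1 _, fun x => ?_, fun x => ?_, fun n => h4 _, fun n => h5 _⟩
  · obtain ⟨y, hy⟩ := (h3 x).1 x.2
    exact ⟨y, Subtype.ext hy⟩
  · rw [← h4 0 x]
    exact Subtype.ext_iff

theorem HasInjRes.exists_coker (h : HasInjRes c X) :
    ∃ (J : FGModuleCat.{u} Λ) (η : X →ₗ[Λ] J), Module.Injective Λ J ∧ c 0 J ∧
      Function.Injective η ∧
      HasInjRes (fun i => c (i + 1)) (FGModuleCat.of Λ (J ⧸ LinearMap.range η)) := by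
  obtain ⟨J, η, d, h1, h2, h3, h4, h5⟩ := h
  have hle : LinearMap.range η ≤ LinearMap.ker (d 0) := by
    rintro _ ⟨y, rfl⟩
    exact (h3 _).2 ⟨y, rfl⟩
  refine ⟨J 0, η, h1 0, h5 0, h2, fun n => J (n + 1), (LinearMap.range η).liftQ (d 0) hle,
    fun n => d (n + 1), fun n => h1 _, ?_, fun x => (h4 0 x).trans ⟨?_, ?_⟩, fun n => h4 _,
    fun n => h5 _⟩
  · refine LinearMap.ker_eq_bot.1 (Submodule.ker_liftQ_eq_bot _ _ _ fun x hx => ?_)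
    exact (h3 x).1 hx
  · rintro ⟨y, rfl⟩
    exact ⟨(LinearMap.range η).mkQ y, rfl⟩
  · rintro ⟨y, rfl⟩
    obtain ⟨y, rfl⟩ := Submodule.mkQ_surjective _ y
    exact ⟨y, rfl⟩

theorem hasProjRes_of_forall [IsArtinianRing Λ] (hc : ∀ i Q, c i Q) (X : FGModuleCat.{u} Λ) :
    HasProjRes c X := by
  choose Q f hf using exists_projectiveCover (Λ := Λ)
  -- `K n` is the n-th iterated kernel of the chosen covers; `g` views the next cover as a map onto
  -- that kernel.
  let K : ℕ → FGModuleCat.{u} Λ := fun n =>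
    Nat.rec X (fun _ Y => FGModuleCat.of Λ (LinearMap.ker (f Y))) n
  let g : ∀ n, Q (K (n + 1)) →ₗ[Λ] LinearMap.ker (f (K n)) := fun n => f (K (n + 1))
  have hg : ∀ n, Function.Surjective (g n) := fun n => (hf (K (n + 1))).2.1
  refine ⟨fun n => Q (K n), f X, fun n => (LinearMap.ker (f (K n))).subtype ∘ₗ g n,
    fun n => (hf _).1, (hf X).2.1, fun x => ⟨fun hx => ?_, ?_⟩, fun n x => ⟨fun hx => ?_, ?_⟩,
    fun i => hc _ _⟩
  · obtain ⟨y, hy⟩ := hg 0 ⟨x, hx⟩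
    exact ⟨y, congrArg Subtype.val hy⟩
  · rintro ⟨y, rfl⟩
    exact (g 0 y).2
  · obtain ⟨y, hy⟩ := hg (n + 1) ⟨x, Subtype.ext hx⟩
    exact ⟨y, congrArg Subtype.val hy⟩
  · rintro ⟨y, rfl⟩
    exact congrArg Subtype.val (g (n + 1) y).2

theorem hasInjRes_of_forall (R : Type v) [CommRing R] [IsArtinianRing R] [Algebra R Λ]
    [Module.Finite R Λ] (hc : ∀ i J, c i J) (X : FGModuleCat.{u} Λ) :
    HasInjRes c X := by
  choose J f hf using exists_injectiveEnvelope_fg (Λ := Λ) R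
  let K : ℕ → FGModuleCat.{u} Λ := fun n =>
    Nat.rec X (fun _ Y => FGModuleCat.of Λ (J Y ⧸ LinearMap.range (f Y))) n
  let g : ∀ n, (J (K n) ⧸ LinearMap.range (f (K n))) →ₗ[Λ] J (K (n + 1)) := fun n => f (K (n + 1))
  have hg : ∀ n, Function.Injective (g n) := fun n => (hf (K (n + 1))).2.1
  have hz : ∀ n x, g n ((LinearMap.range (f (K n))).mkQ x) = 0 ↔ x ∈ LinearMap.range (f (K n)) :=
    fun n x => by
      rw [map_eq_zero_iff _ (hg n), ← LinearMap.mem_ker, Submodule.ker_mkQ]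
  refine ⟨fun n => J (K n), f X, fun n => g n ∘ₗ (LinearMap.range (f (K n))).mkQ,
    fun n => (hf _).1, (hf X).2.1, fun x => hz 0 x, fun n x => (hz (n + 1) x).trans ⟨?_, ?_⟩,
    fun i => hc _ _⟩
  · rintro ⟨y, rfl⟩
    obtain ⟨y', rfl⟩ := Submodule.mkQ_surjective _ y
    exact ⟨y', rfl⟩
  · rintro ⟨y, rfl⟩
    exact ⟨_, rfl⟩

theorem HasProjRes.mono {c' : ℕ → FGModuleCat.{u} Λ → Prop} (hc : ∀ i Q, c i Q → c' i Q)
    (h : HasProjRes c X) : HasProjRes c' X := by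
  obtain ⟨Q, ε, d, h1, h2, h3, h4, h5⟩ := h
  exact ⟨Q, ε, d, h1, h2, h3, h4, fun i => hc _ _ (h5 i)⟩

theorem HasInjRes.mono {c' : ℕ → FGModuleCat.{u} Λ → Prop} (hc : ∀ i Q, c i Q → c' i Q)
    (h : HasInjRes c X) : HasInjRes c' X := by
  obtain ⟨Q, ε, d, h1, h2, h3, h4, h5⟩ := h
  exact ⟨Q, ε, d, h1, h2, h3, h4, fun i => hc _ _ (h5 i)⟩

end Resolutions

/-! ### Where Hom(P, -) is fully faithful -/

section FullyFaithful

variable {Λ : Type u} [Ring Λ] {P X Y W : Type u} [AddCommGroup P] [Module Λ P]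
  [AddCommGroup X] [Module Λ X] [AddCommGroup Y] [Module Λ Y] [AddCommGroup W] [Module Λ W]

theorem exists_comp_eq [Module.Projective Λ P] {f : X →ₗ[Λ] Y} {h : P →ₗ[Λ] Y}
    (H : ∀ p, h p ∈ LinearMap.range f) : ∃ k : P →ₗ[Λ] X, f ∘ₗ k = h := by
  obtain ⟨k, hk⟩ := Module.projective_lifting_property f.rangeRestrict
    (h.codRestrict (LinearMap.range f) H) f.surjective_rangeRestrict
  exact ⟨k, LinearMap.ext fun p => congrArg Subtype.val (LinearMap.congr_fun hk p)⟩

theorem postcomp_surjective [Module.Projective Λ P] {f : X →ₗ[Λ] Y}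
    (hf : Function.Surjective f) : Function.Surjective (postcomp P f) := fun h =>
  exists_comp_eq fun p => hf (h p)

theorem postcomp_injective {f : X →ₗ[Λ] Y} (hf : Function.Injective f) :
    Function.Injective (postcomp P f) := fun _ _ hgh => LinearMap.ext fun p =>
  hf (LinearMap.congr_fun hgh p)

theorem postcomp_exact [Module.Projective Λ P] {f : X →ₗ[Λ] Y} {g : Y →ₗ[Λ] W}
    (hfg : Function.Exact f g) : Function.Exact (postcomp P f) (postcomp P g) := fun h =>
  ⟨fun hh => exists_comp_eq fun p => (hfg _).1 (LinearMap.congr_fun hh p), by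
    rintro ⟨k, rfl⟩
    exact LinearMap.ext fun p => (hfg _).2 ⟨k p, rfl⟩⟩

variable (P) in
/-- `Hom(P, -)` preserves kernels. -/
def homKerEquiv (f : X →ₗ[Λ] Y) :
    (P →ₗ[Λ] LinearMap.ker f) ≃ₗ[(Module.End Λ P)ᵐᵒᵖ] LinearMap.ker (postcomp P f) where
  toFun h := ⟨(LinearMap.ker f).subtype ∘ₗ h, LinearMap.ext fun p => (h p).2⟩
  map_add' _ _ := rfl
  map_smul' _ _ := rfl
  invFun h := LinearMap.codRestrict _ h.1 fun p => LinearMap.congr_fun h.2 p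

/-- `Hom(P, -)` preserves cokernels if `P` is projective. -/
theorem nonempty_homCokerEquiv [Module.Projective Λ P] {f : X →ₗ[Λ] Y} {g : Y →ₗ[Λ] W}
    (hg : Function.Surjective g) (hfg : Function.Exact f g) :
    Nonempty (((P →ₗ[Λ] Y) ⧸ LinearMap.range (postcomp P f)) ≃ₗ[(Module.End Λ P)ᵐᵒᵖ]
      (P →ₗ[Λ] W)) := by
  rw [← (postcomp_exact (P := P) hfg).linearMap_ker_eq]
  exact ⟨(postcomp P g).quotKerEquivOfSurjective (postcomp_surjective hg)⟩

theorem InAdd.of_isSummand (h : InAdd (Λ := Λ) P Y) (hXY : IsSummand (Λ := Λ) X Y) :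
    InAdd (Λ := Λ) P X := by
  obtain ⟨n, hn⟩ := h
  exact ⟨n, hXY.trans hn⟩

theorem inAdd_pi (n : ℕ) : InAdd (Λ := Λ) P (Fin n → P) :=
  ⟨n, .of_equiv (LinearEquiv.refl Λ _)⟩

/-- `Hom(P, -)` is fully faithful on maps out of `X`. -/
def IsLeftFull (P X : Type u) [AddCommGroup P] [Module Λ P] [AddCommGroup X] [Module Λ X] :
    Prop :=
  ∀ X' : FGModuleCat.{u} Λ, Function.Bijective fun f : X →ₗ[Λ] X' => postcomp P f

/-- `Hom(P, -)` is fully faithful on maps into `X`. -/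
def IsRightFull (P X : Type u) [AddCommGroup P] [Module Λ P] [AddCommGroup X] [Module Λ X] :
    Prop :=
  ∀ X' : FGModuleCat.{u} Λ, Function.Bijective fun f : X' →ₗ[Λ] X => postcomp P f

theorem IsLeftFull.of_isSummand (hY : IsLeftFull (Λ := Λ) P Y) (h : IsSummand (Λ := Λ) X Y) :
    IsLeftFull (Λ := Λ) P X := by
  obtain ⟨i, p, hip⟩ := h
  refine fun X' => ⟨fun f g hfg => ?_, fun t => ?_⟩
  · have : f ∘ₗ p = g ∘ₗ p := (hY X').1 (by
      change postcomp P f ∘ₗ postcomp P p = postcomp P g ∘ₗ postcomp P p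
      exact congrArg (· ∘ₗ postcomp P p) hfg)
    rw [← LinearMap.comp_id f, ← hip, ← LinearMap.comp_assoc, this, LinearMap.comp_assoc, hip,
      LinearMap.comp_id]
  · obtain ⟨s, hs⟩ := (hY X').2 (t ∘ₗ postcomp P p)
    refine ⟨s ∘ₗ i, ?_⟩
    change postcomp P s ∘ₗ postcomp P i = t
    rw [show postcomp P s = _ from hs, LinearMap.comp_assoc, ← postcomp_comp, hip]
    rfl

theorem IsRightFull.of_isSummand (hY : IsRightFull (Λ := Λ) P Y) (h : IsSummand (Λ := Λ) X Y) :
    IsRightFull (Λ := Λ) P X := by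
  obtain ⟨i, p, hip⟩ := h
  refine fun X' => ⟨fun f g hfg => ?_, fun t => ?_⟩
  · have : i ∘ₗ f = i ∘ₗ g := (hY X').1 (by
      change postcomp P i ∘ₗ postcomp P f = postcomp P i ∘ₗ postcomp P g
      exact congrArg (postcomp P i ∘ₗ ·) hfg)
    rw [← LinearMap.id_comp f, ← hip, LinearMap.comp_assoc, this, ← LinearMap.comp_assoc, hip,
      LinearMap.id_comp]
  · obtain ⟨s, hs⟩ := (hY X').2 (postcomp P i ∘ₗ t)
    refine ⟨p ∘ₗ s, ?_⟩
    change postcomp P p ∘ₗ postcomp P s = t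
    rw [show postcomp P s = _ from hs, ← LinearMap.comp_assoc, ← postcomp_comp, hip]
    rfl

theorem IsLeftFull.prod (hX : IsLeftFull (Λ := Λ) P X) (hY : IsLeftFull (Λ := Λ) P Y) :
    IsLeftFull (Λ := Λ) P (X × Y) := by
  refine fun X' => ⟨fun f g hfg => ?_, fun t => ?_⟩
  · refine LinearMap.prod_ext ((hX X').1 ?_) ((hY X').1 ?_)
    · exact congrArg (· ∘ₗ postcomp P (LinearMap.inl Λ X Y)) hfg
    · exact congrArg (· ∘ₗ postcomp P (LinearMap.inr Λ X Y)) hfg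
  · obtain ⟨a, ha⟩ := (hX X').2 (t ∘ₗ postcomp P (LinearMap.inl Λ X Y))
    obtain ⟨b, hb⟩ := (hY X').2 (t ∘ₗ postcomp P (LinearMap.inr Λ X Y))
    refine ⟨a.coprod b, LinearMap.ext fun h => ?_⟩
    have e : h = LinearMap.inl Λ X Y ∘ₗ LinearMap.fst Λ X Y ∘ₗ h +
        LinearMap.inr Λ X Y ∘ₗ LinearMap.snd Λ X Y ∘ₗ h := by ext p <;> simp
    have ha' := LinearMap.congr_fun ha (LinearMap.fst Λ X Y ∘ₗ h)
    have hb' := LinearMap.congr_fun hb (LinearMap.snd Λ X Y ∘ₗ h)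
    simp only [LinearMap.comp_apply, postcomp_apply] at ha' hb' ⊢
    conv_rhs => rw [e, map_add, ← ha', ← hb']
    ext p
    simp

theorem IsRightFull.prod (hX : IsRightFull (Λ := Λ) P X) (hY : IsRightFull (Λ := Λ) P Y) :
    IsRightFull (Λ := Λ) P (X × Y) := by
  refine fun X' => ⟨fun f g hfg => ?_, fun t => ?_⟩
  · have h1 : LinearMap.fst Λ X Y ∘ₗ f = LinearMap.fst Λ X Y ∘ₗ g := (hX X').1
      (congrArg (postcomp P (LinearMap.fst Λ X Y) ∘ₗ ·) hfg)
    have h2 : LinearMap.snd Λ X Y ∘ₗ f = LinearMap.snd Λ X Y ∘ₗ g := (hY X').1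
      (congrArg (postcomp P (LinearMap.snd Λ X Y) ∘ₗ ·) hfg)
    exact LinearMap.ext fun x => Prod.ext (LinearMap.congr_fun h1 x) (LinearMap.congr_fun h2 x)
  · obtain ⟨a, ha⟩ := (hX X').2 (postcomp P (LinearMap.fst Λ X Y) ∘ₗ t)
    obtain ⟨b, hb⟩ := (hY X').2 (postcomp P (LinearMap.snd Λ X Y) ∘ₗ t)
    refine ⟨a.prod b, LinearMap.ext fun h => LinearMap.ext fun p => Prod.ext ?_ ?_⟩
    · exact LinearMap.congr_fun (LinearMap.congr_fun ha h) p
    · exact LinearMap.congr_fun (LinearMap.congr_fun hb h) p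

theorem IsLeftFull.pi (hX : IsLeftFull (Λ := Λ) P X) (n : ℕ) :
    IsLeftFull (Λ := Λ) P (Fin n → X) := by
  refine fun X' => ⟨fun f g hfg => LinearMap.pi_ext' fun k => (hX X').1 ?_, fun t => ?_⟩
  · exact congrArg (· ∘ₗ postcomp P (LinearMap.single Λ (fun _ : Fin n => X) k)) hfg
  · choose s hs using fun k =>
      (hX X').2 (t ∘ₗ postcomp P (LinearMap.single Λ (fun _ : Fin n => X) k))
    refine ⟨∑ k, s k ∘ₗ LinearMap.proj k, LinearMap.ext fun h => ?_⟩
    have e : h = ∑ k, LinearMap.single Λ (fun _ : Fin n => X) k ∘ₗ LinearMap.proj k ∘ₗ h := by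
      ext p j
      simp [Finset.sum_apply, Pi.single_apply]
    have hs' := fun k => LinearMap.congr_fun (hs k) (LinearMap.proj k ∘ₗ h)
    simp only [LinearMap.comp_apply, postcomp_apply] at hs' ⊢
    conv_rhs => rw [e, map_sum]
    rw [← Finset.sum_congr rfl fun k _ => hs' k]
    ext p
    simp [LinearMap.sum_apply]

theorem IsRightFull.pi (hX : IsRightFull (Λ := Λ) P X) (n : ℕ) :
    IsRightFull (Λ := Λ) P (Fin n → X) := by
  refine fun X' => ⟨fun f g hfg => ?_, fun t => ?_⟩
  · have h1 : ∀ k, LinearMap.proj k ∘ₗ f = LinearMap.proj k ∘ₗ g := fun k => (hX X').1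
      (congrArg (postcomp P (LinearMap.proj (φ := fun _ : Fin n => X) k) ∘ₗ ·) hfg)
    exact LinearMap.ext fun x => funext fun k => LinearMap.congr_fun (h1 k) x
  · choose s hs using fun k =>
      (hX X').2 (postcomp P (LinearMap.proj (φ := fun _ : Fin n => X) k) ∘ₗ t)
    refine ⟨LinearMap.pi s, LinearMap.ext fun h => LinearMap.ext fun p => funext fun k => ?_⟩
    exact LinearMap.congr_fun (LinearMap.congr_fun (hs k) h) p

theorem IsLeftFull.of_inAdd (hX : IsLeftFull (Λ := Λ) P X) (h : InAdd (Λ := Λ) X Y) :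
    IsLeftFull (Λ := Λ) P Y := by
  obtain ⟨n, hn⟩ := h
  exact (hX.pi n).of_isSummand hn

theorem IsRightFull.of_inAdd (hX : IsRightFull (Λ := Λ) P X) (h : InAdd (Λ := Λ) X Y) :
    IsRightFull (Λ := Λ) P Y := by
  obtain ⟨n, hn⟩ := h
  exact (hX.pi n).of_isSummand hn

/-- Yoneda: every `h : P → P` is the identity acted on by `h`, so a Γ-linear map out of Hom(P, P) is
determined by its value at the identity. -/
theorem isLeftFull_self : IsLeftFull (Λ := Λ) P P := by
  refine fun X' => ⟨fun f g hfg => LinearMap.congr_fun hfg LinearMap.id, fun t => ?_⟩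
  exact ⟨t LinearMap.id, LinearMap.ext fun h => (t.map_smul (MulOpposite.op h) LinearMap.id).symm⟩

/-- Cokernels of maps between modules in `add P` are left full. -/
theorem IsLeftFull.of_exact [Module.Projective Λ P] (hX : IsLeftFull (Λ := Λ) P X)
    (hY : IsLeftFull (Λ := Λ) P Y) {d : X →ₗ[Λ] Y} {ε : Y →ₗ[Λ] W}
    (hε : Function.Surjective ε) (hd : Function.Exact d ε) : IsLeftFull (Λ := Λ) P W := by
  refine fun X' => ⟨fun f g hfg => ?_, fun t => ?_⟩
  · have : f ∘ₗ ε = g ∘ₗ ε := (hY X').1 (congrArg (· ∘ₗ postcomp P ε) hfg)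
    exact LinearMap.ext fun w => by
      obtain ⟨y, rfl⟩ := hε w
      exact LinearMap.congr_fun this y
  -- Pull `t` back along `ε`, realize it by a map `s` on `Y`, and descend `s` to `W`; faithfulness
  -- on `X` gives `s ∘ d = 0`.
  · obtain ⟨s, hs⟩ := (hY X').2 (t ∘ₗ postcomp P ε)
    have hs : postcomp P s = t ∘ₗ postcomp P ε := hs
    have hsd : s ∘ₗ d = 0 := (hX X').1 (by
      change postcomp P s ∘ₗ postcomp P d = postcomp P 0
      rw [hs, LinearMap.comp_assoc, ← postcomp_comp, hd.linearMap_comp_eq_zero, postcomp_zero,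
        postcomp_zero, LinearMap.comp_zero])
    have hker : LinearMap.ker ε ≤ LinearMap.ker s := by
      intro y hy
      obtain ⟨x, rfl⟩ := (hd y).1 hy
      exact LinearMap.congr_fun hsd x
    let s' : W →ₗ[Λ] X' := (LinearMap.ker ε).liftQ s hker ∘ₗ
      ((ε.quotKerEquivOfSurjective hε).symm : W →ₗ[Λ] _)
    have hs' : s' ∘ₗ ε = s := by
      ext y
      have : (ε.quotKerEquivOfSurjective hε).symm (ε y) = (LinearMap.ker ε).mkQ y := by
        rw [LinearEquiv.symm_apply_eq]; rfl
      change (LinearMap.ker ε).liftQ s hker ((ε.quotKerEquivOfSurjective hε).symm (ε y)) = s y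
      rw [this]
      rfl
    refine ⟨s', LinearMap.ext fun h => ?_⟩
    obtain ⟨k, rfl⟩ := postcomp_surjective (P := P) hε h
    rw [← LinearMap.comp_apply, ← LinearMap.comp_apply, ← hs, ← hs']
    rfl

/-- Kernels of maps between right full modules are right full. -/
theorem IsRightFull.of_exact (hX : IsRightFull (Λ := Λ) P X)
    (hY : IsRightFull (Λ := Λ) P Y) {η : W →ₗ[Λ] X} {d : X →ₗ[Λ] Y}
    (hη : Function.Injective η) (hd : Function.Exact η d) : IsRightFull (Λ := Λ) P W := by
  refine fun X' => ⟨fun f g hfg => ?_, fun t => ?_⟩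
  · have : η ∘ₗ f = η ∘ₗ g := (hX X').1 (congrArg (postcomp P η ∘ₗ ·) hfg)
    exact LinearMap.ext fun w => hη (LinearMap.congr_fun this w)
  · obtain ⟨s, hs⟩ := (hX X').2 (postcomp P η ∘ₗ t)
    have hs : postcomp P s = postcomp P η ∘ₗ t := hs
    have hds : d ∘ₗ s = 0 := (hY X').1 (by
      change postcomp P d ∘ₗ postcomp P s = postcomp P 0
      rw [hs, ← LinearMap.comp_assoc, ← postcomp_comp, hd.linearMap_comp_eq_zero, postcomp_zero,
        postcomp_zero, LinearMap.zero_comp])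
    choose s' hs' using fun x => (hd (s x)).1 (LinearMap.congr_fun hds x)
    let σ : X' →ₗ[Λ] W :=
      { toFun := s'
        map_add' := fun x y => hη (by simp [hs'])
        map_smul' := fun r x => hη (by simp [hs']) }
    refine ⟨σ, LinearMap.ext fun h => postcomp_injective hη ?_⟩
    rw [← LinearMap.comp_apply, ← LinearMap.comp_apply, ← hs, ← postcomp_comp]
    congr 2
    exact LinearMap.ext hs'

/-- Every finitely generated `End(P)ᵒᵖ`-module is a quotient of some `Hom(P, Pⁿ)`. -/
theorem exists_surjective_hom (M : Type u) [AddCommGroup M] [Module (Module.End Λ P)ᵐᵒᵖ M]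
    [Module.Finite (Module.End Λ P)ᵐᵒᵖ M] :
    ∃ (n : ℕ) (τ : (P →ₗ[Λ] (Fin n → P)) →ₗ[(Module.End Λ P)ᵐᵒᵖ] M), Function.Surjective τ := by
  obtain ⟨n, w, hw⟩ := Module.Finite.exists_fin (R := (Module.End Λ P)ᵐᵒᵖ) (M := M)
  -- Hom(P, Pⁿ) is free of rank n over Γ; `τ` sends its basis to the generators `w`.
  let τ : (P →ₗ[Λ] (Fin n → P)) →ₗ[(Module.End Λ P)ᵐᵒᵖ] M :=
    { toFun := fun h => ∑ k, (MulOpposite.op (LinearMap.proj k ∘ₗ h) : (Module.End Λ P)ᵐᵒᵖ) • w k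
      map_add' := fun h h' => by
        rw [← Finset.sum_add_distrib]
        refine Finset.sum_congr rfl fun k _ => ?_
        rw [← add_smul, ← MulOpposite.op_add, LinearMap.comp_add]
      map_smul' := fun γ h => by
        rw [RingHom.id_apply, Finset.smul_sum]
        exact Finset.sum_congr rfl fun k _ => mul_smul γ
          (MulOpposite.op (LinearMap.proj (φ := fun _ : Fin n => P) k ∘ₗ h)) (w k) }
  refine ⟨n, τ, fun y => ?_⟩
  have hy : y ∈ Submodule.span (Module.End Λ P)ᵐᵒᵖ (Set.range w) := hw ▸ Submodule.mem_top
  obtain ⟨c, rfl⟩ := (Submodule.mem_span_range_iff_exists_fun _).1 hy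
  exact ⟨LinearMap.pi fun k => (c k).unop, rfl⟩

theorem projective_hom_of_inAdd (h : InAdd (Λ := Λ) P X) :
    Module.Projective (Module.End Λ P)ᵐᵒᵖ (P →ₗ[Λ] X) := by
  obtain ⟨n, i, p, hip⟩ := h
  let e : (P →ₗ[Λ] (Fin n → P)) ≃ₗ[(Module.End Λ P)ᵐᵒᵖ] (Fin n → (Module.End Λ P)ᵐᵒᵖ) :=
    { toFun := fun h k => MulOpposite.op (LinearMap.proj k ∘ₗ h)
      map_add' := fun _ _ => rfl
      map_smul' := fun _ _ => rfl
      invFun := fun c => LinearMap.pi fun k => (c k).unop }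
  have := Module.Projective.of_equiv e.symm
  exact Module.Projective.of_split (postcomp P i) (postcomp P p)
    (by rw [← postcomp_comp, hip]; rfl)

theorem InAdd.projective [Module.Projective Λ P] (h : InAdd (Λ := Λ) P X) :
    Module.Projective Λ X := by
  obtain ⟨n, hn⟩ := h
  have := Module.Projective.of_equiv
    (DFinsupp.linearEquivFunOnFintype (R := Λ) (M := fun _ : Fin n => P))
  exact hn.projective

end FullyFaithful

/-! ### The equivalence between ℙ₁ and mod End(P)ᵒᵖ -/

section LeftPart

variable {Λ : Type u} [Ring Λ] {P : Type u} [AddCommGroup P] [Module Λ P]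

theorem AddFunctor.map_bijective {Γ : Type u} [Ring Γ] (F : AddFunctor Λ Γ)
    {X Y : FGModuleCat.{u} Λ} {f : X →ₗ[Λ] Y} (hf : Function.Bijective f) :
    Function.Bijective (F.map f) :=
  (F.mapEquiv (LinearEquiv.ofBijective f hf)).bijective

/-- Only the terms of index 0 and 1 are constrained, so an add P presentation may be continued by
any projective resolution. -/
theorem mem_PPres_one_of_exact [IsArtinianRing Λ] [Module.Projective Λ P]
    {Q₁ Q₀ X : FGModuleCat.{u} Λ} (h₁ : InAdd (Λ := Λ) P Q₁) (h₀ : InAdd (Λ := Λ) P Q₀)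
    {d : Q₁ →ₗ[Λ] Q₀} {ε : Q₀ →ₗ[Λ] X} (hε : Function.Surjective ε) (hd : Function.Exact d ε) :
    X ∈ PPres (Λ := Λ) P 1 := by
  refine mem_PPres_iff.2 (hasProjRes_of_ker h₀.projective (fun _ => h₀) hε ?_)
  refine hasProjRes_of_ker (Q := Q₁) (ε := d.codRestrict (LinearMap.ker ε)
    fun x => (hd _).2 ⟨x, rfl⟩) h₁.projective (fun _ => h₁) (fun x => ?_)
    (hasProjRes_of_forall (fun i Q hi => ?_) _)
  · obtain ⟨y, hy⟩ := (hd x).1 x.2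
    exact ⟨y, Subtype.ext hy⟩
  · have : i + 1 + 1 ≤ 1 := by exact_mod_cast hi
    omega

theorem IsLeftFull.of_mem_PPres [IsArtinianRing Λ] [Module.Projective Λ P]
    {X : FGModuleCat.{u} Λ} (hX : X ∈ PPres (Λ := Λ) P 1) : IsLeftFull (Λ := Λ) P X := by
  obtain ⟨Q, ε, d, -, hε, hd, -, hc⟩ := hX
  exact (isLeftFull_self.of_inAdd (hc 1 le_rfl)).of_exact
    (isLeftFull_self.of_inAdd (hc 0 zero_le_one)) hε hd

/-- A presentation of `Y` by modules Hom(P, Pᵐ) → Hom(P, Pⁿ) is induced by some `d : Pᵐ → Pⁿ`. As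
Hom(P, -) preserves cokernels, the cokernel of `d` is the required module. -/
theorem exists_mem_PPres_one [IsArtinianRing Λ] [Module.Finite Λ P] [Module.Projective Λ P]
    [IsArtinianRing (Module.End Λ P)ᵐᵒᵖ] (Y : FGModuleCat.{u} (Module.End Λ P)ᵐᵒᵖ) :
    ∃ X ∈ PPres (Λ := Λ) P 1, Nonempty ((P →ₗ[Λ] X) ≃ₗ[(Module.End Λ P)ᵐᵒᵖ] Y) := by
  obtain ⟨n, τ, hτ⟩ := exists_surjective_hom (Λ := Λ) (P := P) Y
  have : Module.Finite (Module.End Λ P)ᵐᵒᵖ (P →ₗ[Λ] (Fin n → P)) := by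
    let e : (P →ₗ[Λ] (Fin n → P)) ≃ₗ[(Module.End Λ P)ᵐᵒᵖ] (Fin n → (Module.End Λ P)ᵐᵒᵖ) :=
      { toFun := fun h k => MulOpposite.op (LinearMap.proj k ∘ₗ h)
        map_add' := fun _ _ => rfl
        map_smul' := fun _ _ => rfl
        invFun := fun c => LinearMap.pi fun k => (c k).unop }
    exact Module.Finite.equiv e.symm
  obtain ⟨m, σ, hσ⟩ := exists_surjective_hom (Λ := Λ) (P := P) (LinearMap.ker τ)
  obtain ⟨d, hd⟩ := (isLeftFull_self (Λ := Λ) (P := P)).pi m (FGModuleCat.of Λ (Fin n → P)) |>.2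
    ((LinearMap.ker τ).subtype ∘ₗ σ)
  have hd : postcomp P d = (LinearMap.ker τ).subtype ∘ₗ σ := hd
  have hrange : LinearMap.range (postcomp P d) = LinearMap.ker τ := by
    rw [hd, LinearMap.range_comp_of_range_eq_top _ (LinearMap.range_eq_top.2 hσ),
      Submodule.range_subtype]
  have hex : Function.Exact d (LinearMap.range d).mkQ := LinearMap.exact_map_mkQ_range d
  refine ⟨FGModuleCat.of Λ ((Fin n → P) ⧸ LinearMap.range d),
    mem_PPres_one_of_exact (Q₁ := FGModuleCat.of Λ (Fin m → P))
      (Q₀ := FGModuleCat.of Λ (Fin n → P)) (inAdd_pi m) (inAdd_pi n)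
      (Submodule.mkQ_surjective _) hex, ?_⟩
  obtain ⟨e⟩ := nonempty_homCokerEquiv (P := P) (Submodule.mkQ_surjective (LinearMap.range d)) hex
  exact ⟨e.symm.trans ((Submodule.quotEquivOfEq _ _ hrange).trans
    (τ.quotKerEquivOfSurjective hτ))⟩

variable (hP : ∀ X : FGModuleCat.{u} Λ, Module.Finite (Module.End Λ P)ᵐᵒᵖ (P →ₗ[Λ] X))

theorem isEquivOn_isLeftFull [IsArtinianRing Λ] [Module.Finite Λ P] [Module.Projective Λ P]
    [IsArtinianRing (Module.End Λ P)ᵐᵒᵖ] :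
    IsEquivOn (homFunctor P hP) {X | IsLeftFull (Λ := Λ) P X} where
  mem_of_summand h hY := IsLeftFull.of_isSummand hY h
  mem_prod hA hB := IsLeftFull.prod hA hB
  full hX _ := hX _
  dense Y := by
    obtain ⟨X, hX, e⟩ := exists_mem_PPres_one Y
    exact ⟨X, .of_mem_PPres hX, e⟩

-- For the converse, Hom(P, X) is also realized by an object of ℙ₁. Both objects are left full, and
-- Hom(P, -) reflects isomorphisms between such objects. Working with left full modules makes
-- closure under sums and summands immediate.
include hP in
theorem mem_PPres_one_iff [IsArtinianRing Λ] [Module.Finite Λ P] [Module.Projective Λ P]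
    [IsArtinianRing (Module.End Λ P)ᵐᵒᵖ] {X : FGModuleCat.{u} Λ} :
    X ∈ PPres (Λ := Λ) P 1 ↔ IsLeftFull (Λ := Λ) P X := by
  refine ⟨.of_mem_PPres, fun hX => ?_⟩
  obtain ⟨X', hX', ⟨e⟩⟩ := exists_mem_PPres_one ((homFunctor P hP).obj X)
  obtain ⟨e'⟩ := (isEquivOn_isLeftFull hP).nonempty_equiv (IsLeftFull.of_mem_PPres hX') hX e
  exact mem_PPres_iff.2 ((mem_PPres_iff.1 hX').of_equiv e')

/-- If `ℙ₁ = ℙ_∞`, then `Hom(P, -)` restricts to an equivalence `ℙ₁ ≃ mod End(P)ᵒᵖ` that is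
compatible with syzygies. -/
theorem isShiftEquivOn_isLeftFull (R : Type v) [CommRing R] [IsArtinianRing R] [Algebra R Λ]
    [Module.Finite R Λ] [Module.Finite Λ P] [Module.Projective Λ P]
    [IsArtinianRing (Module.End Λ P)ᵐᵒᵖ] (h : PPres (Λ := Λ) P 1 = PPres (Λ := Λ) P ⊤) :
    IsShiftEquivOn (homFunctor P hP) {X | IsLeftFull (Λ := Λ) P X}
      (fun Q : FGModuleCat.{u} Λ => Module.Projective Λ Q) IsSyzygy
      (fun Q => Module.Projective (Module.End Λ P)ᵐᵒᵖ Q) IsSyzygy := by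
  have hart : IsArtinianRing Λ := isArtinianRing_of_artinAlgebra R
  have hmem : ∀ X : FGModuleCat.{u} Λ, IsLeftFull (Λ := Λ) P X ↔ X ∈ PPres (Λ := Λ) P ⊤ :=
    fun X => by rw [← h, mem_PPres_one_iff hP]
  have hres : ∀ X : FGModuleCat.{u} Λ, IsLeftFull (Λ := Λ) P X →
      ∃ (Q : FGModuleCat.{u} Λ) (ε : Q →ₗ[Λ] X), InAdd (Λ := Λ) P Q ∧ Function.Surjective ε ∧
        IsLeftFull (Λ := Λ) P (LinearMap.ker ε) := fun X hX => by
    obtain ⟨Q, ε, -, hQ, hε, hK⟩ := (mem_PPres_iff.1 ((hmem X).1 hX)).exists_ker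
    exact ⟨Q, ε, hQ le_top, hε, (hmem (FGModuleCat.of Λ (LinearMap.ker ε))).2
      (mem_PPres_iff.2 (hK.mono fun i Q hQ _ => hQ le_top))⟩
  -- The projective cover is a retract over `X` of the add P term in `hres`, and the retraction
  -- restricts to kernels.
  have hcover : ∀ {X Q : FGModuleCat.{u} Λ} {f : Q →ₗ[Λ] X}, IsLeftFull (Λ := Λ) P X →
      IsProjectiveCover f → InAdd (Λ := Λ) P Q ∧ IsLeftFull (Λ := Λ) P (LinearMap.ker f) := by
    intro X Q f hX hf
    obtain ⟨Q₀, ε, hQ₀, hε, hK⟩ := hres X hX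
    have := hQ₀.projective
    obtain ⟨a, b, hba, ha, hb⟩ := hf.exists_retract hε
    refine ⟨hQ₀.of_isSummand ⟨a, b, hba⟩, hK.of_isSummand
      ⟨a.restrict (p := LinearMap.ker f) (q := LinearMap.ker ε) fun x hx => ?_,
        b.restrict (p := LinearMap.ker ε) (q := LinearMap.ker f) fun x hx => ?_, ?_⟩⟩
    · exact (LinearMap.congr_fun ha x).trans hx
    · exact (LinearMap.congr_fun hb x).trans hx
    · exact LinearMap.ext fun x => Subtype.ext (LinearMap.congr_fun hba x)
  exact
    { toIsEquivOn := isEquivOn_isLeftFull hP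
      isShift := isShift_projective
      isShift' := isShift_projective
      shift_mem := by
        rintro X K hX ⟨Q, f, hf, ⟨e⟩⟩
        exact (hcover hX hf).2.of_isSummand (.of_equiv e)
      map_shift := by
        rintro X K hX ⟨Q, f, hf, ⟨e⟩⟩
        obtain ⟨hQ, -⟩ := hcover hX hf
        have hQ' := isLeftFull_self.of_inAdd hQ
        refine ⟨(homFunctor P hP).obj Q, (homFunctor P hP).map f, ?_,
          ⟨((homFunctor P hP).mapEquiv (Y := FGModuleCat.of Λ (LinearMap.ker f)) e).trans
            (homKerEquiv P f)⟩⟩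
        have := hf.1
        -- Minimality involves only endomorphisms of the source over the target, and these
        -- correspond under the fully faithful functor.
        refine (isProjectiveCover_iff_minimal (Q := (homFunctor P hP).obj Q)
          (M := (homFunctor P hP).obj X) (projective_hom_of_inAdd hQ)
          (postcomp_surjective hf.2.1)).2 fun u hu => ?_
        obtain ⟨u, rfl⟩ := (hQ' Q).2 u
        exact (homFunctor P hP).map_bijective
          ((isProjectiveCover_iff_minimal hf.1 hf.2.1).1 hf u ((hQ' X).1 hu))
      map_mem := by
        intro X hX
        obtain ⟨Q, ε, hQ, hε, -⟩ := hres X hX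
        have := hQ.projective
        constructor
        -- If Hom(P, X) is projective, the image of `ε` splits; full faithfulness lifts the
        -- splitting, so `X` is a summand of `Q`.
        · intro hp
          have hp : Module.Projective (Module.End Λ P)ᵐᵒᵖ (P →ₗ[Λ] X) := hp
          obtain ⟨t, ht⟩ := Module.projective_lifting_property (postcomp P ε) LinearMap.id
            (postcomp_surjective hε)
          obtain ⟨s, rfl⟩ := (hX Q).2 t
          exact Module.Projective.of_split s ε ((hX X).1 ht)
        · intro hp
          have hp : Module.Projective Λ X := hp
          obtain ⟨s, hs⟩ := Module.projective_lifting_property ε LinearMap.id hε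
          exact projective_hom_of_inAdd (hQ.of_isSummand ⟨s, ε, hs⟩)
      common_summand := isShift_projective.common_summand R }

end LeftPart

/-! ### The envelope of the top of P and the equivalence between 𝕀₁ and mod End(P)ᵒᵖ -/

section Envelope

variable {Λ : Type u} [Ring Λ] {P I : Type u} [AddCommGroup P] [Module Λ P] [AddCommGroup I]
  [Module Λ I] {ι : (P ⧸ (Ring.jacobson Λ • (⊤ : Submodule Λ P))) →ₗ[Λ] I}

theorem isSemisimpleModule_top [IsArtinianRing Λ] :
    IsSemisimpleModule Λ (P ⧸ (Ring.jacobson Λ • (⊤ : Submodule Λ P))) :=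
  isSemisimpleModule_of_jacobson fun a ha x => by
    obtain ⟨x, rfl⟩ := Submodule.mkQ_surjective _ x
    rw [← map_smul]
    exact (Submodule.Quotient.mk_eq_zero _).2 (Submodule.smul_mem_smul ha Submodule.mem_top)

/-- Nonzero submodules of the injective envelope of the top of `P` receive nonzero maps
from `P`. -/
theorem IsInjectiveEnvelope.exists_hom_ne_zero [IsArtinianRing Λ] (hι : IsInjectiveEnvelope ι)
    {N : Submodule Λ I} (hN : N ≠ ⊥) : ∃ h : P →ₗ[Λ] I, h ≠ 0 ∧ ∀ p, h p ∈ N := by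
  have := isSemisimpleModule_top (Λ := Λ) (P := P)
  -- By essentiality `N` meets the top of `P`, which is semisimple and hence projects onto the
  -- intersection; composing with P → P/rP gives the map.
  obtain ⟨_, ⟨hx, l, rfl⟩, hl⟩ :=
    Submodule.exists_mem_ne_zero_of_ne_bot fun h => hN (hι.2.2 N h)
  obtain ⟨L', hL⟩ := exists_isCompl (N.comap ι)
  obtain ⟨p, rfl⟩ := Submodule.mkQ_surjective _ l
  refine ⟨ι ∘ₗ (N.comap ι).projection L' hL ∘ₗ Submodule.mkQ _, fun h0 => hl ?_,
    fun p => Submodule.projection_apply_mem hL _⟩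
  have := LinearMap.congr_fun h0 p
  rw [LinearMap.comp_apply, LinearMap.comp_apply,
    Submodule.projection_apply_of_mem_left hL hx] at this
  exact this

/-- Nonzero maps from `P` are detected by maps to the injective envelope of the top of `P`. -/
theorem IsInjectiveEnvelope.exists_comp_ne_zero [IsArtinianRing Λ] [Module.Finite Λ P]
    (hι : IsInjectiveEnvelope ι) {X : Type u} [AddCommGroup X] [Module Λ X] {h : P →ₗ[Λ] X}
    (hh : h ≠ 0) : ∃ s : X →ₗ[Λ] I, s ∘ₗ h ≠ 0 := by
  have := isSemisimpleModule_top (Λ := Λ) (P := P)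
  have : Nontrivial (LinearMap.range h) :=
    Submodule.nontrivial_iff_ne_bot.2 fun h0 => hh (LinearMap.range_eq_bot.1 h0)
  -- By Nakayama the image of `h` has a nonzero top. That top is a quotient of the semisimple P/rP,
  -- so it embeds there and then in `I`; the resulting map on the image extends to `X` by
  -- injectivity.
  have hlt := Submodule.jacobson_smul_lt_top (R := Λ) (⊤ : Submodule Λ (LinearMap.range h))
  let π := Submodule.mapQ (Ring.jacobson Λ • (⊤ : Submodule Λ P))
    (Ring.jacobson Λ • (⊤ : Submodule Λ (LinearMap.range h))) h.rangeRestrict (by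
      rw [← Submodule.map_le_iff_le_comap, Submodule.map_smul'']
      exact smul_mono_right _ le_top)
  have hπ : Function.Surjective π := fun y => by
    obtain ⟨⟨_, p, rfl⟩, rfl⟩ := Submodule.mkQ_surjective _ y
    exact ⟨Submodule.mkQ _ p, rfl⟩
  obtain ⟨σ, hσ⟩ := IsSemisimpleModule.lifting_property π hπ LinearMap.id
  obtain ⟨s, hs⟩ := hι.1.out (LinearMap.range h).subtype (Submodule.subtype_injective _)
    (ι ∘ₗ σ ∘ₗ Submodule.mkQ _)
  refine ⟨s, fun h0 => hlt.ne (eq_top_iff.2 ?_)⟩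
  rintro ⟨_, p, rfl⟩ -
  have h1 : ι (σ (Submodule.mkQ _ ⟨h p, p, rfl⟩)) = 0 :=
    (hs ⟨h p, p, rfl⟩).symm.trans (LinearMap.congr_fun h0 p)
  have h2 : σ (Submodule.mkQ _ ⟨h p, p, rfl⟩) = 0 := hι.2.1 (h1.trans (map_zero ι).symm)
  have h3 := LinearMap.congr_fun hσ (Submodule.mkQ _ ⟨h p, p, rfl⟩)
  rw [LinearMap.comp_apply, h2, map_zero] at h3
  exact (Submodule.Quotient.mk_eq_zero _).1 h3.symm

/-- Partially defined maps `Hom(P, X) → Hom(P, I)` are induced by maps `X → I`. -/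
theorem IsInjectiveEnvelope.exists_comp_eq [IsArtinianRing Λ] [Module.Projective Λ P]
    (hι : IsInjectiveEnvelope ι) {X : Type u} [AddCommGroup X] [Module Λ X]
    (L : Submodule (Module.End Λ P)ᵐᵒᵖ (P →ₗ[Λ] X)) [Module.Finite (Module.End Λ P)ᵐᵒᵖ L]
    (t : L →ₗ[(Module.End Λ P)ᵐᵒᵖ] (P →ₗ[Λ] I)) :
    ∃ s : X →ₗ[Λ] I, ∀ h : L, s ∘ₗ h.1 = t h := by
  obtain ⟨n, g, hg⟩ := Module.Finite.exists_fin (R := (Module.End Λ P)ᵐᵒᵖ) (M := L)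
  -- `α` collects generators of `L` and `β` their images under `t`. If `β` did not vanish on ker α,
  -- a nonzero map from `P` into β(ker α) would lift to ker α and give a relation among the
  -- generators that `t` violates. So `β` factors through the image of `α`, and injectivity of `I`
  -- extends it to `X`.
  let α : (Fin n → P) →ₗ[Λ] X := ∑ k, (g k).1 ∘ₗ LinearMap.proj k
  let β : (Fin n → P) →ₗ[Λ] I := ∑ k, t (g k) ∘ₗ LinearMap.proj k
  have hαβ : LinearMap.ker α ≤ LinearMap.ker β := by
    by_contra hne
    have hN : (LinearMap.ker α).map β ≠ ⊥ := fun h0 => hne fun a ha => by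
      have : β a ∈ (⊥ : Submodule Λ I) := h0 ▸ ⟨a, ha, rfl⟩
      exact this
    obtain ⟨w, hw0, hw⟩ := hι.exists_hom_ne_zero hN
    obtain ⟨v, hv⟩ := IgusaTodorov.exists_comp_eq (f := β ∘ₗ (LinearMap.ker α).subtype) (h := w)
      (fun p => by
        obtain ⟨a, ha, hap⟩ := hw p
        exact ⟨⟨a, ha⟩, hap⟩)
    let e : Fin n → (Module.End Λ P)ᵐᵒᵖ := fun k =>
      MulOpposite.op (LinearMap.proj k ∘ₗ (LinearMap.ker α).subtype ∘ₗ v)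
    have h1 : ∑ k, e k • g k = 0 := by
      refine Subtype.ext (LinearMap.ext fun p => ?_)
      have : α (v p) = 0 := (v p).2
      rw [LinearMap.sum_apply] at this
      rw [AddSubmonoidClass.coe_finsetSum, LinearMap.sum_apply]
      exact this
    apply hw0
    have h2 : ∑ k, e k • t (g k) = 0 := by
      rw [← map_zero t, ← h1, map_sum]
      exact Finset.sum_congr rfl fun k _ => (map_smul t _ _).symm
    rw [← hv, ← h2]
    refine LinearMap.ext fun p => ?_
    rw [LinearMap.sum_apply]
    exact LinearMap.sum_apply _ _ _
  obtain ⟨s, hs⟩ := hι.1.out ((LinearMap.ker α).liftQ α le_rfl)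
    (LinearMap.ker_eq_bot.1 (Submodule.ker_liftQ_eq_bot _ _ _ le_rfl))
    ((LinearMap.ker α).liftQ β hαβ)
  have hsα : ∀ a, s (α a) = β a := fun a => hs (Submodule.Quotient.mk a)
  have key : postcomp P s ∘ₗ L.subtype = t := by
    refine LinearMap.ext_on_range hg fun k => LinearMap.ext fun p => ?_
    have h1 := hsα (Pi.single k p)
    have h2 : α (Pi.single k p) = (g k).1 p := by
      simp only [α, LinearMap.sum_apply, LinearMap.comp_apply, LinearMap.proj_apply]
      rw [Finset.sum_eq_single k (fun j _ hj => by rw [Pi.single_eq_of_ne hj, map_zero])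
        (by simp), Pi.single_eq_same]
    have h3 : β (Pi.single k p) = t (g k) p := by
      simp only [β, LinearMap.sum_apply, LinearMap.comp_apply, LinearMap.proj_apply]
      rw [Finset.sum_eq_single k (fun j _ hj => by rw [Pi.single_eq_of_ne hj, map_zero])
        (by simp), Pi.single_eq_same]
    rw [h2, h3] at h1
    exact h1
  exact ⟨s, fun h => LinearMap.congr_fun key h⟩

variable (hP : ∀ X : FGModuleCat.{u} Λ, Module.Finite (Module.End Λ P)ᵐᵒᵖ (P →ₗ[Λ] X))

include hP in
theorem IsInjectiveEnvelope.isRightFull [IsArtinianRing Λ] [Module.Projective Λ P]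
    [IsArtinianRing (Module.End Λ P)ᵐᵒᵖ] (hι : IsInjectiveEnvelope ι) :
    IsRightFull (Λ := Λ) P I := by
  refine fun X => ⟨fun f g hfg => ?_, fun t => ?_⟩
  · by_contra hne
    have hN : LinearMap.range (f - g) ≠ ⊥ := fun h0 =>
      hne (sub_eq_zero.1 (LinearMap.range_eq_bot.1 h0))
    obtain ⟨w, hw0, hw⟩ := hι.exists_hom_ne_zero hN
    obtain ⟨k, rfl⟩ := IgusaTodorov.exists_comp_eq hw
    apply hw0
    rw [LinearMap.sub_comp, sub_eq_zero]
    exact LinearMap.congr_fun hfg k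
  · have := hP X
    obtain ⟨s, hs⟩ := hι.exists_comp_eq (⊤ : Submodule (Module.End Λ P)ᵐᵒᵖ (P →ₗ[Λ] X))
      (t ∘ₗ Submodule.subtype _)
    exact ⟨s, LinearMap.ext fun h => hs ⟨h, Submodule.mem_top⟩⟩

/-- Baer's criterion: a left ideal of Γ is a finitely generated submodule of Hom(P, P), and a map
from it to Hom(P, I) is induced by some `s : P → I`, which extends it to all of Γ. -/
theorem IsInjectiveEnvelope.injective_hom [IsArtinianRing Λ] [Module.Projective Λ P]
    [IsArtinianRing (Module.End Λ P)ᵐᵒᵖ] (hι : IsInjectiveEnvelope ι) :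
    Module.Injective (Module.End Λ P)ᵐᵒᵖ (P →ₗ[Λ] I) := by
  refine Module.Baer.injective fun L t => ?_
  let e : (Module.End Λ P)ᵐᵒᵖ ≃ₗ[(Module.End Λ P)ᵐᵒᵖ] (P →ₗ[Λ] P) :=
    { toFun := fun γ => γ.unop
      map_add' := fun _ _ => rfl
      map_smul' := fun _ _ => rfl
      invFun := fun h => MulOpposite.op h }
  have : Module.Finite (Module.End Λ P)ᵐᵒᵖ (P →ₗ[Λ] P) := Module.Finite.equiv e
  let L' : Submodule (Module.End Λ P)ᵐᵒᵖ (P →ₗ[Λ] P) :=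
    Submodule.comap (e.symm : (P →ₗ[Λ] P) →ₗ[(Module.End Λ P)ᵐᵒᵖ] (Module.End Λ P)ᵐᵒᵖ) L
  let r : L' →ₗ[(Module.End Λ P)ᵐᵒᵖ] L :=
    ((e.symm : (P →ₗ[Λ] P) →ₗ[(Module.End Λ P)ᵐᵒᵖ] (Module.End Λ P)ᵐᵒᵖ) ∘ₗ
      L'.subtype).codRestrict L fun x => x.2
  obtain ⟨s, hs⟩ := hι.exists_comp_eq L' (t ∘ₗ r)
  exact ⟨postcomp P s ∘ₗ (e : _ →ₗ[_] _), fun x hx => hs ⟨e x, hx⟩⟩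

theorem InAdd.injective {M X : Type u} [AddCommGroup M] [Module Λ M] [AddCommGroup X]
    [Module Λ X] [Module.Injective Λ M] (h : InAdd (Λ := Λ) M X) : Module.Injective Λ X := by
  obtain ⟨n, hn⟩ := h
  exact hn.injective

theorem IsInjectiveEnvelope.injective_hom_of_inAdd [IsArtinianRing Λ] [Module.Projective Λ P]
    [IsArtinianRing (Module.End Λ P)ᵐᵒᵖ] (hι : IsInjectiveEnvelope ι) {J : Type u}
    [AddCommGroup J] [Module Λ J] (hJ : InAdd (Λ := Λ) I J) :
    Module.Injective (Module.End Λ P)ᵐᵒᵖ (P →ₗ[Λ] J) := by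
  obtain ⟨n, i, p, hip⟩ := hJ
  have := hι.injective_hom
  let e : (P →ₗ[Λ] (Fin n → I)) ≃ₗ[(Module.End Λ P)ᵐᵒᵖ] (Fin n → (P →ₗ[Λ] I)) :=
    { toFun := fun h k => LinearMap.proj k ∘ₗ h
      map_add' := fun _ _ => rfl
      map_smul' := fun _ _ => rfl
      invFun := fun c => LinearMap.pi c }
  exact ((show IsSummand (Λ := (Module.End Λ P)ᵐᵒᵖ) (P →ₗ[Λ] J) (P →ₗ[Λ] (Fin n → I)) from
    ⟨postcomp P i, postcomp P p, by rw [← postcomp_comp, hip]; rfl⟩).trans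
      (.of_equiv e)).injective

include hP in
/-- Every finitely generated `End(P)ᵒᵖ`-module embeds in some `Hom(P, Iⁿ)`. -/
theorem IsInjectiveEnvelope.exists_injective_hom [IsArtinianRing Λ] [Module.Finite Λ P]
    [Module.Projective Λ P] [IsArtinianRing (Module.End Λ P)ᵐᵒᵖ] (hι : IsInjectiveEnvelope ι)
    (M : FGModuleCat.{u} (Module.End Λ P)ᵐᵒᵖ) :
    ∃ (n : ℕ) (τ : M →ₗ[(Module.End Λ P)ᵐᵒᵖ] (P →ₗ[Λ] (Fin n → I))), Function.Injective τ := by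
  obtain ⟨X, -, ⟨e⟩⟩ := exists_mem_PPres_one M
  have := hP X
  suffices H : ∃ (n : ℕ) (s : X →ₗ[Λ] (Fin n → I)), LinearMap.ker (postcomp P s) = ⊥ by
    obtain ⟨n, s, hs⟩ := H
    exact ⟨n, postcomp P s ∘ₗ (e.symm : M →ₗ[_] _),
      (LinearMap.ker_eq_bot.1 hs).comp e.symm.injective⟩
  -- Choose `s` with minimal kernel on Hom(P, X). A nonzero element of the kernel would be detected
  -- by a further map X → I, and adding that coordinate would shrink the kernel.
  obtain ⟨_, ⟨n, s, rfl⟩, hmin⟩ := WellFounded.has_min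
    (wellFounded_lt (α := Submodule (Module.End Λ P)ᵐᵒᵖ (P →ₗ[Λ] X)))
    {K | ∃ (n : ℕ) (s : X →ₗ[Λ] (Fin n → I)), LinearMap.ker (postcomp P s) = K} ⟨_, 0, 0, rfl⟩
  refine ⟨n, s, ?_⟩
  by_contra hne
  obtain ⟨h, hh, hh0⟩ := Submodule.exists_mem_ne_zero_of_ne_bot hne
  obtain ⟨s', hs'⟩ := hι.exists_comp_ne_zero hh0
  let s'' : X →ₗ[Λ] (Fin (n + 1) → I) :=
    LinearMap.pi (Fin.cons s' fun k => LinearMap.proj k ∘ₗ s)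
  refine hmin _ ⟨n + 1, s'', rfl⟩ (lt_of_le_of_ne (fun k hk => ?_) fun heq => hs' ?_)
  · refine LinearMap.ext fun p => funext fun j => ?_
    exact congrFun (LinearMap.congr_fun hk p) j.succ
  · rw [← heq] at hh
    exact LinearMap.ext fun p => congrFun (LinearMap.congr_fun hh p) 0

variable (R : Type v) [CommRing R] [IsArtinianRing R] [Algebra R Λ] [Module.Finite R Λ]

include R in
theorem mem_IIres_one_of_exact [Module.Injective Λ I]
    {J₁ J₀ X : FGModuleCat.{u} Λ} (h₁ : InAdd (Λ := Λ) I J₁) (h₀ : InAdd (Λ := Λ) I J₀)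
    {η : X →ₗ[Λ] J₀} {d : J₀ →ₗ[Λ] J₁} (hη : Function.Injective η) (hd : Function.Exact η d) :
    X ∈ IIres (Λ := Λ) I 1 := by
  refine mem_IIres_iff.2 (hasInjRes_of_coker h₀.injective (fun _ => h₀) hη ?_)
  refine hasInjRes_of_coker (J := J₁) (η := (LinearMap.range η).liftQ d ?_) h₁.injective
    (fun _ => h₁) ?_ (hasInjRes_of_forall R (fun i Q hi => ?_) _)
  · rintro _ ⟨x, rfl⟩
    exact (hd _).2 ⟨x, rfl⟩
  · exact LinearMap.ker_eq_bot.1 (Submodule.ker_liftQ_eq_bot _ _ _ fun x hx => (hd x).1 hx)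
  · have : i + 1 + 1 ≤ 1 := by exact_mod_cast hi
    omega

theorem IsRightFull.of_mem_IIres (hI : IsRightFull (Λ := Λ) P I) {X : FGModuleCat.{u} Λ}
    (hX : X ∈ IIres (Λ := Λ) I 1) : IsRightFull (Λ := Λ) P X := by
  obtain ⟨J, η, d, -, hη, hd, -, hc⟩ := hX
  exact (hI.of_inAdd (hc 0 zero_le_one)).of_exact (hI.of_inAdd (hc 1 le_rfl)) hη hd

-- A copresentation of `Y` by modules Hom(P, Iⁿ) → Hom(P, Iᵐ) is induced by a map `d`, and Hom(P, -)
-- preserves its kernel.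
include hP R in
theorem IsInjectiveEnvelope.exists_mem_IIres_one [Module.Finite Λ P] [Module.Projective Λ P]
    [IsArtinianRing (Module.End Λ P)ᵐᵒᵖ] (hι : IsInjectiveEnvelope ι)
    (Y : FGModuleCat.{u} (Module.End Λ P)ᵐᵒᵖ) :
    ∃ X ∈ IIres (Λ := Λ) I 1, Nonempty ((P →ₗ[Λ] X) ≃ₗ[(Module.End Λ P)ᵐᵒᵖ] Y) := by
  have hart : IsArtinianRing Λ := isArtinianRing_of_artinAlgebra R
  have : Module.Finite Λ I := hι.finite R
  have := hι.1
  obtain ⟨n, τ, hτ⟩ := hι.exists_injective_hom hP Y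
  have := hP (FGModuleCat.of Λ (Fin n → I))
  have : Module.Finite (Module.End Λ P)ᵐᵒᵖ (P →ₗ[Λ] (Fin n → I)) := this
  obtain ⟨m, σ, hσ⟩ := hι.exists_injective_hom hP
    (FGModuleCat.of _ ((P →ₗ[Λ] (Fin n → I)) ⧸ LinearMap.range τ))
  obtain ⟨d, hd⟩ := ((hι.isRightFull hP).pi m (FGModuleCat.of Λ (Fin n → I))).2
    (σ ∘ₗ (LinearMap.range τ).mkQ)
  have hd : postcomp P d = σ ∘ₗ (LinearMap.range τ).mkQ := hd
  have hker : LinearMap.ker (postcomp P d) = LinearMap.range τ := by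
    rw [hd, LinearMap.ker_comp_of_ker_eq_bot _ (LinearMap.ker_eq_bot.2 hσ), Submodule.ker_mkQ]
  refine ⟨FGModuleCat.of Λ (LinearMap.ker d),
    mem_IIres_one_of_exact R (J₁ := FGModuleCat.of Λ (Fin m → I))
      (J₀ := FGModuleCat.of Λ (Fin n → I)) (inAdd_pi m) (inAdd_pi n)
      (η := (LinearMap.ker d).subtype) (Submodule.subtype_injective _)
      (LinearMap.exact_subtype_ker_map d), ?_⟩
  exact ⟨(homKerEquiv P d).trans ((LinearEquiv.ofEq _ _ hker).trans
    (LinearEquiv.ofInjective τ hτ).symm)⟩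

include R in
theorem IsInjectiveEnvelope.isEquivOn_isRightFull [Module.Finite Λ P] [Module.Projective Λ P]
    [IsArtinianRing (Module.End Λ P)ᵐᵒᵖ] (hι : IsInjectiveEnvelope ι) :
    IsEquivOn (homFunctor P hP) {X | IsRightFull (Λ := Λ) P X} where
  mem_of_summand h hY := IsRightFull.of_isSummand hY h
  mem_prod hA hB := IsRightFull.prod hA hB
  full {X _} _ hY := hY X
  dense Y := by
    have hart : IsArtinianRing Λ := isArtinianRing_of_artinAlgebra R
    obtain ⟨X, hX, e⟩ := hι.exists_mem_IIres_one hP R Y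
    exact ⟨X, .of_mem_IIres (hι.isRightFull hP) hX, e⟩

include hP R in
theorem IsInjectiveEnvelope.mem_IIres_one_iff [Module.Finite Λ P] [Module.Projective Λ P]
    [IsArtinianRing (Module.End Λ P)ᵐᵒᵖ] (hι : IsInjectiveEnvelope ι) {X : FGModuleCat.{u} Λ} :
    X ∈ IIres (Λ := Λ) I 1 ↔ IsRightFull (Λ := Λ) P X := by
  have hart : IsArtinianRing Λ := isArtinianRing_of_artinAlgebra R
  refine ⟨.of_mem_IIres (hι.isRightFull hP), fun hX => ?_⟩
  obtain ⟨X', hX', ⟨e⟩⟩ := hι.exists_mem_IIres_one hP R ((homFunctor P hP).obj X)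
  obtain ⟨e'⟩ := (hι.isEquivOn_isRightFull hP R).nonempty_equiv
    (IsRightFull.of_mem_IIres (hι.isRightFull hP) hX') hX e
  exact mem_IIres_iff.2 ((mem_IIres_iff.1 hX').of_equiv e'.symm)

include R in
/-- If `𝕀₁ = 𝕀_∞`, then `Hom(P, -)` restricts to an equivalence `𝕀₁ ≃ mod End(P)ᵒᵖ` that is
compatible with cosyzygies. -/
theorem IsInjectiveEnvelope.isShiftEquivOn_isRightFull [Module.Finite Λ P]
    [Module.Projective Λ P]
    (R' : Type v) [CommRing R'] [IsArtinianRing R'] [Algebra R' (Module.End Λ P)ᵐᵒᵖ]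
    [Module.Finite R' (Module.End Λ P)ᵐᵒᵖ] (hι : IsInjectiveEnvelope ι)
    (h : IIres (Λ := Λ) I 1 = IIres (Λ := Λ) I ⊤) :
    IsShiftEquivOn (homFunctor P hP) {X | IsRightFull (Λ := Λ) P X}
      (fun J : FGModuleCat.{u} Λ => Module.Injective Λ J) IsCosyzygy
      (fun J => Module.Injective (Module.End Λ P)ᵐᵒᵖ J) IsCosyzygy := by
  have hart : IsArtinianRing Λ := isArtinianRing_of_artinAlgebra R
  have hart' : IsArtinianRing (Module.End Λ P)ᵐᵒᵖ := isArtinianRing_of_artinAlgebra R'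
  have := hι.1
  have hI := hι.isRightFull hP
  have hmem : ∀ X : FGModuleCat.{u} Λ, IsRightFull (Λ := Λ) P X ↔ X ∈ IIres (Λ := Λ) I ⊤ :=
    fun X => by rw [← h, hι.mem_IIres_one_iff hP R]
  have hres : ∀ X : FGModuleCat.{u} Λ, IsRightFull (Λ := Λ) P X →
      ∃ (J : FGModuleCat.{u} Λ) (η : X →ₗ[Λ] J), InAdd (Λ := Λ) I J ∧ Function.Injective η ∧
        IsRightFull (Λ := Λ) P (J ⧸ LinearMap.range η) := fun X hX => by
    obtain ⟨J, η, -, hJ, hη, hK⟩ := (mem_IIres_iff.1 ((hmem X).1 hX)).exists_coker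
    exact ⟨J, η, hJ le_top, hη, (hmem (FGModuleCat.of Λ (J ⧸ LinearMap.range η))).2
      (mem_IIres_iff.2 (hK.mono fun i J hJ _ => hJ le_top))⟩
  -- The envelope is a retract under `X` of the add I term in `hres`, and the retraction passes to
  -- cokernels.
  have henv : ∀ {X J : FGModuleCat.{u} Λ} {f : X →ₗ[Λ] J}, IsRightFull (Λ := Λ) P X →
      IsInjectiveEnvelope f → InAdd (Λ := Λ) I J ∧
        IsRightFull (Λ := Λ) P (J ⧸ LinearMap.range f) := by
    intro X J f hX hf
    obtain ⟨J₀, η, hJ₀, hη, hK⟩ := hres X hX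
    obtain ⟨a, b, hba, ha, hb⟩ := hf.exists_retract hJ₀.injective hη
    refine ⟨hJ₀.of_isSummand ⟨a, b, hba⟩, hK.of_isSummand
      ⟨Submodule.mapQ _ _ a ?_, Submodule.mapQ _ _ b ?_, ?_⟩⟩
    · rintro _ ⟨x, rfl⟩
      exact ⟨x, (LinearMap.congr_fun ha x).symm⟩
    · rintro _ ⟨x, rfl⟩
      exact ⟨x, (LinearMap.congr_fun hb x).symm⟩
    · refine LinearMap.ext fun x => ?_
      obtain ⟨x, rfl⟩ := Submodule.mkQ_surjective _ x
      exact congrArg (Submodule.mkQ _) (LinearMap.congr_fun hba x)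
  exact
    { toIsEquivOn := hι.isEquivOn_isRightFull hP R
      isShift := isShift_injective R
      isShift' := isShift_injective R'
      shift_mem := by
        rintro X K hX ⟨J, f, hf, ⟨e⟩⟩
        exact (henv hX hf).2.of_isSummand (.of_equiv e)
      map_shift := by
        rintro X K hX ⟨J, f, hf, ⟨e⟩⟩
        obtain ⟨hJ, -⟩ := henv hX hf
        have hJ' := hI.of_inAdd hJ
        obtain ⟨c⟩ := nonempty_homCokerEquiv (P := P) (Submodule.mkQ_surjective _)
          (LinearMap.exact_map_mkQ_range f)
        refine ⟨(homFunctor P hP).obj J, (homFunctor P hP).map f, ?_,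
          ⟨((homFunctor P hP).mapEquiv (Y := FGModuleCat.of Λ (J ⧸ LinearMap.range f)) e).trans
            c.symm⟩⟩
        refine (isInjectiveEnvelope_iff_minimal (J := (homFunctor P hP).obj J)
          (M := (homFunctor P hP).obj X) (hι.injective_hom_of_inAdd hJ)
          (postcomp_injective hf.2.1)).2 fun w hw => ?_
        obtain ⟨w, rfl⟩ := (hJ' J).2 w
        exact (homFunctor P hP).map_bijective
          ((isInjectiveEnvelope_iff_minimal hf.1 hf.2.1).1 hf w ((hJ' X).1 hw))
      map_mem := by
        intro X hX
        obtain ⟨J, η, hJ, hη, -⟩ := hres X hX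
        constructor
        · intro hp
          have hp : Module.Injective (Module.End Λ P)ᵐᵒᵖ (P →ₗ[Λ] X) := hp
          obtain ⟨t, ht⟩ := hp.out (postcomp P η) (postcomp_injective hη) LinearMap.id
          obtain ⟨s, rfl⟩ := (hX J).2 t
          have hs : s ∘ₗ η = LinearMap.id := (hX X).1 (LinearMap.ext ht)
          have := hJ.injective
          exact (show IsSummand (Λ := Λ) X J from ⟨η, s, hs⟩).injective
        · intro hp
          have hp : Module.Injective Λ X := hp
          obtain ⟨s, hs⟩ := hp.out η hη LinearMap.id
          exact hι.injective_hom_of_inAdd (hJ.of_isSummand ⟨η, s, LinearMap.ext hs⟩)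
      common_summand := (isShift_injective R).common_summand R }

end Envelope

end IgusaTodorov

end

theorem theorem4p7 {R : Type v} [CommRing R] [IsArtinianRing R]
    {Λ : Type u} [Ring Λ] [Algebra R Λ] [Module.Finite R Λ]
    (P : Type u) [AddCommGroup P] [Module Λ P] [Module.Finite Λ P] [Module.Projective Λ P] :
    (IgusaTodorov.PPres (Λ := Λ) P 1 = IgusaTodorov.PPres (Λ := Λ) P ⊤ →
      IgusaTodorov.phiLDim (Module.End Λ P)ᵐᵒᵖ ≤ IgusaTodorov.phiLDim Λ ∧
      IgusaTodorov.psiLDim (Module.End Λ P)ᵐᵒᵖ ≤ IgusaTodorov.psiLDim Λ) ∧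
    (∀ (I : Type u) [AddCommGroup I] [Module Λ I]
      (ι : (P ⧸ (Ring.jacobson Λ • (⊤ : Submodule Λ P))) →ₗ[Λ] I),
      IgusaTodorov.IsInjectiveEnvelope ι →
      IgusaTodorov.IIres (Λ := Λ) I 1 = IgusaTodorov.IIres (Λ := Λ) I ⊤ →
      IgusaTodorov.phiRDim (Module.End Λ P)ᵐᵒᵖ ≤ IgusaTodorov.phiRDim Λ ∧
      IgusaTodorov.psiRDim (Module.End Λ P)ᵐᵒᵖ ≤ IgusaTodorov.psiRDim Λ) := by
  obtain ⟨⟨_, _⟩, hP⟩ := IgusaTodorov.exists_algebra_end (Λ := Λ) R P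
  have : IsArtinianRing (Module.End Λ P)ᵐᵒᵖ := IgusaTodorov.isArtinianRing_of_artinAlgebra R
  -- In the second half `R` appears twice, as a base ring for `Λ` and for Γ: injective envelopes in
  -- mod Γ must be finitely generated as well.
  exact ⟨fun h => (IgusaTodorov.isShiftEquivOn_isLeftFull (fun X => hP X) R h).phiLDim_le,
    fun I _ _ ι hι h => (hι.isShiftEquivOn_isRightFull (fun X => hP X) R R h).phiRDim_le⟩
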